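/- Let $C\subset\mathbb P^2=\mathbb P^2_{\mathbb C}$ be a smooth algebraic curve of degree $d\ge 1$, that is, the zero locus of a homogeneous polynomial of degree $d$ whose partial derivatives have no common zero on $C$. For a smooth, closed holomorphic curve $C$ embedded in a complex surface $S$, a holomorphic line field along $C$ is a holomorphic line subbundle $X\subset TS|_C$. Its order of tangency with $C$ at $p\in C$ is the order of vanishing at $p$ of the induced morphism $X\to NC=TS|_C/TC$ ($+\infty$ if this morphism vanishes identically near $p$), and $\mathrm{tang}(X,C)\in\{0,1,2,\dots\}\cup\{\infty\}$ is the sum of these orders over all $p\in C$. The line field is transverse to $C$ if $X_p\oplus T_pC=T_pS$ for every $p\in C$. The curve $C$ has a linearizable neighborhood in $S$ if there is a biholomorphic map from a neighborhood of $C$ in $S$ onto a neighborhood of the zero section in the total space of the normal bundle $NC$ which maps $C$ onto the zero section. 1. Every holomorphic line field $X$ along the smooth plane curve $C$ of degree $d$ satisfies $\mathrm{tang}(X,C)\ge (d-1)^2$. 2. If $d>1$, there is no holomorphic line field along $C$ transverse to $C$, and $C$ has no linearizable neighborhood in $\mathbb P^2$. 3. If $d>1$, let $P$ be any set of $d^2-2d$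 different points of $C$, let $S$ be the blow-up of $\mathbb P^2$ at the points of $P$, and let $\hat C\subset S$ be the strict transform of $C$, i.e. the closure in $S$ of the inverse image of $C\setminus P$. Then $\hat C$ is a smooth holomorphic curve embedded in $S$, there is no holomorphic line field along $\hat C$ transverse to $\hat C$, and $\hat C$ has no linearizable neighborhood in $S$. -/

import Mathlib

open scoped Manifold ContDiff Topology LinearAlgebra.Projectivization Matrix

noncomputable section

namespace CurvesInSurfaces

/-! ### Complex surfaces from holomorphically compatible charts -/

/-- A holomorphic atlas of a complex surface on a bare type `M`: partial bijections onto subsets of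
`ℂ²` that cover `M`, with open domains of the coordinate changes and holomorphic coordinate
changes. -/
structure SurfaceAtlas (M : Type*) where
  charts : Set (PartialEquiv M (ℂ × ℂ))
  cover : ∀ x, ∃ e ∈ charts, x ∈ e.source
  open_source : ∀ e ∈ charts, ∀ e' ∈ charts, IsOpen (e.symm.trans e').source
  holomorphic : ∀ e ∈ charts, ∀ e' ∈ charts,
    ContDiffOn ℂ ω (e.symm.trans e') (e.symm.trans e').source

namespace SurfaceAtlas

variable {M : Type*} (a : SurfaceAtlas M)

def core : ChartedSpaceCore (ℂ × ℂ) M where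
  atlas := a.charts
  chartAt x := (a.cover x).choose
  mem_chart_source x := (a.cover x).choose_spec.2
  chart_mem_atlas x := (a.cover x).choose_spec.1
  open_source e e' he he' := a.open_source e he e' he'
  continuousOn_toFun e e' he he' := (a.holomorphic e he e' he').continuousOn

theorem isManifold :
    @IsManifold ℂ _ (ℂ × ℂ) _ _ (ℂ × ℂ) _ 𝓘(ℂ, ℂ × ℂ) ω M a.core.toTopologicalSpace
      a.core.toChartedSpace := by
  let := a.core.toTopologicalSpace
  let := a.core.toChartedSpace
  apply isManifold_of_contDiffOn
  intro e e' he he'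
  obtain ⟨f, hf, rfl⟩ := Set.mem_iUnion₂.1 he
  obtain ⟨f', hf', rfl⟩ := Set.mem_iUnion₂.1 he'
  have := a.holomorphic f hf f' hf'
  simp only [modelWithCornersSelf_coe, modelWithCornersSelf_coe_symm, Set.range_id, Set.inter_univ,
    Set.preimage_id_eq, id_eq, Function.id_comp, Function.comp_id]
  exact this

end SurfaceAtlas

/-! ### Curves in a complex surface -/

section Surface

variable {S : Type*} [TopologicalSpace S] [ChartedSpace (ℂ × ℂ) S]

/-- A holomorphic chart `(x, y)` of the surface in which the set `C` is given by `y = 0`. -/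
def IsAdaptedChart (C : Set S) (φ : OpenPartialHomeomorph S (ℂ × ℂ)) : Prop :=
  φ ∈ IsManifold.maximalAtlas 𝓘(ℂ, ℂ × ℂ) ω S ∧ ∀ q ∈ φ.source, q ∈ C ↔ (φ q).2 = 0

variable (S) in
/-- A smooth holomorphic curve embedded in the surface `S`: a closed subset which is a
one-dimensional complex submanifold. -/
structure EmbeddedCurve where
  carrier : Set S
  isClosed : IsClosed carrier
  exists_chart : ∀ p ∈ carrier, ∃ φ, IsAdaptedChart carrier φ ∧ p ∈ φ.source

instance : CoeSort (EmbeddedCurve S) (Type _) := ⟨fun C => C.carrier⟩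

/-- The differential at `p` of a chart `φ` of the surface, with values in `ℂ²`. -/
def chartDeriv (φ : OpenPartialHomeomorph S (ℂ × ℂ)) (p : S) :
    TangentSpace 𝓘(ℂ, ℂ × ℂ) p →ₗ[ℂ] ℂ × ℂ :=
  (mfderiv 𝓘(ℂ, ℂ × ℂ) 𝓘(ℂ, ℂ × ℂ) φ p).toLinearMap

/-- The differential `dy` at `p` of the second coordinate of the chart `φ = (x, y)`. -/
def dNormal (φ : OpenPartialHomeomorph S (ℂ × ℂ)) (p : S) :
    TangentSpace 𝓘(ℂ, ℂ × ℂ) p →ₗ[ℂ] ℂ :=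
  LinearMap.snd ℂ ℂ ℂ ∘ₗ chartDeriv φ p

namespace EmbeddedCurve

variable (C : EmbeddedCurve S)

/-- The tangent line `T_p C ⊆ T_p S`, cut out by `dy = 0` for the charts `(x, y)` at `p` with
`C = {y = 0}` (any one of them suffices, see `tangentLine_eq_ker`). -/
def tangentLine (p : S) : Submodule ℂ (TangentSpace 𝓘(ℂ, ℂ × ℂ) p) :=
  ⨅ φ : {φ : OpenPartialHomeomorph S (ℂ × ℂ) // IsAdaptedChart C.carrier φ ∧ p ∈ φ.source},
    LinearMap.ker (dNormal φ.1 p)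

/-- The fibre at `p ∈ C` of the normal bundle `NC = TS|C / TC`. -/
abbrev normalFibre (p : S) : Type := TangentSpace 𝓘(ℂ, ℂ × ℂ) p ⧸ C.tangentLine p

/-- The total space of the normal bundle of `C` in `S`. -/
def NormalBundle : Type _ := Σ p : C, C.normalFibre p

/-- The zero section of the normal bundle. -/
def zeroSection : Set C.NormalBundle := Set.range fun p => ⟨p, 0⟩

theorem tangentLine_le_ker {φ : OpenPartialHomeomorph S (ℂ × ℂ)} {p : S}
    (hφ : IsAdaptedChart C.carrier φ) (hp : p ∈ φ.source) :
    C.tangentLine p ≤ LinearMap.ker (dNormal φ p) :=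
  iInf_le (fun φ : {φ : OpenPartialHomeomorph S (ℂ × ℂ) //
    IsAdaptedChart C.carrier φ ∧ p ∈ φ.source} => LinearMap.ker (dNormal φ.1 p)) ⟨φ, hφ, hp⟩

open Classical in
/-- The linear coordinate on the fibre of the normal bundle at `p` induced by `dy`, for an adapted
chart `(x, y)` at `p` (and `0` otherwise). -/
def normalCoord (φ : OpenPartialHomeomorph S (ℂ × ℂ)) (p : S) : C.normalFibre p →ₗ[ℂ] ℂ :=
  if h : IsAdaptedChart C.carrier φ ∧ p ∈ φ.source then
    (C.tangentLine p).liftQ (dNormal φ p) (C.tangentLine_le_ker h.1 h.2)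
  else 0

/-- `e` is the chart `(p, [v]) ↦ (x(p), dy(v))` of the total space of the normal bundle
attached to the adapted chart `φ = (x, y)`. -/
structure IsNormalChart (φ : OpenPartialHomeomorph S (ℂ × ℂ))
    (e : PartialEquiv C.NormalBundle (ℂ × ℂ)) : Prop where
  adapted : IsAdaptedChart C.carrier φ
  source_eq : e.source = {n | (n.1 : S) ∈ φ.source}
  target_eq : e.target = {z | (z.1, 0) ∈ φ.target}
  apply_eq : ∀ n ∈ e.source, e n = ((φ n.1).1, C.normalCoord φ n.1 n.2)

end EmbeddedCurve

theorem transition_contDiffOn {φ ψ : OpenPartialHomeomorph S (ℂ × ℂ)}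
    (hφ : φ ∈ IsManifold.maximalAtlas 𝓘(ℂ, ℂ × ℂ) ω S)
    (hψ : ψ ∈ IsManifold.maximalAtlas 𝓘(ℂ, ℂ × ℂ) ω S) :
    ContDiffOn ℂ ω (ψ ∘ φ.symm) (φ.target ∩ φ.symm ⁻¹' ψ.source) := by
  rw [← contMDiffOn_iff_contDiffOn]
  exact (contMDiffOn_of_mem_maximalAtlas hψ).comp
    ((contMDiffOn_symm_of_mem_maximalAtlas hφ).mono Set.inter_subset_left)
    fun z hz => hz.2

theorem transition_hasFDerivAt {φ ψ : OpenPartialHomeomorph S (ℂ × ℂ)}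
    (hφ : φ ∈ IsManifold.maximalAtlas 𝓘(ℂ, ℂ × ℂ) ω S)
    (hψ : ψ ∈ IsManifold.maximalAtlas 𝓘(ℂ, ℂ × ℂ) ω S) {z : ℂ × ℂ} (hz : z ∈ φ.target)
    (hz' : φ.symm z ∈ ψ.source) :
    HasFDerivAt (ψ ∘ φ.symm) (fderiv ℂ (ψ ∘ φ.symm) z) z := by
  have ho : IsOpen (φ.target ∩ φ.symm ⁻¹' ψ.source) :=
    φ.isOpen_inter_preimage_symm ψ.open_source
  have := ((transition_contDiffOn hφ hψ).contDiffAt (ho.mem_nhds ⟨hz, hz'⟩)).differentiableAt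
    (by simp)
  exact this.hasFDerivAt

theorem chartDeriv_transition {φ ψ : OpenPartialHomeomorph S (ℂ × ℂ)}
    (hφ : φ ∈ IsManifold.maximalAtlas 𝓘(ℂ, ℂ × ℂ) ω S)
    (hψ : ψ ∈ IsManifold.maximalAtlas 𝓘(ℂ, ℂ × ℂ) ω S) {p : S} (hp : p ∈ φ.source)
    (hp' : p ∈ ψ.source) (v : TangentSpace 𝓘(ℂ, ℂ × ℂ) p) :
    chartDeriv ψ p v = fderiv ℂ (ψ ∘ φ.symm) (φ p) (chartDeriv φ p v) := by
  have h1 : MDifferentiableAt 𝓘(ℂ, ℂ × ℂ) 𝓘(ℂ, ℂ × ℂ) φ p :=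
    (contMDiffAt_of_mem_maximalAtlas hφ hp).mdifferentiableAt (by simp)
  have h2 : HasMFDerivAt 𝓘(ℂ, ℂ × ℂ) 𝓘(ℂ, ℂ × ℂ) (ψ ∘ φ.symm) (φ p)
      (fderiv ℂ (ψ ∘ φ.symm) (φ p)) :=
    (transition_hasFDerivAt hφ hψ (φ.map_source hp)
      (by rwa [φ.left_inv hp])).hasMFDerivAt
  have h3 := h2.comp p h1.hasMFDerivAt
  have h4 : ψ =ᶠ[𝓝 p] (ψ ∘ φ.symm) ∘ φ := by
    filter_upwards [φ.open_source.mem_nhds hp] with q hq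
    simp [φ.left_inv hq]
  rw [chartDeriv, (h3.congr_of_eventuallyEq h4).mfderiv]
  rfl

theorem fderiv_transition_fst {C : Set S} {φ ψ : OpenPartialHomeomorph S (ℂ × ℂ)}
    (hφ : IsAdaptedChart C φ) (hψ : IsAdaptedChart C ψ) {z : ℂ} (hz : (z, 0) ∈ φ.target)
    (hz' : φ.symm (z, 0) ∈ ψ.source) (a : ℂ) :
    (fderiv ℂ (ψ ∘ φ.symm) (z, 0) (a, 0)).2 = 0 := by
  have h1 := transition_hasFDerivAt hφ.1 hψ.1 hz hz'
  have h2 : HasFDerivAt (fun t : ℂ => (t, (0 : ℂ))) (ContinuousLinearMap.inl ℂ ℂ ℂ) z :=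
    (ContinuousLinearMap.inl ℂ ℂ ℂ).hasFDerivAt
  have h3 := (hasFDerivAt_snd.comp (z, (0 : ℂ)) h1).comp z h2
  have ho : IsOpen (φ.target ∩ φ.symm ⁻¹' ψ.source) :=
    φ.isOpen_inter_preimage_symm ψ.open_source
  have h4 : ((Prod.snd ∘ ψ ∘ φ.symm) ∘ fun t : ℂ => (t, (0 : ℂ))) =ᶠ[𝓝 z] fun _ => 0 := by
    have hc : Continuous fun t : ℂ => (t, (0 : ℂ)) := by fun_prop
    filter_upwards [(ho.preimage hc).mem_nhds ⟨hz, hz'⟩] with t ht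
    have h5 : φ.symm (t, 0) ∈ C :=
      (hφ.2 _ (φ.map_target ht.1)).2 (by rw [φ.right_inv ht.1])
    exact (hψ.2 _ ht.2).1 h5
  have h5 := h3.unique ((hasFDerivAt_const (0 : ℂ) z).congr_of_eventuallyEq h4)
  exact congrArg (fun L : ℂ →L[ℂ] ℂ => L a) h5

theorem dNormal_transition {C : Set S} {φ ψ : OpenPartialHomeomorph S (ℂ × ℂ)}
    (hφ : IsAdaptedChart C φ) (hψ : IsAdaptedChart C ψ) {p : S} (hC : p ∈ C)
    (hp : p ∈ φ.source) (hp' : p ∈ ψ.source) (v : TangentSpace 𝓘(ℂ, ℂ × ℂ) p) :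
    dNormal ψ p v = (fderiv ℂ (ψ ∘ φ.symm) ((φ p).1, 0) (0, dNormal φ p v)).2 := by
  have h0 : φ p = ((φ p).1, 0) := Prod.ext rfl ((hφ.2 p hp).1 hC)
  have h1 : chartDeriv φ p v = ((chartDeriv φ p v).1, 0) + (0, dNormal φ p v) := by
    ext <;> simp [dNormal]
  have h2 : dNormal ψ p v = (chartDeriv ψ p v).2 := rfl
  rw [h2, chartDeriv_transition hφ.1 hψ.1 hp hp', h1, map_add, Prod.snd_add, h0,
    fderiv_transition_fst hφ hψ (by rw [← h0]; exact φ.map_source hp)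
      (by rwa [← h0, φ.left_inv hp]), zero_add]

namespace EmbeddedCurve

variable (C : EmbeddedCurve S)

theorem tangentLine_eq_ker {φ : OpenPartialHomeomorph S (ℂ × ℂ)} {p : S} (hC : p ∈ C.carrier)
    (hφ : IsAdaptedChart C.carrier φ) (hp : p ∈ φ.source) :
    C.tangentLine p = LinearMap.ker (dNormal φ p) := by
  refine le_antisymm (C.tangentLine_le_ker hφ hp) (le_iInf fun ψ v hv => ?_)
  rw [LinearMap.mem_ker] at hv ⊢
  rw [dNormal_transition hφ ψ.2.1 hC hp ψ.2.2, hv]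
  exact congrArg Prod.snd (map_zero _)

theorem normalCoord_mk {φ : OpenPartialHomeomorph S (ℂ × ℂ)} {p : S}
    (hφ : IsAdaptedChart C.carrier φ) (hp : p ∈ φ.source) (v : TangentSpace 𝓘(ℂ, ℂ × ℂ) p) :
    C.normalCoord φ p (Submodule.Quotient.mk v) = dNormal φ p v := by
  rw [normalCoord, dif_pos ⟨hφ, hp⟩]
  rfl

theorem normalCoord_bijective {φ : OpenPartialHomeomorph S (ℂ × ℂ)} {p : S} (hC : p ∈ C.carrier)
    (hφ : IsAdaptedChart C.carrier φ) (hp : p ∈ φ.source) :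
    Function.Bijective (C.normalCoord φ p) := by
  constructor
  · rw [injective_iff_map_eq_zero]
    intro n hn
    induction n using Submodule.Quotient.induction_on with
    | H v =>
      rw [normalCoord_mk C hφ hp] at hn
      rw [Submodule.Quotient.mk_eq_zero, C.tangentLine_eq_ker hC hφ hp]
      exact hn
  · intro t
    have hd : φ.MDifferentiable 𝓘(ℂ, ℂ × ℂ) 𝓘(ℂ, ℂ × ℂ) :=
      ⟨(contMDiffOn_of_mem_maximalAtlas hφ.1).mdifferentiableOn (by simp),
        (contMDiffOn_symm_of_mem_maximalAtlas hφ.1).mdifferentiableOn (by simp)⟩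
    obtain ⟨v, hv⟩ := hd.mfderiv_surjective hp ((0, t) : ℂ × ℂ)
    refine ⟨Submodule.Quotient.mk v, ?_⟩
    rw [normalCoord_mk C hφ hp]
    exact congrArg Prod.snd hv

theorem normalCoord_transition {φ ψ : OpenPartialHomeomorph S (ℂ × ℂ)}
    (hφ : IsAdaptedChart C.carrier φ) (hψ : IsAdaptedChart C.carrier ψ) {p : S}
    (hC : p ∈ C.carrier) (hp : p ∈ φ.source) (hp' : p ∈ ψ.source) (n : C.normalFibre p) :
    C.normalCoord ψ p n =
      (fderiv ℂ (ψ ∘ φ.symm) ((φ p).1, 0) (0, C.normalCoord φ p n)).2 := by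
  induction n using Submodule.Quotient.induction_on with
  | H v =>
    rw [normalCoord_mk C hφ hp, normalCoord_mk C hψ hp', dNormal_transition hφ hψ hC hp hp']

theorem exists_isNormalChart {φ : OpenPartialHomeomorph S (ℂ × ℂ)} {p : S} (hC : p ∈ C.carrier)
    (hφ : IsAdaptedChart C.carrier φ) : ∃ e, C.IsNormalChart φ e := by
  have : Nonempty C.NormalBundle := ⟨⟨⟨p, hC⟩, 0⟩⟩
  have hb : Set.BijOn
      (fun n : C.NormalBundle => ((φ n.1).1, C.normalCoord φ n.1 n.2))
      {n | (n.1 : S) ∈ φ.source} {z | (z.1, 0) ∈ φ.target} := by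
    have h0 : ∀ q : C, (q : S) ∈ φ.source → φ q = ((φ q).1, 0) := fun q hq =>
      Prod.ext rfl ((hφ.2 q hq).1 q.2)
    refine ⟨fun n hn => ?_, ?_, ?_⟩
    · change (_, _) ∈ φ.target
      rw [← h0 n.1 hn]
      exact φ.map_source hn
    · rintro ⟨q, n⟩ hn ⟨q', n'⟩ hn' h
      simp only [Prod.mk.injEq] at h
      have hq : q = q' := by
        refine Subtype.ext (φ.injOn hn hn' ?_)
        rw [h0 q hn, h0 q' hn', h.1]
      subst hq
      rw [(C.normalCoord_bijective q.2 hφ hn).1 h.2]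
    · rintro ⟨z, t⟩ hz
      have hq : φ.symm (z, 0) ∈ C.carrier :=
        (hφ.2 _ (φ.map_target hz)).2 (by rw [φ.right_inv hz])
      obtain ⟨n, hn⟩ := (C.normalCoord_bijective hq hφ (φ.map_target hz)).2 t
      refine ⟨⟨⟨φ.symm (z, 0), hq⟩, n⟩, φ.map_target hz, ?_⟩
      simp only [hn, φ.right_inv hz]
  exact ⟨hb.toPartialEquiv _ _ _, hφ, rfl, rfl, fun n _ => rfl⟩

theorem IsNormalChart.symm_base {C : EmbeddedCurve S} {φ : OpenPartialHomeomorph S (ℂ × ℂ)}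
    {e : PartialEquiv C.NormalBundle (ℂ × ℂ)} (he : C.IsNormalChart φ e) {z : ℂ × ℂ}
    (hz : z ∈ e.target) : ((e.symm z).1 : S) ∈ φ.source ∧
      ((e.symm z).1 : S) = φ.symm (z.1, 0) ∧ φ (e.symm z).1 = (z.1, 0) := by
  have hs : e.symm z ∈ e.source := e.map_target hz
  have h4 := he.apply_eq _ hs
  rw [e.right_inv hz] at h4
  have hp : ((e.symm z).1 : S) ∈ φ.source := by
    rw [he.source_eq] at hs
    exact hs
  have h5 : φ (e.symm z).1 = (z.1, 0) :=
    Prod.ext (congrArg Prod.fst h4).symm ((he.adapted.2 _ hp).1 (e.symm z).1.2)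
  exact ⟨hp, by rw [← h5, φ.left_inv hp], h5⟩

theorem transition_source {φ ψ : OpenPartialHomeomorph S (ℂ × ℂ)}
    {e e' : PartialEquiv C.NormalBundle (ℂ × ℂ)} (he : C.IsNormalChart φ e)
    (he' : C.IsNormalChart ψ e') : (e.symm.trans e').source =
      (fun z : ℂ × ℂ => (z.1, (0 : ℂ))) ⁻¹' (φ.target ∩ φ.symm ⁻¹' ψ.source) := by
  ext z
  have h0 : z ∈ (e.symm.trans e').source ↔ z ∈ e.target ∧ e.symm z ∈ e'.source := Iff.rfl
  rw [h0, Set.mem_preimage, Set.mem_inter_iff, he.target_eq, he'.source_eq]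
  refine and_congr_right fun hz => ?_
  have hz1 : z ∈ e.target := by rw [he.target_eq]; exact hz
  rw [Set.mem_preimage, ← (he.symm_base hz1).2.1]
  rfl

/-- The complex surface structure on the total space of the normal bundle. -/
def normalAtlas : SurfaceAtlas C.NormalBundle where
  charts := {e | ∃ φ, C.IsNormalChart φ e}
  cover n := by
    obtain ⟨φ, hφ, hp⟩ := C.exists_chart n.1 n.1.2
    obtain ⟨e, he⟩ := C.exists_isNormalChart n.1.2 hφ
    exact ⟨e, ⟨φ, he⟩, by rw [he.source_eq]; exact hp⟩
  open_source := by
    rintro e ⟨φ, he⟩ e' ⟨ψ, he'⟩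
    rw [C.transition_source he he']
    have hc : Continuous fun z : ℂ × ℂ => (z.1, (0 : ℂ)) := by fun_prop
    exact (φ.isOpen_inter_preimage_symm ψ.open_source).preimage hc
  holomorphic := by
    rintro e ⟨φ, he⟩ e' ⟨ψ, he'⟩
    have ho : IsOpen (φ.target ∩ φ.symm ⁻¹' ψ.source) :=
      φ.isOpen_inter_preimage_symm ψ.open_source
    have hT := transition_contDiffOn he.adapted.1 he'.adapted.1
    have hc : ContDiffOn ℂ ω (fun z : ℂ × ℂ => (z.1, (0 : ℂ))) (e.symm.trans e').source := by
      fun_prop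
    have hm : Set.MapsTo (fun z : ℂ × ℂ => (z.1, (0 : ℂ))) (e.symm.trans e').source
        (φ.target ∩ φ.symm ⁻¹' ψ.source) := by
      rw [C.transition_source he he']
      exact fun z hz => hz
    have h1 := hT.comp hc hm
    have h2 := (hT.fderiv_of_isOpen (m := ω) ho (by simp)).comp hc hm
    have h3 : ContDiffOn ℂ ω (fun z : ℂ × ℂ =>
        fderiv ℂ (ψ ∘ φ.symm) (z.1, 0) ((0 : ℂ), z.2)) (e.symm.trans e').source :=
      h2.clm_apply (by fun_prop)
    refine (h1.fst.prodMk h3.snd).congr fun z hz => ?_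
    have hz1 : z ∈ e.target := hz.1
    have hz2 : e.symm z ∈ e'.source := hz.2
    have hs : e.symm z ∈ e.source := e.map_target hz1
    have h4 := he.apply_eq _ hs
    rw [e.right_inv hz1] at h4
    have h5 := he'.apply_eq _ hz2
    obtain ⟨hp, h6, h7⟩ := he.symm_base hz1
    have hp' : ((e.symm z).1 : S) ∈ ψ.source := by
      rw [he'.source_eq] at hz2
      exact hz2
    change e' (e.symm z) = _
    rw [h5, C.normalCoord_transition he.adapted he'.adapted (e.symm z).1.2 hp hp']
    have h8 := congrArg Prod.snd h4
    simp only at h8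
    rw [← h8, h7, h6]
    rfl

instance : TopologicalSpace C.NormalBundle := C.normalAtlas.core.toTopologicalSpace

instance : ChartedSpace (ℂ × ℂ) C.NormalBundle := C.normalAtlas.core.toChartedSpace

instance : IsManifold 𝓘(ℂ, ℂ × ℂ) ω C.NormalBundle := C.normalAtlas.isManifold

/-- `C` has a linearizable neighbourhood in `S`: some neighbourhood of `C` in `S` is biholomorphic
to a neighbourhood of the zero section in the total space of the normal bundle of `C`, by a map
sending `C` onto the zero section. -/
def HasLinearizableNhd : Prop :=
  ∃ Φ : PartialDiffeomorph 𝓘(ℂ, ℂ × ℂ) 𝓘(ℂ, ℂ × ℂ) S C.NormalBundle ω,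
    C.carrier ⊆ Φ.source ∧ Φ '' C.carrier = C.zeroSection

end EmbeddedCurve

/-! ### Line fields along a curve -/

/-- Near the point `p` of `C`, the family of subspaces `X q ⊆ T_q S`, `q ∈ C`, is spanned by the
nowhere vanishing holomorphic section `a(x) ∂/∂x + b(x) ∂/∂y` of `TS|C`, where `φ = (x, y)` is an
adapted chart at `p` (so that `x` is a coordinate on `C`). -/
structure IsLocalGenerator (C : EmbeddedCurve S)
    (X : ∀ q : C, Submodule ℂ (TangentSpace 𝓘(ℂ, ℂ × ℂ) (q : S))) (p : C)
    (φ : OpenPartialHomeomorph S (ℂ × ℂ)) (a b : ℂ → ℂ) : Prop where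
  adapted : IsAdaptedChart C.carrier φ
  mem_source : (p : S) ∈ φ.source
  analyticAt_fst : AnalyticAt ℂ a (φ p).1
  analyticAt_snd : AnalyticAt ℂ b (φ p).1
  ne_zero : (a (φ p).1, b (φ p).1) ≠ 0
  span_eq : ∀ᶠ q in 𝓝 p,
    (X q).map (chartDeriv φ q) = Submodule.span ℂ {(a (φ q).1, b (φ q).1)}

/-- A holomorphic line field along `C`: a holomorphic line subbundle of `TS|C`. -/
structure LineField (C : EmbeddedCurve S) where
  line : ∀ q : C, Submodule ℂ (TangentSpace 𝓘(ℂ, ℂ × ℂ) (q : S))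
  holomorphic : ∀ p : C, ∃ φ a b, IsLocalGenerator C line p φ a b

namespace LineField

variable {C : EmbeddedCurve S} (X : LineField C)

/-- The order of tangency of `X` and `C` at `p`: the order of vanishing at `p` of the morphism of
line bundles `X → NC = TS|C / TC`. In terms of an adapted chart `(x, y)` and of a local generator
`a(x) ∂/∂x + b(x) ∂/∂y` of `X`, this morphism is given by the function `b`; the order does not
depend on these choices. It is `⊤` when `X = TC` near `p`. -/
def tangOrder (p : C) : ℕ∞ :=
  sInf {n | ∃ φ a b, IsLocalGenerator C X.line p φ a b ∧ n = analyticOrderAt b (φ p).1}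

/-- The total number `tang(X, C)` of tangencies between `X` and `C`, counted with order: the sum
over `p ∈ C` of the orders of tangency, i.e. the supremum of the finite partial sums. -/
def tang : ℕ∞ := ⨆ s : Finset C, ∑ p ∈ s, X.tangOrder p

/-- `X` is transverse to `C`: at every point of `C`, the tangent space of the surface is the direct
sum of the line `X` and the tangent line of `C`. -/
def IsTransverse : Prop := ∀ p : C, IsCompl (X.line p) (C.tangentLine p)

end LineField

end Surface

/-! ### The projective plane -/

/-- The complex projective plane `ℙ²`, as the set of lines through the origin of `ℂ³`. -/
abbrev ProjectivePlane : Type := ℙ ℂ (Fin 3 → ℂ)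

namespace ProjectivePlane

/-- The quotient `⟨a, x⟩ / ⟨b, x⟩` of two linear forms at the point `x` of `ℙ²`. -/
def ratio (a b : Fin 3 → ℂ) (x : ProjectivePlane) : ℂ := (a ⬝ᵥ x.rep) / (b ⬝ᵥ x.rep)

theorem dot_rep_mk (b v : Fin 3 → ℂ) (hv : v ≠ 0) :
    b ⬝ᵥ (Projectivization.mk ℂ v hv).rep ≠ 0 ↔ b ⬝ᵥ v ≠ 0 := by
  obtain ⟨c, hc⟩ := Projectivization.exists_smul_eq_mk_rep ℂ v hv
  rw [← hc, dotProduct_smul, Ne, smul_eq_zero_iff_eq]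

theorem ratio_mk (a b v : Fin 3 → ℂ) (hv : v ≠ 0) :
    ratio a b (Projectivization.mk ℂ v hv) = (a ⬝ᵥ v) / (b ⬝ᵥ v) := by
  obtain ⟨c, hc⟩ := Projectivization.exists_smul_eq_mk_rep ℂ v hv
  have : (c : ℂ) ≠ 0 := c.ne_zero
  rw [ratio, ← hc, dotProduct_smul, dotProduct_smul, Units.smul_def, Units.smul_def, smul_eq_mul,
    smul_eq_mul,
    mul_div_mul_left _ _ this]

theorem mul_inv_mulVec {A : Matrix (Fin 3) (Fin 3) ℂ} (hA : A.det ≠ 0) (v : Fin 3 → ℂ) :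
    A *ᵥ (A⁻¹ *ᵥ v) = v := by
  rw [Matrix.mulVec_mulVec, Matrix.mul_nonsing_inv _ (isUnit_iff_ne_zero.2 hA), Matrix.one_mulVec]

theorem inv_mul_mulVec {A : Matrix (Fin 3) (Fin 3) ℂ} (hA : A.det ≠ 0) (v : Fin 3 → ℂ) :
    A⁻¹ *ᵥ (A *ᵥ v) = v := by
  rw [Matrix.mulVec_mulVec, Matrix.nonsing_inv_mul _ (isUnit_iff_ne_zero.2 hA), Matrix.one_mulVec]

/-- The vector of `ℂ³` whose coordinates with respect to the linear forms `A 0`, `A 1`, `A 2`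
are `1`, `s`, `t`. -/
def affineVec (A : Matrix (Fin 3) (Fin 3) ℂ) (s t : ℂ) : Fin 3 → ℂ := A⁻¹ *ᵥ ![1, s, t]

theorem dot_affineVec {A : Matrix (Fin 3) (Fin 3) ℂ} (hA : A.det ≠ 0) (s t : ℂ) (i : Fin 3) :
    A i ⬝ᵥ affineVec A s t = ![1, s, t] i :=
  congrFun (mul_inv_mulVec hA ![1, s, t]) i

theorem affineVec_ne_zero {A : Matrix (Fin 3) (Fin 3) ℂ} (hA : A.det ≠ 0) (s t : ℂ) :
    affineVec A s t ≠ 0 := by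
  intro h
  have := dot_affineVec hA s t 0
  simp [h] at this

theorem eq_mk_affineVec {A : Matrix (Fin 3) (Fin 3) ℂ} (hA : A.det ≠ 0) {x : ProjectivePlane}
    (hx : A 0 ⬝ᵥ x.rep ≠ 0) :
    x = Projectivization.mk ℂ (affineVec A (ratio (A 1) (A 0) x) (ratio (A 2) (A 0) x))
      (affineVec_ne_zero hA _ _) := by
  conv_lhs => rw [← Projectivization.mk_rep x]
  rw [Projectivization.mk_eq_mk_iff']
  refine ⟨A 0 ⬝ᵥ x.rep, ?_⟩
  rw [affineVec, ← Matrix.mulVec_smul]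
  conv_rhs => rw [← inv_mul_mulVec hA x.rep]
  congr 1
  ext i
  fin_cases i
  · simp [Matrix.mulVec]
  · simpa [Matrix.mulVec, ratio] using mul_div_cancel₀ _ hx
  · simpa [Matrix.mulVec, ratio] using mul_div_cancel₀ _ hx

/-- The affine chart `x ↦ (⟨A 1, x⟩ / ⟨A 0, x⟩, ⟨A 2, x⟩ / ⟨A 0, x⟩)` of `ℙ²` given by three
independent linear forms, the rows of the invertible matrix `A`. -/
def affineChart (A : Matrix (Fin 3) (Fin 3) ℂ) (hA : A.det ≠ 0) :
    PartialEquiv ProjectivePlane (ℂ × ℂ) where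
  toFun x := (ratio (A 1) (A 0) x, ratio (A 2) (A 0) x)
  invFun z := Projectivization.mk ℂ (affineVec A z.1 z.2) (affineVec_ne_zero hA _ _)
  source := {x | A 0 ⬝ᵥ x.rep ≠ 0}
  target := Set.univ
  map_source' _ _ := Set.mem_univ _
  map_target' z _ := by
    change _ ≠ _
    rw [dot_rep_mk, dot_affineVec hA]
    simp
  left_inv' x hx := (eq_mk_affineVec hA hx).symm
  right_inv' z _ := by
    simp only [ratio_mk, dot_affineVec hA]
    simp

theorem exists_affine_forms (x : ProjectivePlane) :
    ∃ A : Matrix (Fin 3) (Fin 3) ℂ, A.det ≠ 0 ∧ A 0 ⬝ᵥ x.rep ≠ 0 := by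
  obtain ⟨i, hi⟩ := Function.ne_iff.1 x.rep_nonzero
  refine ⟨(Equiv.swap 0 i).permMatrix ℂ, ?_, ?_⟩
  · rw [Matrix.det_permutation]
    simp [Units.ne_zero]
  · have : ((Equiv.swap 0 i).permMatrix ℂ *ᵥ x.rep) 0 = x.rep i := by
      rw [Matrix.permMatrix_mulVec]
      simp
    change ((Equiv.swap 0 i).permMatrix ℂ *ᵥ x.rep) 0 ≠ 0
    rw [this]
    exact hi

theorem contDiff_dot {v : ℂ × ℂ → Fin 3 → ℂ} (hv : ContDiff ℂ ω v) (a : Fin 3 → ℂ) :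
    ContDiff ℂ ω fun z => a ⬝ᵥ v z := by
  have h : ∀ i, ContDiff ℂ ω fun z => v z i := contDiff_pi.1 hv
  simp only [dotProduct, Fin.sum_univ_three]
  exact ((contDiff_const.mul (h 0)).add (contDiff_const.mul (h 1))).add
    (contDiff_const.mul (h 2))

theorem contDiff_affineVec (A : Matrix (Fin 3) (Fin 3) ℂ) {f g : ℂ × ℂ → ℂ}
    (hf : ContDiff ℂ ω f) (hg : ContDiff ℂ ω g) :
    ContDiff ℂ ω fun z => affineVec A (f z) (g z) := by
  refine contDiff_pi.2 fun i => ?_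
  simp only [affineVec, Matrix.mulVec, dotProduct, Fin.sum_univ_three, Matrix.cons_val_zero,
    Matrix.cons_val_one, Matrix.cons_val]
  fun_prop

/-- The complex surface structure of `ℙ²`: the affine charts of all linear coordinate systems. -/
def surfaceAtlas : SurfaceAtlas ProjectivePlane where
  charts := {e | ∃ A hA, e = affineChart A hA}
  cover x := by
    obtain ⟨A, hA, hx⟩ := exists_affine_forms x
    exact ⟨_, ⟨A, hA, rfl⟩, hx⟩
  open_source := by
    rintro _ ⟨A, hA, rfl⟩ _ ⟨B, hB, rfl⟩
    have : ((affineChart A hA).symm.trans (affineChart B hB)).source =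
        {z | B 0 ⬝ᵥ affineVec A z.1 z.2 ≠ 0} := by
      ext z
      exact (and_iff_right (Set.mem_univ _)).trans (dot_rep_mk _ _ _)
    rw [this]
    exact isOpen_ne_fun
      (contDiff_dot (contDiff_affineVec A contDiff_fst contDiff_snd) _).continuous
      continuous_const
  holomorphic := by
    rintro _ ⟨A, hA, rfl⟩ _ ⟨B, hB, rfl⟩
    have hV := contDiff_affineVec A contDiff_fst contDiff_snd
    have h0 : ∀ z ∈ ((affineChart A hA).symm.trans (affineChart B hB)).source,
        B 0 ⬝ᵥ affineVec A z.1 z.2 ≠ 0 := fun z hz => (dot_rep_mk _ _ _).1 hz.2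
    refine ContDiffOn.congr
      (((contDiff_dot hV (B 1)).contDiffOn.div (contDiff_dot hV (B 0)).contDiffOn h0).prodMk
        ((contDiff_dot hV (B 2)).contDiffOn.div (contDiff_dot hV (B 0)).contDiffOn h0))
      fun z _ => ?_
    exact Prod.ext (ratio_mk _ _ _ _) (ratio_mk _ _ _ _)

instance : TopologicalSpace ProjectivePlane := surfaceAtlas.core.toTopologicalSpace

instance : ChartedSpace (ℂ × ℂ) ProjectivePlane := surfaceAtlas.core.toChartedSpace

instance : IsManifold 𝓘(ℂ, ℂ × ℂ) ω ProjectivePlane := surfaceAtlas.isManifold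

end ProjectivePlane

/-- `C` is a smooth plane curve of degree `d`: the zero locus in `ℙ²` of a homogeneous polynomial
`F` of degree `d` whose partial derivatives have no common zero on the curve. -/
def IsSmoothPlaneCurve (C : Set ProjectivePlane) (d : ℕ) : Prop :=
  ∃ F : MvPolynomial (Fin 3) ℂ, F.IsHomogeneous d ∧
    C = {x | MvPolynomial.eval x.rep F = 0} ∧
    ∀ v : Fin 3 → ℂ, v ≠ 0 → MvPolynomial.eval v F = 0 →
      ∃ i, MvPolynomial.eval v (MvPolynomial.pderiv i F) ≠ 0

/-! ### Blow-ups of the projective plane -/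

/-- The blow-up of `ℙ²` at the finitely many points of `P`, as an incidence variety: a point of
the blow-up consists of a point of `ℙ²` and, for each centre `p ∈ P`, of a projective line through
`p` and that point. Here `ℓ : ℙ²` represents the projective line `{x | ⟨ℓ, x⟩ = 0}`. Thus the line
is determined by the point if the point is not `p`, and is an arbitrary direction at `p`
otherwise. -/
@[ext]
structure BlowUp (P : Finset ProjectivePlane) where
  point : ProjectivePlane
  line : P → ProjectivePlane
  center_mem : ∀ p : P, (p : ProjectivePlane).orthogonal (line p)
  point_mem : ∀ p : P, point.orthogonal (line p)

namespace BlowUp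

open ProjectivePlane Classical

variable {P : Finset ProjectivePlane}

/-- A chart of the blow-up outside the exceptional lines: the affine chart of `ℙ²` given by the
linear forms `A 0`, `A 1`, `A 2`. -/
structure IsOrdinaryChart (A : Matrix (Fin 3) (Fin 3) ℂ)
    (e : PartialEquiv (BlowUp P) (ℂ × ℂ)) : Prop where
  det_ne_zero : A.det ≠ 0
  source_eq : e.source = {x | A 0 ⬝ᵥ x.point.rep ≠ 0 ∧ ∀ q ∈ P, x.point ≠ q}
  target_eq : e.target =
    {z | ∀ q ∈ P, ∀ h, Projectivization.mk ℂ (affineVec A z.1 z.2) h ≠ q}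
  apply_eq : ∀ x ∈ e.source,
    e x = (ratio (A 1) (A 0) x.point, ratio (A 2) (A 0) x.point)

/-- A chart `(x, u)` of the blow-up near the exceptional line over `p`. The linear forms `A 1` and
`A 2` vanish at `p`, so that `x = A 1 / A 0`, `y = A 2 / A 0` are affine coordinates of `ℙ²`
centred at `p`; the coordinate `u` is the slope of the line through `p`, given by
`A 2 = u • A 1`. So `y = x u`, and the exceptional line is `x = 0`. -/
structure IsExceptionalChart (p : P) (A : Matrix (Fin 3) (Fin 3) ℂ)
    (e : PartialEquiv (BlowUp P) (ℂ × ℂ)) : Prop where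
  det_ne_zero : A.det ≠ 0
  center_one : A 1 ⬝ᵥ p.1.rep = 0
  center_two : A 2 ⬝ᵥ p.1.rep = 0
  source_eq : e.source = {x | A 0 ⬝ᵥ x.point.rep ≠ 0 ∧ (∀ q ∈ P, q ≠ p → x.point ≠ q) ∧
    A⁻¹ᵀ 2 ⬝ᵥ (x.line p).rep ≠ 0}
  target_eq : e.target =
    {z | ∀ q ∈ P, q ≠ p → ∀ h, Projectivization.mk ℂ (affineVec A z.1 (z.1 * z.2)) h ≠ q}
  apply_eq : ∀ x ∈ e.source,
    e x = (ratio (A 1) (A 0) x.point, -ratio (A⁻¹ᵀ 1) (A⁻¹ᵀ 2) (x.line p))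

theorem line_eq_cross (x : BlowUp P) (q : P) (h : x.point ≠ q) :
    x.line q = Projectivization.cross (q : ProjectivePlane) x.point := by
  rcases Configuration.ofField.eq_or_eq_of_orthogonal (x.center_mem q) (x.point_mem q)
    (Projectivization.orthogonal_cross_left h.symm)
    (Projectivization.orthogonal_cross_right h.symm) with h1 | h1
  · exact absurd h1.symm h
  · exact h1

theorem line_eq_mk (x : BlowUp P) (q : P) (h : x.point ≠ q) {v : Fin 3 → ℂ} {hv : v ≠ 0}
    (hx : x.point = Projectivization.mk ℂ v hv) :
    ∃ hw, x.line q = Projectivization.mk ℂ (crossProduct q.1.rep v) hw := by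
  rw [x.line_eq_cross q h, hx]
  have hq : Projectivization.mk ℂ q.1.rep q.1.rep_nonzero = q.1 := Projectivization.mk_rep _
  rw [hx, ← hq] at h
  conv => enter [1, hw, 1, 1]; rw [← hq]
  exact ⟨_, Projectivization.cross_mk_of_ne _ _ h.symm⟩

/-- Homogeneous coordinates of the point and of the lines, as functions of the two coordinates. -/
structure Lifts (e : PartialEquiv (BlowUp P) (ℂ × ℂ)) (V : ℂ × ℂ → Fin 3 → ℂ)
    (W : P → ℂ × ℂ → Fin 3 → ℂ) : Prop where
  contDiff_point : ContDiff ℂ ω V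
  contDiff_line : ∀ q, ContDiff ℂ ω (W q)
  isOpen_target : IsOpen e.target
  point_eq : ∀ z ∈ e.target, ∃ h, (e.symm z).point = Projectivization.mk ℂ (V z) h
  line_eq : ∀ z ∈ e.target, ∀ q, ∃ h, (e.symm z).line q = Projectivization.mk ℂ (W q z) h

theorem contDiff_cross {v : ℂ × ℂ → Fin 3 → ℂ} (hv : ContDiff ℂ ω v) (a : Fin 3 → ℂ) :
    ContDiff ℂ ω fun z => crossProduct a (v z) := by
  exact (LinearMap.toContinuousLinearMap (crossProduct a)).contDiff.comp hv

theorem mk_eq_iff_cross (v : Fin 3 → ℂ) (hv : v ≠ 0) (q : ProjectivePlane) :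
    Projectivization.mk ℂ v hv = q ↔ crossProduct q.rep v = 0 := by
  conv_lhs => rw [← Projectivization.mk_rep q]
  rw [eq_comm, Projectivization.mk_eq_mk_iff_crossProduct_eq_zero]

theorem isOpen_avoid {v : ℂ × ℂ → Fin 3 → ℂ} (hv : ContDiff ℂ ω v)
    (Q : Finset ProjectivePlane) : IsOpen {z | ∀ q ∈ Q, crossProduct q.rep (v z) ≠ 0} := by
  have : {z | ∀ q ∈ Q, crossProduct q.rep (v z) ≠ 0} =
      ⋂ q ∈ Q, {z | crossProduct q.rep (v z) ≠ 0} :=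
    by ext z; simp only [Set.mem_iInter]; rfl
  rw [this]
  exact isOpen_biInter_finset fun q _ =>
    isOpen_ne_fun (contDiff_cross hv _).continuous continuous_const

theorem IsOrdinaryChart.point_eq {A : Matrix (Fin 3) (Fin 3) ℂ}
    {e : PartialEquiv (BlowUp P) (ℂ × ℂ)} (he : IsOrdinaryChart A e) {z : ℂ × ℂ}
    (hz : z ∈ e.target) : (e.symm z).point =
      Projectivization.mk ℂ (affineVec A z.1 z.2) (affineVec_ne_zero he.det_ne_zero _ _) := by
  have hs := e.map_target hz
  have h1 := he.apply_eq _ hs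
  rw [e.right_inv hz] at h1
  rw [he.source_eq] at hs
  have h2 : ratio (A 1) (A 0) (e.symm z).point = z.1 := (congrArg Prod.fst h1).symm
  have h3 : ratio (A 2) (A 0) (e.symm z).point = z.2 := (congrArg Prod.snd h1).symm
  have h4 := eq_mk_affineVec he.det_ne_zero hs.1
  simp only [h2, h3] at h4
  exact h4

theorem IsOrdinaryChart.lifts {A : Matrix (Fin 3) (Fin 3) ℂ}
    {e : PartialEquiv (BlowUp P) (ℂ × ℂ)} (he : IsOrdinaryChart A e) :
    Lifts e (fun z => affineVec A z.1 z.2)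
      (fun q z => crossProduct q.1.rep (affineVec A z.1 z.2)) where
  contDiff_point := contDiff_affineVec A contDiff_fst contDiff_snd
  contDiff_line q := contDiff_cross (contDiff_affineVec A contDiff_fst contDiff_snd) _
  isOpen_target := by
    convert! isOpen_avoid (contDiff_affineVec A contDiff_fst contDiff_snd) P using 1
    rw [he.target_eq]
    ext z
    refine forall₂_congr fun q _ => ?_
    rw [forall_prop_of_true (affineVec_ne_zero he.det_ne_zero _ _), Ne, mk_eq_iff_cross]
  point_eq z hz := ⟨_, he.point_eq hz⟩
  line_eq z hz q := by
    have hs := e.map_target hz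
    rw [he.source_eq] at hs
    exact line_eq_mk _ q (hs.2 q q.2) (he.point_eq hz)

theorem inv_transpose_dot {A : Matrix (Fin 3) (Fin 3) ℂ} (hA : A.det ≠ 0) (i j : Fin 3) :
    A⁻¹ᵀ i ⬝ᵥ A j = (1 : Matrix (Fin 3) (Fin 3) ℂ) j i := by
  rw [← Matrix.mul_nonsing_inv A (isUnit_iff_ne_zero.2 hA), Matrix.mul_apply, dotProduct]
  exact Finset.sum_congr rfl fun k _ => mul_comm _ _

/-- The linear form `A 2 - u • A 1`, which defines the line of slope `u`. -/
def slopeForm (A : Matrix (Fin 3) (Fin 3) ℂ) (u : ℂ) : Fin 3 → ℂ := A 2 - u • A 1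

theorem inv_transpose_dot_slopeForm {A : Matrix (Fin 3) (Fin 3) ℂ} (hA : A.det ≠ 0) (u : ℂ)
    (i : Fin 3) : A⁻¹ᵀ i ⬝ᵥ slopeForm A u = ![0, -u, 1] i := by
  rw [slopeForm, dotProduct_sub, dotProduct_smul, inv_transpose_dot hA, inv_transpose_dot hA]
  fin_cases i
  · change (1 : Matrix (Fin 3) (Fin 3) ℂ) 2 0 - u • (1 : Matrix (Fin 3) (Fin 3) ℂ) 1 0 = 0
    simp
  · change (1 : Matrix (Fin 3) (Fin 3) ℂ) 2 1 - u • (1 : Matrix (Fin 3) (Fin 3) ℂ) 1 1 = -u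
    simp
  · change (1 : Matrix (Fin 3) (Fin 3) ℂ) 2 2 - u • (1 : Matrix (Fin 3) (Fin 3) ℂ) 1 2 = 1
    simp

theorem slopeForm_ne_zero {A : Matrix (Fin 3) (Fin 3) ℂ} (hA : A.det ≠ 0) (u : ℂ) :
    slopeForm A u ≠ 0 := by
  intro h
  have := inv_transpose_dot_slopeForm hA u 2
  simp [h] at this

/-- Expansion of a linear form in the basis `A 0`, `A 1`, `A 2`. -/
theorem eq_sum_forms {A : Matrix (Fin 3) (Fin 3) ℂ} (hA : A.det ≠ 0) (w : Fin 3 → ℂ) :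
    w = (A⁻¹ᵀ 0 ⬝ᵥ w) • A 0 + (A⁻¹ᵀ 1 ⬝ᵥ w) • A 1 + (A⁻¹ᵀ 2 ⬝ᵥ w) • A 2 := by
  have h : Aᵀ *ᵥ (A⁻¹ᵀ *ᵥ w) = w := by
    rw [Matrix.mulVec_mulVec, ← Matrix.transpose_mul,
      Matrix.nonsing_inv_mul _ (isUnit_iff_ne_zero.2 hA), Matrix.transpose_one,
      Matrix.one_mulVec]
  conv_lhs => rw [← h]
  ext i
  simp only [Matrix.mulVec, dotProduct, Fin.sum_univ_three, Matrix.transpose_apply, Pi.add_apply,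
    Pi.smul_apply, smul_eq_mul]
  ring

theorem dot_eq_zero {x y : ProjectivePlane} (h : x.orthogonal y) : x.rep ⬝ᵥ y.rep = 0 := by
  rwa [← Projectivization.mk_rep x, ← Projectivization.mk_rep y,
    Projectivization.orthogonal_mk] at h

/-- The form of a line through the common zero `p` of `A 1` and `A 2`. -/
theorem line_form {A : Matrix (Fin 3) (Fin 3) ℂ} (hA : A.det ≠ 0) {p w : Fin 3 → ℂ} (hp : p ≠ 0)
    (h1 : A 1 ⬝ᵥ p = 0) (h2 : A 2 ⬝ᵥ p = 0) (hw : p ⬝ᵥ w = 0) :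
    w = (A⁻¹ᵀ 1 ⬝ᵥ w) • A 1 + (A⁻¹ᵀ 2 ⬝ᵥ w) • A 2 := by
  have h3 := eq_sum_forms hA w
  have h0 : A 0 ⬝ᵥ p ≠ 0 := by
    intro h0
    apply hp
    rw [← inv_mul_mulVec hA p]
    have : A *ᵥ p = 0 := by
      ext i
      fin_cases i
      · exact h0
      · exact h1
      · exact h2
    rw [this, Matrix.mulVec_zero]
  have h4 : A⁻¹ᵀ 0 ⬝ᵥ w = 0 := by
    have h5 : w ⬝ᵥ p = 0 := by rw [dotProduct_comm, hw]
    rw [h3, add_dotProduct, add_dotProduct, smul_dotProduct, smul_dotProduct, smul_dotProduct,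
      h1, h2] at h5
    simpa [h0] using h5
  rw [h4, zero_smul, zero_add] at h3
  exact h3

theorem point_line_eq_mk {p : P} {A : Matrix (Fin 3) (Fin 3) ℂ} (hA : A.det ≠ 0)
    (h1 : A 1 ⬝ᵥ p.1.rep = 0) (h2 : A 2 ⬝ᵥ p.1.rep = 0) {x : BlowUp P}
    (hx0 : A 0 ⬝ᵥ x.point.rep ≠ 0) (hx2 : A⁻¹ᵀ 2 ⬝ᵥ (x.line p).rep ≠ 0) :
    x.point = Projectivization.mk ℂ (affineVec A (ratio (A 1) (A 0) x.point)
        (ratio (A 1) (A 0) x.point * -ratio (A⁻¹ᵀ 1) (A⁻¹ᵀ 2) (x.line p)))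
        (affineVec_ne_zero hA _ _) ∧
      x.line p = Projectivization.mk ℂ (slopeForm A (-ratio (A⁻¹ᵀ 1) (A⁻¹ᵀ 2) (x.line p)))
        (slopeForm_ne_zero hA _) := by
  have hw := line_form hA p.1.rep_nonzero h1 h2 (dot_eq_zero (x.center_mem p))
  have hxw := dot_eq_zero (x.point_mem p)
  rw [dotProduct_comm, hw, add_dotProduct, smul_dotProduct, smul_dotProduct, smul_eq_mul,
    smul_eq_mul] at hxw
  constructor
  · have h3 : ratio (A 1) (A 0) x.point * -ratio (A⁻¹ᵀ 1) (A⁻¹ᵀ 2) (x.line p) =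
        ratio (A 2) (A 0) x.point := by
      rw [ratio, ratio, ratio]
      field_simp
      linear_combination -hxw
    rw [h3]
    exact eq_mk_affineVec hA hx0
  · conv_lhs => rw [← Projectivization.mk_rep (x.line p)]
    rw [Projectivization.mk_eq_mk_iff']
    refine ⟨A⁻¹ᵀ 2 ⬝ᵥ (x.line p).rep, ?_⟩
    conv_rhs => rw [hw]
    rw [slopeForm, smul_sub, smul_smul, ratio, mul_neg, mul_div_cancel₀ _ hx2, neg_smul,
      sub_neg_eq_add, add_comm]

theorem IsExceptionalChart.eq_mk {p : P} {A : Matrix (Fin 3) (Fin 3) ℂ}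
    {e : PartialEquiv (BlowUp P) (ℂ × ℂ)} (he : IsExceptionalChart p A e) {x : BlowUp P}
    (hx : x ∈ e.source) :
    x.point = Projectivization.mk ℂ (affineVec A (e x).1 ((e x).1 * (e x).2))
        (affineVec_ne_zero he.det_ne_zero _ _) ∧
      x.line p = Projectivization.mk ℂ (slopeForm A (e x).2)
        (slopeForm_ne_zero he.det_ne_zero _) := by
  have h1 := he.apply_eq _ hx
  rw [he.source_eq] at hx
  simp only [h1]
  exact point_line_eq_mk he.det_ne_zero he.center_one he.center_two hx.1 hx.2.2

theorem IsExceptionalChart.lifts {p : P} {A : Matrix (Fin 3) (Fin 3) ℂ}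
    {e : PartialEquiv (BlowUp P) (ℂ × ℂ)} (he : IsExceptionalChart p A e) :
    Lifts e (fun z => affineVec A z.1 (z.1 * z.2))
      (fun q z => if q = p then slopeForm A z.2 else
        crossProduct q.1.rep (affineVec A z.1 (z.1 * z.2))) where
  contDiff_point := contDiff_affineVec A contDiff_fst (contDiff_fst.mul contDiff_snd)
  contDiff_line q := by
    by_cases h : q = p
    · simp only [h, if_true, slopeForm]
      exact contDiff_const.sub (contDiff_snd.smul contDiff_const)
    · simp only [h, if_false]
      exact contDiff_cross (contDiff_affineVec A contDiff_fst (contDiff_fst.mul contDiff_snd)) _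
  isOpen_target := by
    convert! isOpen_avoid (contDiff_affineVec A contDiff_fst (contDiff_fst.mul contDiff_snd))
      (P.erase p) using 1
    rw [he.target_eq]
    ext z
    refine forall_congr' fun q => ?_
    rw [forall_prop_of_true (affineVec_ne_zero he.det_ne_zero _ _), Finset.mem_erase, ← not_iff_not]
    simp only [Ne, mk_eq_iff_cross]
    tauto
  point_eq z hz := by
    have h1 := (he.eq_mk (e.map_target hz)).1
    rw [e.right_inv hz] at h1
    exact ⟨_, h1⟩
  line_eq z hz q := by
    have hs := e.map_target hz
    have h1 := he.eq_mk hs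
    rw [e.right_inv hz] at h1
    by_cases h : q = p
    · subst h
      simp only [if_true]
      exact ⟨slopeForm_ne_zero he.det_ne_zero _, h1.2⟩
    · simp only [h, if_false]
      rw [he.source_eq] at hs
      exact line_eq_mk _ q (hs.2.1 q q.2 fun h' => h (Subtype.ext h')) h1.1

theorem Lifts.ordinary {A : Matrix (Fin 3) (Fin 3) ℂ} {e e' : PartialEquiv (BlowUp P) (ℂ × ℂ)}
    {V : ℂ × ℂ → Fin 3 → ℂ} {W : P → ℂ × ℂ → Fin 3 → ℂ} (h : Lifts e V W)
    (he' : IsOrdinaryChart A e') : IsOpen (e.symm.trans e').source ∧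
      ContDiffOn ℂ ω (e.symm.trans e') (e.symm.trans e').source := by
  have hV := h.contDiff_point
  constructor
  · have : (e.symm.trans e').source = e.target ∩
        ({z | A 0 ⬝ᵥ V z ≠ 0} ∩ {z | ∀ q ∈ P, crossProduct q.rep (V z) ≠ 0}) := by
      ext z
      have hsrc : z ∈ (e.symm.trans e').source ↔ z ∈ e.target ∧ e.symm z ∈ e'.source := Iff.rfl
      rw [hsrc, Set.mem_inter_iff]
      refine and_congr_right fun hz => ?_
      obtain ⟨hv, hv'⟩ := h.point_eq z hz
      rw [he'.source_eq]
      refine and_congr ?_ (forall₂_congr fun q _ => ?_)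
      · rw [hv', dot_rep_mk]
        rfl
      · rw [hv', Ne, mk_eq_iff_cross]
    rw [this]
    exact h.isOpen_target.inter ((isOpen_ne_fun (contDiff_dot hV _).continuous
      continuous_const).inter (isOpen_avoid hV P))
  · have h0 : ∀ z ∈ (e.symm.trans e').source, A 0 ⬝ᵥ V z ≠ 0 := fun z hz => by
      obtain ⟨hv, hv'⟩ := h.point_eq z hz.1
      have hz2 : e.symm z ∈ e'.source := hz.2
      rw [he'.source_eq] at hz2
      have := hz2.1
      rwa [hv', dot_rep_mk] at this
    refine ContDiffOn.congr
      (((contDiff_dot hV (A 1)).contDiffOn.div (contDiff_dot hV (A 0)).contDiffOn h0).prodMk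
        ((contDiff_dot hV (A 2)).contDiffOn.div (contDiff_dot hV (A 0)).contDiffOn h0))
      fun z hz => ?_
    have hz2 : e.symm z ∈ e'.source := hz.2
    obtain ⟨hv, hv'⟩ := h.point_eq z hz.1
    change e' (e.symm z) = _
    rw [he'.apply_eq _ hz2, hv', ratio_mk, ratio_mk]
    rfl

theorem Lifts.exceptional {p : P} {A : Matrix (Fin 3) (Fin 3) ℂ}
    {e e' : PartialEquiv (BlowUp P) (ℂ × ℂ)}
    {V : ℂ × ℂ → Fin 3 → ℂ} {W : P → ℂ × ℂ → Fin 3 → ℂ} (h : Lifts e V W)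
    (he' : IsExceptionalChart p A e') : IsOpen (e.symm.trans e').source ∧
      ContDiffOn ℂ ω (e.symm.trans e') (e.symm.trans e').source := by
  have hV := h.contDiff_point
  have hW := h.contDiff_line p
  constructor
  · have : (e.symm.trans e').source = e.target ∩
        ({z | A 0 ⬝ᵥ V z ≠ 0} ∩ ({z | ∀ q ∈ P.erase p, crossProduct q.rep (V z) ≠ 0} ∩
          {z | A⁻¹ᵀ 2 ⬝ᵥ W p z ≠ 0})) := by
      ext z
      have hsrc : z ∈ (e.symm.trans e').source ↔ z ∈ e.target ∧ e.symm z ∈ e'.source := Iff.rfl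
      rw [hsrc, Set.mem_inter_iff]
      refine and_congr_right fun hz => ?_
      obtain ⟨hv, hv'⟩ := h.point_eq z hz
      obtain ⟨hw, hw'⟩ := h.line_eq z hz p
      rw [he'.source_eq]
      refine and_congr ?_ (and_congr (forall_congr' fun q => ?_) ?_)
      · rw [hv', dot_rep_mk]
        rfl
      · rw [hv', Finset.mem_erase, ← not_iff_not]
        simp only [Ne, mk_eq_iff_cross]
        tauto
      · rw [hw', dot_rep_mk]
        rfl
    rw [this]
    exact h.isOpen_target.inter ((isOpen_ne_fun (contDiff_dot hV _).continuous
      continuous_const).inter ((isOpen_avoid hV _).inter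
        (isOpen_ne_fun (contDiff_dot hW _).continuous continuous_const)))
  · have h0 : ∀ z ∈ (e.symm.trans e').source, A 0 ⬝ᵥ V z ≠ 0 := fun z hz => by
      obtain ⟨hv, hv'⟩ := h.point_eq z hz.1
      have hz2 : e.symm z ∈ e'.source := hz.2
      rw [he'.source_eq] at hz2
      have := hz2.1
      rwa [hv', dot_rep_mk] at this
    have h2 : ∀ z ∈ (e.symm.trans e').source, A⁻¹ᵀ 2 ⬝ᵥ W p z ≠ 0 := fun z hz => by
      obtain ⟨hv, hv'⟩ := h.line_eq z hz.1 p
      have hz2 : e.symm z ∈ e'.source := hz.2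
      rw [he'.source_eq] at hz2
      have := hz2.2.2
      rwa [hv', dot_rep_mk] at this
    refine ContDiffOn.congr
      (((contDiff_dot hV (A 1)).contDiffOn.div (contDiff_dot hV (A 0)).contDiffOn h0).prodMk
        ((contDiff_dot hW (A⁻¹ᵀ 1)).contDiffOn.div
          (contDiff_dot hW (A⁻¹ᵀ 2)).contDiffOn h2).neg)
      fun z hz => ?_
    have hz2 : e.symm z ∈ e'.source := hz.2
    obtain ⟨hv, hv'⟩ := h.point_eq z hz.1
    obtain ⟨hw, hw'⟩ := h.line_eq z hz.1 p
    change e' (e.symm z) = _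
    rw [he'.apply_eq _ hz2, hv', hw', ratio_mk, ratio_mk]
    rfl

theorem exists_isOrdinaryChart (x₀ : BlowUp P) {A : Matrix (Fin 3) (Fin 3) ℂ} (hA : A.det ≠ 0) :
    ∃ e : PartialEquiv (BlowUp P) (ℂ × ℂ), IsOrdinaryChart A e := by
  have : Nonempty (BlowUp P) := ⟨x₀⟩
  have hb : Set.BijOn
      (fun x : BlowUp P => (ratio (A 1) (A 0) x.point, ratio (A 2) (A 0) x.point))
      {x | A 0 ⬝ᵥ x.point.rep ≠ 0 ∧ ∀ q ∈ P, x.point ≠ q}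
      {z | ∀ q ∈ P, ∀ h, Projectivization.mk ℂ (affineVec A z.1 z.2) h ≠ q} := by
    refine ⟨fun x hx q hq h => ?_, fun x hx y hy h => ?_, fun z hz => ?_⟩
    · exact (eq_mk_affineVec hA hx.1) ▸ hx.2 q hq
    · have hxy : x.point = y.point := by
        have hs : ratio (A 1) (A 0) x.point = ratio (A 1) (A 0) y.point := congrArg Prod.fst h
        have ht : ratio (A 2) (A 0) x.point = ratio (A 2) (A 0) y.point := congrArg Prod.snd h
        rw [eq_mk_affineVec hA hx.1, eq_mk_affineVec hA hy.1]
        simp only [hs, ht]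
      refine BlowUp.ext hxy (funext fun q => ?_)
      rw [line_eq_cross x q (hx.2 q q.2), line_eq_cross y q (hy.2 q q.2), hxy]
    · have h0 := affineVec_ne_zero hA z.1 z.2
      refine ⟨⟨Projectivization.mk ℂ _ h0,
        fun q => Projectivization.cross q (Projectivization.mk ℂ _ h0),
        fun q => Projectivization.orthogonal_cross_left (hz q q.2 h0).symm,
        fun q => Projectivization.orthogonal_cross_right (hz q q.2 h0).symm⟩,
        ⟨?_, fun q hq => hz q hq h0⟩, ?_⟩
      · rw [dot_rep_mk, dot_affineVec hA]
        simp
      · simp only [ratio_mk, dot_affineVec hA]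
        simp
  exact ⟨hb.toPartialEquiv _ _ _, hA, rfl, rfl, fun _ _ => rfl⟩

theorem exists_isExceptionalChart (x₀ : BlowUp P) (p : P) {A : Matrix (Fin 3) (Fin 3) ℂ}
    (hA : A.det ≠ 0) (h1 : A 1 ⬝ᵥ p.1.rep = 0) (h2 : A 2 ⬝ᵥ p.1.rep = 0) :
    ∃ e : PartialEquiv (BlowUp P) (ℂ × ℂ), IsExceptionalChart p A e := by
  have : Nonempty (BlowUp P) := ⟨x₀⟩
  have hpl : ∀ u : ℂ, (p : ProjectivePlane).orthogonal
      (Projectivization.mk ℂ (slopeForm A u) (slopeForm_ne_zero hA u)) := fun u => by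
    rw [← Projectivization.mk_rep p.1, Projectivization.orthogonal_mk, dotProduct_comm, slopeForm,
      sub_dotProduct, smul_dotProduct, h1, h2]
    simp
  have key : ∀ x : BlowUp P, A 0 ⬝ᵥ x.point.rep ≠ 0 → A⁻¹ᵀ 2 ⬝ᵥ (x.line p).rep ≠ 0 →
      x.point = Projectivization.mk ℂ (affineVec A (ratio (A 1) (A 0) x.point)
        (ratio (A 1) (A 0) x.point * -ratio (A⁻¹ᵀ 1) (A⁻¹ᵀ 2) (x.line p)))
        (affineVec_ne_zero hA _ _) ∧
      x.line p = Projectivization.mk ℂ (slopeForm A (-ratio (A⁻¹ᵀ 1) (A⁻¹ᵀ 2) (x.line p)))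
        (slopeForm_ne_zero hA _) := fun x hx0 hx2 =>
    point_line_eq_mk hA h1 h2 hx0 hx2
  have hb : Set.BijOn
      (fun x : BlowUp P => (ratio (A 1) (A 0) x.point, -ratio (A⁻¹ᵀ 1) (A⁻¹ᵀ 2) (x.line p)))
      {x | A 0 ⬝ᵥ x.point.rep ≠ 0 ∧ (∀ q ∈ P, q ≠ p → x.point ≠ q) ∧
        A⁻¹ᵀ 2 ⬝ᵥ (x.line p).rep ≠ 0}
      {z | ∀ q ∈ P, q ≠ p → ∀ h,
        Projectivization.mk ℂ (affineVec A z.1 (z.1 * z.2)) h ≠ q} := by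
    refine ⟨fun x hx q hq hqp h => ?_, fun x hx y hy h => ?_, fun z hz => ?_⟩
    · exact (key x hx.1 hx.2.2).1 ▸ hx.2.1 q hq hqp
    · have hs := congrArg Prod.fst h
      have hu := congrArg Prod.snd h
      simp only at hs hu
      have hxy : x.point = y.point := by
        rw [(key x hx.1 hx.2.2).1, (key y hy.1 hy.2.2).1]
        simp only [hs, hu]
      refine BlowUp.ext hxy (funext fun q => ?_)
      by_cases hq : q = p
      · subst hq
        rw [(key x hx.1 hx.2.2).2, (key y hy.1 hy.2.2).2]
        simp only [hu]
      · have hq' : (q : ProjectivePlane) ≠ p := fun h' => hq (Subtype.ext h')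
        rw [line_eq_cross x q (hx.2.1 q q.2 hq'), line_eq_cross y q (hy.2.1 q q.2 hq'), hxy]
    · have h0 := affineVec_ne_zero hA z.1 (z.1 * z.2)
      have hne : ∀ q : P, q ≠ p → (q : ProjectivePlane) ≠ Projectivization.mk ℂ _ h0 :=
        fun q hq => (hz q q.2 (fun h' => hq (Subtype.ext h')) h0).symm
      have hl := slopeForm_ne_zero hA z.2
      refine ⟨⟨Projectivization.mk ℂ _ h0,
        fun q => if q = p then Projectivization.mk ℂ _ hl else
          Projectivization.cross q (Projectivization.mk ℂ _ h0),
        fun q => ?_, fun q => ?_⟩, ⟨?_, fun q hq hqp => hz q hq hqp h0, ?_⟩, ?_⟩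
      · by_cases hq : q = p
        · subst hq
          simp only [if_true]
          exact hpl _
        · simp only [hq, if_false]
          exact Projectivization.orthogonal_cross_left (hne q hq)
      · by_cases hq : q = p
        · subst hq
          simp only [if_true]
          rw [Projectivization.orthogonal_mk, dotProduct_comm, slopeForm, sub_dotProduct,
            smul_dotProduct, dot_affineVec hA, dot_affineVec hA]
          simp [mul_comm]
        · simp only [hq, if_false]
          exact Projectivization.orthogonal_cross_right (hne q hq)
      · rw [dot_rep_mk, dot_affineVec hA]
        simp
      · simp only [if_true]
        rw [dot_rep_mk, inv_transpose_dot_slopeForm hA]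
        simp
      · simp only [if_true, ratio_mk, dot_affineVec hA, inv_transpose_dot_slopeForm hA]
        simp
  exact ⟨hb.toPartialEquiv _ _ _, hA, h1, h2, rfl, rfl, fun _ _ => rfl⟩

open scoped ComplexOrder in
/-- Three independent linear forms, the first not vanishing at a point, and the third defining a
line through the point. -/
theorem exists_forms {v w : Fin 3 → ℂ} (hv : v ≠ 0) (hw : w ≠ 0) (h : v ⬝ᵥ w = 0) :
    ∃ A : Matrix (Fin 3) (Fin 3) ℂ, A.det ≠ 0 ∧ A 0 ⬝ᵥ v ≠ 0 ∧ A 1 ⬝ᵥ v = 0 ∧ A 2 = w := by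
  have hv' : star v ⬝ᵥ v ≠ 0 := by
    rw [Ne, dotProduct_star_self_eq_zero]
    exact hv
  have hw' : star w ⬝ᵥ w ≠ 0 := by
    rw [Ne, dotProduct_star_self_eq_zero]
    exact hw
  refine ⟨![star v, crossProduct v (star w), w], ?_, hv', ?_, rfl⟩
  · have h3 : Matrix.det ![star v, crossProduct v (star w), w] =
        -((star v ⬝ᵥ v) * (star w ⬝ᵥ w)) := by
      rw [← triple_product_eq_det, triple_product_permutation, cross_dot_cross, h,
        dotProduct_comm v (star v)]
      ring
    exact h3 ▸ neg_ne_zero.2 (mul_ne_zero hv' hw')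
  · change crossProduct v (star w) ⬝ᵥ v = 0
    rw [dotProduct_comm, dot_self_cross]

/-- The complex surface structure of the blow-up. -/
def surfaceAtlas : SurfaceAtlas (BlowUp P) where
  charts := {e | (∃ A, IsOrdinaryChart A e) ∨ ∃ p A, IsExceptionalChart p A e}
  cover x := by
    by_cases hx : ∀ q ∈ P, x.point ≠ q
    · obtain ⟨A, hA, h0⟩ := exists_affine_forms x.point
      obtain ⟨e, he⟩ := exists_isOrdinaryChart x hA
      exact ⟨e, Or.inl ⟨A, he⟩, by rw [he.source_eq]; exact ⟨h0, hx⟩⟩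
    · push Not at hx
      obtain ⟨p, hp, hxp⟩ := hx
      have hc := dot_eq_zero (x.center_mem ⟨p, hp⟩)
      obtain ⟨A, hA, h0, h1, h2⟩ :=
        exists_forms p.rep_nonzero (x.line ⟨p, hp⟩).rep_nonzero hc
      obtain ⟨e, he⟩ := exists_isExceptionalChart x ⟨p, hp⟩ hA h1
        (by rw [h2, dotProduct_comm]; exact hc)
      refine ⟨e, Or.inr ⟨_, A, he⟩, ?_⟩
      rw [he.source_eq]
      refine ⟨by rw [hxp]; exact h0, fun q _ hq => by rw [hxp]; exact hq.symm, ?_⟩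
      rw [← h2, inv_transpose_dot hA]
      simp
  open_source := by
    rintro e (⟨A, he⟩ | ⟨p, A, he⟩) e' (⟨B, he'⟩ | ⟨q, B, he'⟩)
    exacts [(he.lifts.ordinary he').1, (he.lifts.exceptional he').1,
      (he.lifts.ordinary he').1, (he.lifts.exceptional he').1]
  holomorphic := by
    rintro e (⟨A, he⟩ | ⟨p, A, he⟩) e' (⟨B, he'⟩ | ⟨q, B, he'⟩)
    exacts [(he.lifts.ordinary he').2, (he.lifts.exceptional he').2,
      (he.lifts.ordinary he').2, (he.lifts.exceptional he').2]

instance : TopologicalSpace (BlowUp P) := surfaceAtlas.core.toTopologicalSpace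

instance : ChartedSpace (ℂ × ℂ) (BlowUp P) := surfaceAtlas.core.toChartedSpace

instance : IsManifold 𝓘(ℂ, ℂ × ℂ) ω (BlowUp P) := surfaceAtlas.isManifold

/-- The strict transform of a curve: the closure of the inverse image of the curve without the
centres of the blow-up. -/
def strictTransform (P : Finset ProjectivePlane) (C : Set ProjectivePlane) : Set (BlowUp P) :=
  closure {x | x.point ∈ C \ (P : Set ProjectivePlane)}

end BlowUp

end CurvesInSurfaces

end

open CurvesInSurfaces

open scoped Manifold ContDiff Topology LinearAlgebra.Projectivization Matrix

noncomputable section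

namespace CurvesInSurfaces

section

/-! Let `F = 0` be the equation of the curve. At a point `v` of the cone `F = 0`, let `V` be a lift
to `ℂ³` of a nonzero vector of the line field `X`. The vector `u(v) = (v × V) / (∇F(v) · V)` gives
the coefficients of the projective line through `v` in the direction of `X`. Rescaling `V` or adding
a multiple of `v` to it does not change `u`: the first is clear, the second is Euler's relation
`∇F(v) · v = 0` on the cone. So `u` is intrinsic, homogeneous of degree `2 - d`, orthogonal to `v`,
and its only poles are at the tangencies of `X` with the curve, of order at most the order of
tangency.

For a fixed vector `p`, the function `p · u` is a meromorphic section of `O(2 - d)` on a curve of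
degree `d`, so its zeros minus its poles number `-d(d - 2)`. If `p` is itself a point of the curve,
`p · u` vanishes there. Hence `u` has at least `d(d - 2) + 1 = (d - 1)²` poles, which is the bound
on `tang`. This is `IsPolarField.lt_sum`, applied to line fields in `pow_le_tang`.

The degree count is made by hand. Project the curve from a point off it onto a line with coordinate
`s`, and take the product of `p · u` over each fibre (`fibreNorm`). The norm has at each `s` a pole
of order at most the sum of the orders over the fibre (`IsPolarField.exists_fibreNorm_le`), and near
infinity it is `O(s ^ (-d(d - 2)))` when no pole lies on the fibre at infinity
(`fibreNorm_swapForms`). If the poles numbered at most `d(d - 2)`, then multiplying by a polynomial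
vanishing at them would give a bounded entire function, hence a constant
(`IsPolarField.fibreNorm_const`). Taking for `p` a suitable point of the curve makes this constant
both zero and nonzero.

On the blow-up, the same `u` is formed from the image in the plane of a line field along the strict
transform. In coordinates `(x, u)` with `y = x u`, the equation `F` becomes `x` times the equation
of the strict transform. The strict transform meets the exceptional line `x = 0` transversally, so a
transverse field gives a pole of order at most one at each centre, and no others. With at most `d(d
- 2)` centres this contradicts the same inequality (`BlowUp.not_isTransverse`).

Finally, a linearization carries the fibres of the normal bundle to a transverse line field
(`EmbeddedCurve.HasLinearizableNhd.exists_isTransverse`), so the absence of transverse fields rules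
out linearizable neighbourhoods. -/

open MvPolynomial in
/-- The gradient of a polynomial in three variables at a vector. -/
def gradient (F : MvPolynomial (Fin 3) ℂ) (v : Fin 3 → ℂ) : Fin 3 → ℂ :=
  fun i => eval v (pderiv i F)

/-! ### Homogeneous forms in three variables and their restrictions to lines. -/

section Polynomials

open MvPolynomial

variable {F : MvPolynomial (Fin 3) ℂ} {d : ℕ}

theorem contDiff_eval (F : MvPolynomial (Fin 3) ℂ) :
    ContDiff ℂ ω fun v : Fin 3 → ℂ => eval v F := by
  induction F using MvPolynomial.induction_on with
  | C c => simpa using contDiff_const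
  | add p q hp hq => simpa using hp.add hq
  | mul_X p i hp => simpa using hp.mul (contDiff_apply ℂ ℂ i)

theorem contDiff_gradient (F : MvPolynomial (Fin 3) ℂ) : ContDiff ℂ ω (gradient F) :=
  contDiff_pi.2 fun _ => contDiff_eval _

theorem hasFDerivAt_eval (F : MvPolynomial (Fin 3) ℂ) (v : Fin 3 → ℂ) :
    HasFDerivAt (fun v : Fin 3 → ℂ => eval v F)
      (∑ i, gradient F v i • ContinuousLinearMap.proj (R := ℂ) (φ := fun _ : Fin 3 => ℂ) i) v := by
  induction F using MvPolynomial.induction_on with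
  | C c =>
    simp only [gradient, eval_C, pderiv_C, map_zero]
    refine (hasFDerivAt_const (𝕜 := ℂ) c v).congr_fderiv ?_
    ext w
    simp only [sum_apply, smul_apply, zero_smul, Finset.sum_const_zero,
      zero_apply]
  | add p q hp hq =>
    refine ((hp.add hq).congr_fderiv ?_).congr_of_eventuallyEq
      (Filter.Eventually.of_forall fun v => map_add _ _ _)
    simp only [gradient, map_add, ← Finset.sum_add_distrib, ← add_smul]
  | mul_X p i hp =>
    have h := hp.mul (hasFDerivAt_apply (𝕜 := ℂ) i v)
    simp only [map_mul, eval_X]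
    refine h.congr_fderiv ?_
    ext w
    simp only [gradient, pderiv_mul, pderiv_X, map_add, map_mul, eval_X,
      add_apply, smul_apply, ContinuousLinearMap.proj_apply, smul_eq_mul, Fin.sum_univ_three]
    fin_cases i <;> simp <;> ring

theorem fderiv_eval_apply (F : MvPolynomial (Fin 3) ℂ) (v w : Fin 3 → ℂ) :
    fderiv ℂ (fun v : Fin 3 → ℂ => eval v F) v w = gradient F v ⬝ᵥ w := by
  rw [(hasFDerivAt_eval F v).fderiv]
  simp [dotProduct]

theorem hasFDerivAt_eval_comp {E : Type*} [NormedAddCommGroup E] [NormedSpace ℂ E]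
    (F : MvPolynomial (Fin 3) ℂ) {g : E → Fin 3 → ℂ} {g' : E →L[ℂ] Fin 3 → ℂ} {x : E}
    (hg : HasFDerivAt g g' x) (w : E) :
    fderiv ℂ (fun x => eval (g x) F) x w = gradient F (g x) ⬝ᵥ g' w := by
  have h := ((contDiff_eval F).differentiable (by simp) (g x)).hasFDerivAt.comp x hg
  have h2 : (fun x => eval (g x) F) = (fun v : Fin 3 → ℂ => eval v F) ∘ g := rfl
  rw [h2, h.fderiv, ContinuousLinearMap.comp_apply, fderiv_eval_apply]

theorem hasDerivAt_eval_comp (F : MvPolynomial (Fin 3) ℂ) {g : ℂ → Fin 3 → ℂ} {g' : Fin 3 → ℂ}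
    {x : ℂ} (hg : HasDerivAt g g' x) :
    HasDerivAt (fun x => eval (g x) F) (gradient F (g x) ⬝ᵥ g') x := by
  have h := ((contDiff_eval F).differentiable (by simp) (g x)).hasFDerivAt.comp_hasDerivAt x hg
  rwa [fderiv_eval_apply] at h

theorem sum_eq_of_isHomogeneous (hF : F.IsHomogeneous d) {m : Fin 3 →₀ ℕ} (hm : m ∈ F.support) :
    m 0 + m 1 + m 2 = d := by
  have h := hF (mem_support_iff.1 hm)
  rw [← h, Finsupp.weight_apply, Finsupp.sum_fintype _ _ (by simp)]
  simp [Fin.sum_univ_three]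

theorem eval_smul_of_isHomogeneous (hF : F.IsHomogeneous d) (c : ℂ) (v : Fin 3 → ℂ) :
    eval (c • v) F = c ^ d * eval v F := by
  rw [eval_eq', eval_eq', Finset.mul_sum]
  refine Finset.sum_congr rfl fun m hm => ?_
  rw [← sum_eq_of_isHomogeneous hF hm]
  simp only [Fin.prod_univ_three, Pi.smul_apply, smul_eq_mul]
  ring

theorem gradient_smul (hF : F.IsHomogeneous d) (c : ℂ) (v : Fin 3 → ℂ) :
    gradient F (c • v) = c ^ (d - 1) • gradient F v :=
  funext fun _ => eval_smul_of_isHomogeneous hF.pderiv c v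

theorem gradient_dot_self (hF : F.IsHomogeneous d) (v : Fin 3 → ℂ) :
    gradient F v ⬝ᵥ v = d * eval v F := by
  have h := congrArg (eval v) hF.sum_X_mul_pderiv
  simp only [map_sum, map_mul, eval_X, nsmul_eq_mul, map_natCast] at h
  rw [← h]
  exact Finset.sum_congr rfl fun i _ => mul_comm _ _

/-- The restriction of `F` to the line through `v` with direction `w`. -/
def linePoly (F : MvPolynomial (Fin 3) ℂ) (v w : Fin 3 → ℂ) : Polynomial ℂ :=
  aeval (fun i => Polynomial.C (v i) + Polynomial.C (w i) * Polynomial.X) F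

theorem eval_linePoly (F : MvPolynomial (Fin 3) ℂ) (v w : Fin 3 → ℂ) (t : ℂ) :
    (linePoly F v w).eval t = eval (v + t • w) F := by
  induction F using MvPolynomial.induction_on with
  | C c => simp [linePoly]
  | add p q hp hq =>
    simp only [linePoly, map_add, Polynomial.eval_add] at hp hq ⊢
    rw [hp, hq]
  | mul_X p i hp =>
    simp only [linePoly, map_mul, Polynomial.eval_mul] at hp ⊢
    rw [hp, aeval_X, eval_X, Polynomial.eval_add, Polynomial.eval_mul, Polynomial.eval_C,
      Polynomial.eval_C, Polynomial.eval_X, Pi.add_apply, Pi.smul_apply, smul_eq_mul, mul_comm t]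

theorem linePoly_eq_sum (F : MvPolynomial (Fin 3) ℂ) (v w : Fin 3 → ℂ) :
    linePoly F v w = ∑ m ∈ F.support, Polynomial.C (F.coeff m) *
      ∏ i, (Polynomial.C (w i) * Polynomial.X + Polynomial.C (v i)) ^ m i := by
  rw [linePoly, aeval_def, eval₂_eq']
  simp only [add_comm]
  rfl

theorem natDegree_linearForm_pow_le (a b : ℂ) (n : ℕ) :
    ((Polynomial.C a * Polynomial.X + Polynomial.C b) ^ n).natDegree ≤ n := by
  simpa using Polynomial.natDegree_pow_le_of_le n (Polynomial.natDegree_linear_le (a := a) (b := b))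

theorem coeff_linearForm_pow (a b : ℂ) (n : ℕ) :
    ((Polynomial.C a * Polynomial.X + Polynomial.C b) ^ n).coeff n = a ^ n := by
  have h := Polynomial.coeff_pow_of_natDegree_le (m := n)
    (Polynomial.natDegree_linear_le (a := a) (b := b))
  simpa using h

theorem natDegree_linePoly_le (hF : F.IsHomogeneous d) (v w : Fin 3 → ℂ) :
    (linePoly F v w).natDegree ≤ d := by
  rw [linePoly_eq_sum]
  refine Polynomial.natDegree_sum_le_of_forall_le _ _ fun m hm => ?_
  refine (Polynomial.natDegree_C_mul_le _ _).trans ?_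
  rw [← sum_eq_of_isHomogeneous hF hm, Fin.prod_univ_three]
  exact Polynomial.natDegree_mul_le_of_le (Polynomial.natDegree_mul_le_of_le
    (natDegree_linearForm_pow_le _ _ _) (natDegree_linearForm_pow_le _ _ _))
    (natDegree_linearForm_pow_le _ _ _)

/-- By homogeneity only the top-degree part in the direction survives, so this coefficient is the
value of the form at the point at infinity of the line. It fixes the number of roots when that point
is off the curve, and it carries vanishing along an affine line over to its point at infinity. -/
theorem coeff_linePoly (hF : F.IsHomogeneous d) (v w : Fin 3 → ℂ) :
    (linePoly F v w).coeff d = eval w F := by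
  rw [linePoly_eq_sum, Polynomial.finsetSum_coeff, eval_eq']
  refine Finset.sum_congr rfl fun m hm => ?_
  rw [Polynomial.coeff_C_mul, ← sum_eq_of_isHomogeneous hF hm, Fin.prod_univ_three,
    Polynomial.coeff_mul_add_eq_of_natDegree_le (Polynomial.natDegree_mul_le_of_le
      (natDegree_linearForm_pow_le _ _ _) (natDegree_linearForm_pow_le _ _ _))
      (natDegree_linearForm_pow_le _ _ _),
    Polynomial.coeff_mul_add_eq_of_natDegree_le (natDegree_linearForm_pow_le _ _ _)
      (natDegree_linearForm_pow_le _ _ _),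
    coeff_linearForm_pow, coeff_linearForm_pow, coeff_linearForm_pow, Fin.prod_univ_three]

theorem natDegree_linePoly (hF : F.IsHomogeneous d) (v : Fin 3 → ℂ) {w : Fin 3 → ℂ}
    (hw : eval w F ≠ 0) : (linePoly F v w).natDegree = d :=
  Polynomial.natDegree_eq_of_le_of_coeff_ne_zero (natDegree_linePoly_le hF v w)
    (by rwa [coeff_linePoly hF])

theorem leadingCoeff_linePoly (hF : F.IsHomogeneous d) (v : Fin 3 → ℂ) {w : Fin 3 → ℂ}
    (hw : eval w F ≠ 0) : (linePoly F v w).leadingCoeff = eval w F := by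
  rw [Polynomial.leadingCoeff, natDegree_linePoly hF v hw, coeff_linePoly hF]

theorem linePoly_ne_zero (hF : F.IsHomogeneous d) (v : Fin 3 → ℂ) {w : Fin 3 → ℂ}
    (hw : eval w F ≠ 0) : linePoly F v w ≠ 0 := by
  rw [← Polynomial.leadingCoeff_ne_zero, leadingCoeff_linePoly hF v hw]
  exact hw

/-- The parameters of the intersection points of the curve `F = 0` with the line through `v` of
direction `w`, with multiplicity. -/
def lineRoots (F : MvPolynomial (Fin 3) ℂ) (v w : Fin 3 → ℂ) : Multiset ℂ := (linePoly F v w).roots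

theorem mem_lineRoots (hF : F.IsHomogeneous d) {v w : Fin 3 → ℂ} (hw : eval w F ≠ 0) {t : ℂ} :
    t ∈ lineRoots F v w ↔ eval (v + t • w) F = 0 := by
  rw [lineRoots, Polynomial.mem_roots (linePoly_ne_zero hF v hw), Polynomial.IsRoot, eval_linePoly]

theorem card_lineRoots (hF : F.IsHomogeneous d) (v : Fin 3 → ℂ) {w : Fin 3 → ℂ}
    (hw : eval w F ≠ 0) : (lineRoots F v w).card = d := by
  rw [lineRoots, ← natDegree_linePoly hF v hw]
  exact (IsAlgClosed.splits _).natDegree_eq_card_roots.symm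

theorem eval_add_smul_eq_prod (hF : F.IsHomogeneous d) (v : Fin 3 → ℂ) {w : Fin 3 → ℂ}
    (hw : eval w F ≠ 0) (t : ℂ) :
    eval (v + t • w) F = eval w F * ((lineRoots F v w).map fun r => t - r).prod := by
  rw [← eval_linePoly, (IsAlgClosed.splits (linePoly F v w)).eval_eq_prod_roots,
    leadingCoeff_linePoly hF v hw]
  rfl

end Polynomials

end

section

open MvPolynomial (eval)
open ProjectivePlane

/-! ### Affine equations of plane curves -/

/-- The gradient of `F` does not vanish on the cone `F = 0`. -/
def IsSmoothForm (F : MvPolynomial (Fin 3) ℂ) : Prop :=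
  ∀ v : Fin 3 → ℂ, v ≠ 0 → eval v F = 0 → gradient F v ≠ 0

/-- The vector at which the forms `A 0`, `A 1`, `A 2` are `0`, `0`, `1`. -/
def vertex (A : Matrix (Fin 3) (Fin 3) ℂ) : Fin 3 → ℂ := A⁻¹ *ᵥ ![0, 0, 1]

theorem affineVec_add (A : Matrix (Fin 3) (Fin 3) ℂ) (s t a b : ℂ) :
    affineVec A (s + a) (t + b) = affineVec A s t + A⁻¹ *ᵥ ![0, a, b] := by
  rw [affineVec, affineVec, ← Matrix.mulVec_add]
  congr 1
  ext i
  fin_cases i <;> simp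

theorem mulVec_inv_eq (A : Matrix (Fin 3) (Fin 3) ℂ) (a b : ℂ) :
    A⁻¹ *ᵥ ![0, a, b] = a • A⁻¹ *ᵥ ![0, 1, 0] + b • vertex A := by
  rw [vertex, ← Matrix.mulVec_smul, ← Matrix.mulVec_smul, ← Matrix.mulVec_add]
  congr 1
  ext i
  fin_cases i <;> simp

theorem affineVec_eq_add (A : Matrix (Fin 3) (Fin 3) ℂ) (s t r : ℂ) :
    affineVec A s t = affineVec A s r + (t - r) • vertex A := by
  have h := affineVec_add A s r 0 (t - r)
  rw [add_zero, add_sub_cancel] at h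
  rw [h, mulVec_inv_eq, zero_smul, zero_add]

theorem hasFDerivAt_affineVec (A : Matrix (Fin 3) (Fin 3) ℂ) (z : ℂ × ℂ) :
    ∃ L : ℂ × ℂ →L[ℂ] Fin 3 → ℂ, HasFDerivAt (fun z : ℂ × ℂ => affineVec A z.1 z.2) L z ∧
      ∀ w, L w = A⁻¹ *ᵥ ![0, w.1, w.2] := by
  let L₀ : ℂ × ℂ →ₗ[ℂ] Fin 3 → ℂ :=
    { toFun := fun w => A⁻¹ *ᵥ ![0, w.1, w.2]
      map_add' := fun v w => by
        rw [← Matrix.mulVec_add]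
        congr 1
        ext i
        fin_cases i <;> simp
      map_smul' := fun c w => by
        rw [RingHom.id_apply, ← Matrix.mulVec_smul]
        congr 1
        ext i
        fin_cases i <;> simp }
  refine ⟨L₀.toContinuousLinearMap, ?_, fun w => rfl⟩
  have h : (fun z : ℂ × ℂ => affineVec A z.1 z.2) =
      fun z => L₀.toContinuousLinearMap z + affineVec A 0 0 := by
    ext1 z
    have := affineVec_add A 0 0 z.1 z.2
    rw [zero_add, zero_add] at this
    rw [this, add_comm]
    rfl
  rw [h]
  exact L₀.toContinuousLinearMap.hasFDerivAt.add_const _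

/-- The equation of the curve `F = 0` in the affine coordinates attached to `A`. -/
def affEq (F : MvPolynomial (Fin 3) ℂ) (A : Matrix (Fin 3) (Fin 3) ℂ) (z : ℂ × ℂ) : ℂ :=
  eval (affineVec A z.1 z.2) F

section

variable {F : MvPolynomial (Fin 3) ℂ} {d : ℕ} {A : Matrix (Fin 3) (Fin 3) ℂ}

theorem contDiff_affEq (F : MvPolynomial (Fin 3) ℂ) (A : Matrix (Fin 3) (Fin 3) ℂ) :
    ContDiff ℂ ω (affEq F A) :=
  (contDiff_eval F).comp (contDiff_affineVec A contDiff_fst contDiff_snd)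

theorem fderiv_affEq (F : MvPolynomial (Fin 3) ℂ) (A : Matrix (Fin 3) (Fin 3) ℂ) (z w : ℂ × ℂ) :
    fderiv ℂ (affEq F A) z w =
      gradient F (affineVec A z.1 z.2) ⬝ᵥ (A⁻¹ *ᵥ ![0, w.1, w.2]) := by
  obtain ⟨L, hL, hL'⟩ := hasFDerivAt_affineVec A z
  rw [← hL']
  exact hasFDerivAt_eval_comp F hL w

/-- An affine point together with the two coordinate directions spans `ℂ³`. -/
theorem eq_zero_of_dot_eq_zero (hA : A.det ≠ 0) {g : Fin 3 → ℂ} {s t : ℂ}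
    (h0 : g ⬝ᵥ affineVec A s t = 0) (h : ∀ a b, g ⬝ᵥ (A⁻¹ *ᵥ ![0, a, b]) = 0) : g = 0 := by
  have h1 : ∀ v : Fin 3 → ℂ, g ⬝ᵥ v = 0 := fun v => by
    have h2 : v = (A *ᵥ v) 0 • affineVec A s t +
        A⁻¹ *ᵥ ![0, (A *ᵥ v) 1 - (A *ᵥ v) 0 * s, (A *ᵥ v) 2 - (A *ᵥ v) 0 * t] := by
      conv_lhs => rw [← ProjectivePlane.inv_mul_mulVec hA v]
      rw [affineVec, ← Matrix.mulVec_smul, ← Matrix.mulVec_add]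
      congr 1
      ext i
      fin_cases i <;> simp
    rw [h2, dotProduct_add, dotProduct_smul, h0, h, smul_zero, add_zero]
  exact dotProduct_eq_zero _ h1

/-- A zero differential would make the gradient of `F` orthogonal to both affine directions. Euler's
relation makes it orthogonal to the point as well, so the gradient would vanish on the cone. -/
theorem fderiv_affEq_ne_zero (hF : F.IsHomogeneous d) (hs : IsSmoothForm F) (hA : A.det ≠ 0)
    {z : ℂ × ℂ} (hz : affEq F A z = 0) : fderiv ℂ (affEq F A) z ≠ 0 := by
  intro h
  refine hs _ (affineVec_ne_zero hA z.1 z.2) hz (eq_zero_of_dot_eq_zero hA (s := z.1) (t := z.2)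
    ?_ fun a b => ?_)
  · rw [gradient_dot_self hF]
    exact mul_eq_zero_of_right _ hz
  · have := fderiv_affEq F A z (a, b)
    rw [h] at this
    exact this.symm

theorem clm_prod_eq (L : ℂ × ℂ →L[ℂ] ℂ) (w : ℂ × ℂ) :
    L w = w.1 * L (1, 0) + w.2 * L (0, 1) := by
  have : w = w.1 • ((1 : ℂ), (0 : ℂ)) + w.2 • ((0 : ℂ), (1 : ℂ)) := by ext <;> simp
  conv_lhs => rw [this, map_add, map_smul, map_smul, smul_eq_mul, smul_eq_mul]

theorem clm_prod_ne_zero {L : ℂ × ℂ →L[ℂ] ℂ} (hL : L ≠ 0) : L (1, 0) ≠ 0 ∨ L (0, 1) ≠ 0 := by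
  by_contra! h
  exact hL (ContinuousLinearMap.ext fun w => by rw [clm_prod_eq, h.1, h.2]; simp)

/-- The implicit function theorem for a curve in `ℂ²`. -/
theorem exists_implicit_snd {f : ℂ × ℂ → ℂ} {z : ℂ × ℂ} (hf : ContDiffAt ℂ ω f z) (h0 : f z = 0)
    (h1 : fderiv ℂ f z (0, 1) ≠ 0) :
    ∃ η : ℂ → ℂ, AnalyticAt ℂ η z.1 ∧ η z.1 = z.2 ∧ ∀ᶠ v in 𝓝 z, f v = 0 ↔ η v.1 = v.2 := by
  have hi : (fderiv ℂ f z ∘L .inr ℂ ℂ ℂ).IsInvertible := by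
    refine ⟨ContinuousLinearEquiv.unitsEquivAut ℂ (Units.mk0 _ h1), ?_⟩
    ext
    simp
  refine ⟨hf.implicitFunction (by simp) hi, ?_, hf.implicitFunction_apply_self (by simp) hi, ?_⟩
  · exact (hf.contDiffAt_implicitFunction (by simp) hi).analyticAt
  · have := hf.eventually_apply_eq_iff_implicitFunction (by simp) hi
    rwa [h0] at this

theorem exists_implicit_fst {f : ℂ × ℂ → ℂ} {z : ℂ × ℂ} (hf : ContDiffAt ℂ ω f z) (h0 : f z = 0)
    (h1 : fderiv ℂ f z (1, 0) ≠ 0) :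
    ∃ ξ : ℂ → ℂ, AnalyticAt ℂ ξ z.2 ∧ ξ z.2 = z.1 ∧ ∀ᶠ v in 𝓝 z, f v = 0 ↔ ξ v.2 = v.1 := by
  have hsw : HasFDerivAt (Prod.swap : ℂ × ℂ → ℂ × ℂ)
      ((ContinuousLinearMap.snd ℂ ℂ ℂ).prod (ContinuousLinearMap.fst ℂ ℂ ℂ)) z.swap :=
    ((ContinuousLinearMap.snd ℂ ℂ ℂ).prod (ContinuousLinearMap.fst ℂ ℂ ℂ)).hasFDerivAt
  have hg : ContDiffAt ℂ ω (f ∘ Prod.swap) z.swap :=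
    ContDiffAt.comp z.swap (by simpa using hf) (contDiff_snd.prodMk contDiff_fst).contDiffAt
  have hd : HasFDerivAt f (fderiv ℂ f z) z.swap.swap := by
    rw [Prod.swap_swap]
    exact (hf.differentiableAt (by simp)).hasFDerivAt
  obtain ⟨ξ, h2, h3, h4⟩ := exists_implicit_snd hg (by simpa using h0)
    (by rw [(hd.comp z.swap hsw).fderiv]; simpa using h1)
  refine ⟨ξ, h2, h3, ?_⟩
  have := (continuous_swap.tendsto z).eventually h4
  filter_upwards [this] with v hv
  simpa using hv

/-! ### Intersections with the lines through a vertex off the curve -/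

/-- The second affine coordinates of the points of the curve with first coordinate `s`. -/
def fibre (F : MvPolynomial (Fin 3) ℂ) (A : Matrix (Fin 3) (Fin 3) ℂ) (s : ℂ) : Multiset ℂ :=
  lineRoots F (affineVec A s 0) (vertex A)

theorem affineVec_eq_zero_add (A : Matrix (Fin 3) (Fin 3) ℂ) (s t : ℂ) :
    affineVec A s t = affineVec A s 0 + t • vertex A := by
  simpa using affineVec_eq_add A s t 0

theorem mem_fibre (hF : F.IsHomogeneous d) (hV : eval (vertex A) F ≠ 0) {s t : ℂ} :
    t ∈ fibre F A s ↔ affEq F A (s, t) = 0 := by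
  rw [fibre, mem_lineRoots hF hV, ← affineVec_eq_zero_add, affEq]

theorem card_fibre (hF : F.IsHomogeneous d) (hV : eval (vertex A) F ≠ 0) (s : ℂ) :
    (fibre F A s).card = d := card_lineRoots hF _ hV

theorem affEq_eq_prod (hF : F.IsHomogeneous d) (hV : eval (vertex A) F ≠ 0) (s t : ℂ) :
    affEq F A (s, t) = eval (vertex A) F * ((fibre F A s).map fun r => t - r).prod := by
  rw [affEq, affineVec_eq_zero_add]
  exact eval_add_smul_eq_prod hF _ hV t

/-- If `t` is large, `t⁻¹ • affineVec A s t` is close to the vertex, uniformly for `s` in a disc.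
Since `F` does not vanish near the vertex, homogeneity keeps such points off the curve. Thus the
projection from the vertex is proper. -/
theorem fibre_bounded (hF : F.IsHomogeneous d) (hV : eval (vertex A) F ≠ 0) (s₀ : ℂ) :
    ∃ R : ℝ, ∀ s ∈ Metric.closedBall s₀ 1, ∀ t, affEq F A (s, t) = 0 → ‖t‖ ≤ R := by
  have hc : Continuous fun s => affineVec A s 0 := by
    have := (contDiff_affineVec A (contDiff_fst (𝕜 := ℂ) (n := ω) (E := ℂ) (F := ℂ))
      (contDiff_const (c := (0 : ℂ)))).continuous
    exact this.comp (Continuous.prodMk continuous_id (continuous_const (y := (0 : ℂ))))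
  obtain ⟨B, hB⟩ := (isCompact_closedBall s₀ 1).exists_bound_of_continuousOn hc.continuousOn
  have h1 : ∀ᶠ v in 𝓝 (vertex A), eval v F ≠ 0 :=
    (contDiff_eval F).continuous.continuousAt.eventually_ne hV
  obtain ⟨ε, hε, h2⟩ := Metric.eventually_nhds_iff.1 h1
  refine ⟨|B| / ε + 1, fun s hs t ht => ?_⟩
  by_contra! hlt
  have hB0 : 0 ≤ |B| / ε := by positivity
  have ht0 : t ≠ 0 := by
    rintro rfl
    rw [norm_zero] at hlt
    linarith
  refine h2 (y := t⁻¹ • affineVec A s t) ?_ ?_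
  · rw [affineVec_eq_zero_add, smul_add, smul_smul, inv_mul_cancel₀ ht0, one_smul, dist_eq_norm,
      add_sub_cancel_right, norm_smul, norm_inv]
    have h3 : 0 < ‖t‖ := norm_pos_iff.2 ht0
    rw [inv_mul_lt_iff₀ h3]
    have h4 : |B| / ε < ‖t‖ := by linarith
    rw [div_lt_iff₀ hε] at h4
    exact ((hB s hs).trans (le_abs_self B)).trans_lt h4
  · rw [eval_smul_of_isHomogeneous hF]
    exact mul_eq_zero_of_right _ ht

/-- Neighbourhoods of the points of a fibre contain the neighbouring fibres. -/
theorem eventually_fibre (hF : F.IsHomogeneous d) (hV : eval (vertex A) F ≠ 0) {s₀ : ℂ}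
    {p : ℂ × ℂ → Prop} (h : ∀ t, affEq F A (s₀, t) = 0 → ∀ᶠ z in 𝓝 (s₀, t), affEq F A z = 0 → p z) :
    ∀ᶠ s in 𝓝 s₀, ∀ t, affEq F A (s, t) = 0 → p (s, t) := by
  obtain ⟨R, hR⟩ := fibre_bounded hF hV s₀
  -- Tube lemma over the compact disc that contains all nearby fibres; at values of `t` off the
  -- fibre the condition is vacuous nearby.
  have h1 := (isCompact_closedBall (0 : ℂ) R).eventually_forall_of_forall_eventually
    (x₀ := s₀) (P := fun s t => affEq F A (s, t) = 0 → p (s, t)) fun t _ => by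
      by_cases ht : affEq F A (s₀, t) = 0
      · exact h t ht
      · filter_upwards [(contDiff_affEq F A).continuous.continuousAt.eventually_ne ht] with z hz hz'
        exact absurd hz' hz
  filter_upwards [h1, Metric.closedBall_mem_nhds s₀ one_pos] with s hs hs' t ht
  exact hs t (by simpa using hR s hs' t ht) ht

/-- All the points of the fibres close to a given one are simple. -/
theorem eventually_fderiv_snd_ne_zero (hF : F.IsHomogeneous d) (hs : IsSmoothForm F)
    (hA : A.det ≠ 0) (hV : eval (vertex A) F ≠ 0) (s₀ : ℂ) :
    ∀ᶠ s in 𝓝[≠] s₀, ∀ t, affEq F A (s, t) = 0 → fderiv ℂ (affEq F A) (s, t) (0, 1) ≠ 0 := by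
  have hfd : ContDiff ℂ ω fun z => fderiv ℂ (affEq F A) z (0, 1) :=
    ((contDiff_affEq F A).fderiv_right (m := ω) (by simp)).clm_apply contDiff_const
  have key := eventually_fibre hF hV (s₀ := s₀)
    (p := fun z => z.1 ≠ s₀ → fderiv ℂ (affEq F A) z (0, 1) ≠ 0) fun t ht => by
      by_cases h1 : fderiv ℂ (affEq F A) (s₀, t) (0, 1) = 0
      swap
      · filter_upwards [hfd.continuous.continuousAt.eventually_ne h1] with z hz _ _
        exact hz
      have h2 : fderiv ℂ (affEq F A) (s₀, t) (1, 0) ≠ 0 :=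
        (clm_prod_ne_zero (fderiv_affEq_ne_zero hF hs hA ht)).resolve_right (not_not.2 h1)
      -- At a ramification point the curve is still a graph over the second coordinate, `s = ξ(r)`.
      -- The vertical derivative along it is analytic in `r`: it vanishes identically or has an
      -- isolated zero.
      obtain ⟨ξ, hξ, hξ0, hξ1⟩ := exists_implicit_fst (contDiff_affEq F A).contDiffAt ht h2
      simp only at hξ hξ0
      have hcurve : Filter.Tendsto (fun r => (ξ r, r)) (𝓝 t) (𝓝 (s₀, t)) := by
        have := hξ.continuousAt.prodMk (continuousAt_id (x := t))
        rw [ContinuousAt, hξ0] at this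
        exact this
      have hξ2 : ∀ᶠ r in 𝓝 t, affEq F A (ξ r, r) = 0 := by
        filter_upwards [hcurve.eventually hξ1] with r hr
        exact hr.2 rfl
      have ha : AnalyticAt ℂ (fun r => fderiv ℂ (affEq F A) (ξ r, r) (0, 1)) t :=
        ((hfd.contDiffAt.comp t (hξ.contDiffAt.prodMk contDiffAt_id)) : ContDiffAt ℂ ω
          ((fun z => fderiv ℂ (affEq F A) z (0, 1)) ∘ fun r => (ξ r, r)) t).analyticAt
      rcases ha.eventually_eq_zero_or_eventually_ne_zero with h3 | h3
      · exfalso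
        -- Differentiating `F(ξ r, r) = 0` gives `F_s ξ' + F_t = 0` with `F_t = 0` and `F_s ≠ 0`.
        have h4 : ∀ᶠ r in 𝓝 t, deriv ξ r = 0 := by
          have h5 : ∀ᶠ r in 𝓝 t, fderiv ℂ (affEq F A) (ξ r, r) (1, 0) ≠ 0 :=
            hcurve.eventually (((((contDiff_affEq F A).fderiv_right (m := ω)
              (by simp)).clm_apply contDiff_const).continuous.continuousAt).eventually_ne h2)
          filter_upwards [h3, h5, hξ.eventually_analyticAt, hξ2.eventually_nhds] with r h6 h7 h8 h9
          have h10 : HasDerivAt (fun r => (ξ r, r)) (deriv ξ r, 1) r :=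
            h8.differentiableAt.hasDerivAt.prodMk (hasDerivAt_id r)
          have h11 := HasFDerivAt.comp_hasDerivAt (f := fun r => (ξ r, r)) r
            ((contDiff_affEq F A).differentiable (by simp) (ξ r, r)).hasFDerivAt h10
          have h12 := h11.unique ((hasDerivAt_const r (0 : ℂ)).congr_of_eventuallyEq h9)
          rw [clm_prod_eq] at h12
          simpa [h6, h7] using h12
        obtain ⟨ε, hε, h5⟩ := Metric.eventually_nhds_iff_ball.1 (h4.and hξ.eventually_analyticAt)
        have h6 : ∀ᶠ r in 𝓝 t, ξ r = s₀ := by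
          filter_upwards [Metric.ball_mem_nhds t hε] with r hr
          rw [← hξ0]
          refine (convex_ball t ε).is_const_of_fderivWithin_eq_zero (𝕜 := ℂ) (f := ξ)
            (fun x hx => (h5 x hx).2.differentiableAt.differentiableWithinAt) (fun x hx => ?_) hr
            (Metric.mem_ball_self hε)
          rw [fderivWithin_of_isOpen Metric.isOpen_ball hx]
          ext
          simpa using (h5 x hx).1
        -- With `ξ` constant the curve would contain a piece of a vertical line, against the
        -- finiteness of the fibre.
        have h7 : ∀ᶠ r in 𝓝 t, r ∈ fibre F A s₀ := by
          filter_upwards [h6, hξ2] with r h8 h9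
          rw [mem_fibre hF hV, ← h8]
          exact h9
        have h8 : ({r | r ∈ fibre F A s₀} : Set ℂ).Finite := by
          have : {r | r ∈ fibre F A s₀} = ((fibre F A s₀).toFinset : Set ℂ) := by ext; simp
          rw [this]
          exact Finset.finite_toSet _
        exact h8.not_infinite (infinite_of_mem_nhds t h7)
      · have h4 : ∀ᶠ z in 𝓝 (s₀, t), z.2 ≠ t →
            fderiv ℂ (affEq F A) (ξ z.2, z.2) (0, 1) ≠ 0 := by
          have : Filter.Tendsto (Prod.snd : ℂ × ℂ → ℂ) (𝓝 (s₀, t)) (𝓝 t) :=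
            continuous_snd.tendsto (s₀, t)
          exact this.eventually (eventually_nhdsWithin_iff.1 h3)
        filter_upwards [h4, hξ1] with z h5 h6 h7 h8
        have h9 := h6.1 h7
        rw [h9] at h5
        refine h5 fun h10 => h8 ?_
        rw [← h9, h10, hξ0]
  rw [eventually_nhdsWithin_iff]
  filter_upwards [key] with s h1 h2 t ht
  exact h1 t ht h2

end

end

section

open MvPolynomial (eval)
open ProjectivePlane

/-! ### Vector fields with poles along the cone over a plane curve -/

/-- The nonzero vectors at which `F` vanishes. -/
def cone (F : MvPolynomial (Fin 3) ℂ) : Set (Fin 3 → ℂ) := {v | v ≠ 0 ∧ eval v F = 0}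

/-- A field of vectors `u v` orthogonal to `v` along the cone `F = 0`, homogeneous of degree
`2 - d`, nonvanishing and holomorphic except for poles of order at most `m`. -/
structure IsPolarField (F : MvPolynomial (Fin 3) ℂ) (d : ℕ) (m : ProjectivePlane → ℕ)
    (u : (Fin 3 → ℂ) → Fin 3 → ℂ) : Prop where
  smul : ∀ v ∈ cone F, ∀ c : ℂ, c ≠ 0 → c ^ (d - 2) • u (c • v) = u v
  dot_self : ∀ v ∈ cone F, v ⬝ᵥ u v = 0
  analytic : ∀ v (hv : v ∈ cone F), m (Projectivization.mk ℂ v hv.1) = 0 →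
    u v ≠ 0 ∧ ∃ w, AnalyticAt ℂ w v ∧ ∀ᶠ x in 𝓝[cone F] v, u x = w x
  bounded : ∀ v (hv : v ∈ cone F) (β : Fin 3 → ℂ), β ⬝ᵥ v = 0 →
    ∃ M : ℝ, ∀ᶠ x in 𝓝[cone F] v,
      ‖β ⬝ᵥ x‖ ^ m (Projectivization.mk ℂ v hv.1) * ‖u x‖ ≤ M

section

variable {F : MvPolynomial (Fin 3) ℂ} {d : ℕ} {A : Matrix (Fin 3) (Fin 3) ℂ}
  {m : ProjectivePlane → ℕ} {u : (Fin 3 → ℂ) → Fin 3 → ℂ}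

theorem affineVec_mem_cone (hA : A.det ≠ 0) {s t : ℂ} :
    affineVec A s t ∈ cone F ↔ affEq F A (s, t) = 0 :=
  and_iff_right (affineVec_ne_zero hA s t)

theorem continuous_affineVec (A : Matrix (Fin 3) (Fin 3) ℂ) :
    Continuous fun z : ℂ × ℂ => affineVec A z.1 z.2 :=
  (contDiff_affineVec A contDiff_fst contDiff_snd).continuous

theorem eventually_affineVec (hA : A.det ≠ 0) {z : ℂ × ℂ} {p : (Fin 3 → ℂ) → Prop}
    (h : ∀ᶠ v in 𝓝[cone F] (affineVec A z.1 z.2), p v) :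
    ∀ᶠ y in 𝓝 z, affEq F A y = 0 → p (affineVec A y.1 y.2) := by
  rw [eventually_nhdsWithin_iff] at h
  filter_upwards [(continuous_affineVec A).continuousAt.eventually h] with y hy hy'
  exact hy ((affineVec_mem_cone hA).2 hy')

/-- The multiplicity bound at the point with affine coordinates `(s, t)`. -/
def affOrder (m : ProjectivePlane → ℕ) (A : Matrix (Fin 3) (Fin 3) ℂ) (hA : A.det ≠ 0)
    (s t : ℂ) : ℕ := m (Projectivization.mk ℂ (affineVec A s t) (affineVec_ne_zero hA s t))

/-- The product of the values of `⟨p, u⟩` over a fibre. -/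
def fibreNorm (F : MvPolynomial (Fin 3) ℂ) (A : Matrix (Fin 3) (Fin 3) ℂ)
    (u : (Fin 3 → ℂ) → Fin 3 → ℂ) (p : Fin 3 → ℂ) (s : ℂ) : ℂ :=
  ((fibre F A s).map fun t => p ⬝ᵥ u (affineVec A s t)).prod

/-- A fibre consisting of simple points at which there are no poles. -/
def IsRegularFibre (F : MvPolynomial (Fin 3) ℂ) (A : Matrix (Fin 3) (Fin 3) ℂ) (hA : A.det ≠ 0)
    (m : ProjectivePlane → ℕ) (s : ℂ) : Prop :=
  ∀ t, affEq F A (s, t) = 0 →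
    fderiv ℂ (affEq F A) (s, t) (0, 1) ≠ 0 ∧ affOrder m A hA s t = 0

theorem eventually_notMem_of_finite {T : Set ℂ} (hT : T.Finite) (s₀ : ℂ) :
    ∀ᶠ s in 𝓝[≠] s₀, s ∉ T := by
  have h := (hT.subset (Set.sdiff_subset (t := {s₀}))).isClosed.isOpen_compl.mem_nhds
    (x := s₀) (fun h => h.2 rfl)
  rw [eventually_nhdsWithin_iff]
  filter_upwards [h] with s hs hs' hsT
  exact hs ⟨hsT, hs'⟩

/-- The first coordinate of an affine point recovers `s`, so the exceptional values of `s` are among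
the images of the finitely many points of `D`. -/
theorem finite_affOrder_ne_zero (hA : A.det ≠ 0) {D : Finset ProjectivePlane}
    (hm : ∀ q ∉ D, m q = 0) : {s | ∃ t, affOrder m A hA s t ≠ 0}.Finite := by
  refine (D.finite_toSet.image (ProjectivePlane.ratio (A 1) (A 0))).subset ?_
  rintro s ⟨t, ht⟩
  refine ⟨_, not_not.1 fun h => ht (hm _ h), ?_⟩
  rw [ProjectivePlane.ratio_mk, dot_affineVec hA, dot_affineVec hA]
  simp

theorem eventually_isRegularFibre (hF : F.IsHomogeneous d) (hs : IsSmoothForm F)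
    (hA : A.det ≠ 0) (hV : eval (vertex A) F ≠ 0) {D : Finset ProjectivePlane}
    (hm : ∀ q ∉ D, m q = 0) (s₀ : ℂ) : ∀ᶠ s in 𝓝[≠] s₀, IsRegularFibre F A hA m s := by
  filter_upwards [eventually_fderiv_snd_ne_zero hF hs hA hV s₀,
    eventually_notMem_of_finite (finite_affOrder_ne_zero hA hm) s₀] with s h1 h2 t ht
  refine ⟨h1 t ht, ?_⟩
  by_contra h3
  exact h2 ⟨t, h3⟩

/-- A multiple root of the restriction of `F` to a vertical line is a point where the vertical
derivative vanishes. -/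
theorem IsRegularFibre.nodup {hA : A.det ≠ 0} {s : ℂ} (h : IsRegularFibre F A hA m s)
    (hF : F.IsHomogeneous d) (hV : eval (vertex A) F ≠ 0) : (fibre F A s).Nodup := by
  classical
  rw [Multiset.nodup_iff_count_le_one]
  intro t
  rw [fibre, lineRoots, Polynomial.count_roots]
  by_contra! hlt
  rw [Polynomial.one_lt_rootMultiplicity_iff_isRoot (linePoly_ne_zero hF _ hV)] at hlt
  have he : ∀ r, (linePoly F (affineVec A s 0) (vertex A)).eval r = affEq F A (s, r) := fun r => by
    rw [eval_linePoly, ← affineVec_eq_zero_add, affEq]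
  have h0 : affEq F A (s, t) = 0 := by rw [← he]; exact hlt.1
  refine (h t h0).1 ?_
  have h1 := (linePoly F (affineVec A s 0) (vertex A)).hasDerivAt t
  have h2 := HasFDerivAt.comp_hasDerivAt (f := fun r : ℂ => (s, r)) t
    ((contDiff_affEq F A).differentiable (by simp) (s, t)).hasFDerivAt
    ((hasDerivAt_const t s).prodMk (hasDerivAt_id t))
  have h3 : (affEq F A ∘ fun r : ℂ => (s, r)) =
      fun r => (linePoly F (affineVec A s 0) (vertex A)).eval r := funext fun r => (he r).symm
  rw [h3] at h2
  rw [h2.unique h1]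
  exact hlt.2

/-- Near a regular fibre, the points of the fibres are given by holomorphic functions. -/
theorem IsRegularFibre.differentiableAt {hA : A.det ≠ 0} {s : ℂ} (h : IsRegularFibre F A hA m s)
    (hF : F.IsHomogeneous d) (hV : eval (vertex A) F ≠ 0) (hu : IsPolarField F d m u)
    (p : Fin 3 → ℂ) : DifferentiableAt ℂ (fibreNorm F A u p) s := by
  classical
  set Y := (fibre F A s).toFinset with hY
  have hY0 : ∀ t ∈ Y, affEq F A (s, t) = 0 := fun t ht =>
    (mem_fibre hF hV).1 (Multiset.mem_toFinset.1 ht)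
  have hex : ∀ t : ℂ, ∃ η : ℂ → ℂ, t ∈ Y → AnalyticAt ℂ η s ∧ η s = t ∧
      (∀ᶠ r in 𝓝 s, affEq F A (r, η r) = 0) ∧
      ∃ f : ℂ → ℂ, AnalyticAt ℂ f s ∧ ∀ᶠ r in 𝓝 s, p ⬝ᵥ u (affineVec A r (η r)) = f r := by
    intro t
    by_cases ht : t ∈ Y
    swap
    · exact ⟨0, fun h => absurd h ht⟩
    have h0 := hY0 t ht
    obtain ⟨η, h1, h2, h3⟩ := exists_implicit_snd (contDiff_affEq F A).contDiffAt h0 (h t h0).1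
    simp only at h1 h2
    have hc : Filter.Tendsto (fun r => (r, η r)) (𝓝 s) (𝓝 (s, t)) := by
      have := (continuousAt_id (x := s)).prodMk h1.continuousAt
      rw [ContinuousAt, h2] at this
      exact this
    have h4 : ∀ᶠ r in 𝓝 s, affEq F A (r, η r) = 0 := by
      filter_upwards [hc.eventually h3] with r hr
      exact hr.2 rfl
    refine ⟨η, fun _ => ⟨h1, h2, h4, ?_⟩⟩
    obtain ⟨-, w, hw, hw'⟩ := hu.analytic _ ((affineVec_mem_cone hA).2 h0) (h t h0).2
    refine ⟨fun r => p ⬝ᵥ w (affineVec A r (η r)), ?_, ?_⟩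
    · have h5 : AnalyticAt ℂ (fun r => affineVec A r (η r)) s :=
        ((contDiff_affineVec A contDiff_fst contDiff_snd).contDiffAt.comp s
          (contDiffAt_id.prodMk h1.contDiffAt) : ContDiffAt ℂ ω
          ((fun z : ℂ × ℂ => affineVec A z.1 z.2) ∘ fun r => (r, η r)) s).analyticAt
      have h6 : AnalyticAt ℂ (fun r => w (affineVec A r (η r))) s :=
        AnalyticAt.fun_comp (by rw [h2]; exact hw) h5
      have h7 := contDiffAt_pi.1 (h6.contDiffAt (n := ω))
      simp only [dotProduct, Fin.sum_univ_three]
      exact (((contDiffAt_const.mul (h7 0)).add (contDiffAt_const.mul (h7 1))).add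
        (contDiffAt_const.mul (h7 2))).analyticAt
    · filter_upwards [hc.eventually (eventually_affineVec hA (z := (s, t)) hw'), h4] with r h5 h6
      rw [h5 h6]
  choose η hη using hex
  have hη' : ∀ t ∈ Y, ∃ f : ℂ → ℂ, AnalyticAt ℂ f s ∧
      ∀ᶠ r in 𝓝 s, p ⬝ᵥ u (affineVec A r (η t r)) = f r := fun t ht => (hη t ht).2.2.2
  choose! f hf hf' using hη'
  -- The branches through the points of a regular fibre stay distinct, and there are `d` of them
  -- because the fibre has no repeated points. They are therefore all the points of the nearby
  -- fibres.
  have hroots : ∀ᶠ r in 𝓝 s, fibre F A r = Y.val.map fun t => η t r := by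
    have h1 : ∀ᶠ r in 𝓝 s, ∀ t ∈ Y, affEq F A (r, η t r) = 0 :=
      (Finset.eventually_all Y).2 fun t ht => (hη t ht).2.2.1
    have h2 : ∀ᶠ r in 𝓝 s, ∀ t ∈ Y, ∀ t' ∈ Y, t ≠ t' → η t r ≠ η t' r := by
      refine (Finset.eventually_all Y).2 fun t ht => (Finset.eventually_all Y).2 fun t' ht' => ?_
      by_cases htt : t = t'
      · exact Filter.Eventually.of_forall fun r hr => absurd htt hr
      · have h3 := ((hη t ht).1.continuousAt.sub (hη t' ht').1.continuousAt).eventually_ne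
          (y := 0) (by
            simp only [Pi.sub_apply]
            rw [(hη t ht).2.1, (hη t' ht').2.1]
            exact sub_ne_zero.2 htt)
        filter_upwards [h3] with r hr _
        exact sub_ne_zero.1 hr
    filter_upwards [h1, h2] with r h3 h4
    symm
    refine Multiset.eq_of_le_of_card_le ?_ ?_
    · rw [Multiset.le_iff_subset]
      · intro y hy
        obtain ⟨t, ht, rfl⟩ := Multiset.mem_map.1 hy
        exact (mem_fibre hF hV).2 (h3 t ht)
      · refine Multiset.Nodup.map_on (fun t ht t' ht' hh => ?_) Y.nodup
        by_contra hne
        exact h4 t ht t' ht' hne hh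
    · rw [card_fibre hF hV, Multiset.card_map, ← card_fibre hF hV s, hY,
        Multiset.toFinset_val, (h.nodup hF hV).dedup]
  have heq : fibreNorm F A u p =ᶠ[𝓝 s] fun r => ∏ t ∈ Y, f t r := by
    filter_upwards [hroots, (Finset.eventually_all Y).2 hf'] with r h1 h2
    rw [fibreNorm, h1, Multiset.map_map]
    exact Finset.prod_congr rfl h2
  refine DifferentiableAt.congr_of_eventuallyEq ?_ heq
  exact DifferentiableAt.fun_finsetProd fun t ht => (hf t ht).differentiableAt

end

end

/-! ### The order of the poles of the norm. -/

section

open MvPolynomial (eval)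
open ProjectivePlane

section

variable {F : MvPolynomial (Fin 3) ℂ} {d : ℕ} {A : Matrix (Fin 3) (Fin 3) ℂ}
  {m : ProjectivePlane → ℕ} {u : (Fin 3 → ℂ) → Fin 3 → ℂ}

theorem norm_dot_le (p w : Fin 3 → ℂ) : ‖p ⬝ᵥ w‖ ≤ (∑ i, ‖p i‖) * ‖w‖ := by
  rw [dotProduct, Finset.sum_mul]
  refine (norm_sum_le _ _).trans (Finset.sum_le_sum fun i _ => ?_)
  rw [norm_mul]
  exact mul_le_mul_of_nonneg_left (norm_le_pi_norm w i) (norm_nonneg _)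

theorem norm_multiset_prod (s : Multiset ℂ) : ‖s.prod‖ = (s.map fun x => ‖x‖).prod :=
  map_multiset_prod (normHom : ℂ →*₀ ℝ) s

theorem norm_multiset_prod_le {ι : Type*} {s : Multiset ι} {f : ι → ℂ} {M : ℝ}
    (h : ∀ x ∈ s, ‖f x‖ ≤ M) : ‖(s.map f).prod‖ ≤ M ^ s.card := by
  rw [norm_multiset_prod, Multiset.map_map, ← Multiset.prod_replicate, ← Multiset.map_const']
  exact Multiset.prod_map_le_prod_map₀ _ _ (fun x _ => norm_nonneg _) h

theorem eventually_norm_le_of_continuousAt {X E : Type*} [TopologicalSpace X]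
    [NormedAddCommGroup E] {f : X → E} {x : X} (hf : ContinuousAt f x) :
    ∃ M : ℝ, ∀ᶠ y in 𝓝 x, ‖f y‖ ≤ M :=
  ⟨‖f x‖ + 1, (hf.norm.eventually_lt continuousAt_const (lt_add_one _)).mono fun _ h => h.le⟩

/-- A line through the point `(s, t)` of the curve which is not tangent to it, as the graph of a
function of the first coordinate of slope `μ`. -/
theorem exists_transverse_slope (hF : F.IsHomogeneous d) (hs : IsSmoothForm F) (hA : A.det ≠ 0)
    {s t : ℂ} (h0 : affEq F A (s, t) = 0) :
    ∃ μ : ℂ, fderiv ℂ (affEq F A) (s, t) (1, μ) ≠ 0 := by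
  rcases em (fderiv ℂ (affEq F A) (s, t) (1, 0) = 0) with h | h
  · refine ⟨1, ?_⟩
    rw [clm_prod_eq, h]
    simpa using (clm_prod_ne_zero (fderiv_affEq_ne_zero hF hs hA h0)).resolve_left (not_not.2 h)
  · exact ⟨0, h⟩

/-- Restricted to a line that is not tangent to the curve, the equation has a simple zero, so it
controls `r - s` linearly. -/
theorem isBigO_affEq_line {s t μ : ℂ} (h0 : affEq F A (s, t) = 0)
    (h1 : fderiv ℂ (affEq F A) (s, t) (1, μ) ≠ 0) :
    ∃ c : ℝ, 0 ≤ c ∧ ∀ᶠ r in 𝓝 s, ‖r - s‖ ≤ c * ‖affEq F A (r, t + μ * (r - s))‖ := by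
  have h2 : HasDerivAt (fun r => (r, t + μ * (r - s))) ((1 : ℂ), μ) s := by
    refine (hasDerivAt_id s).prodMk ?_
    simpa using (((hasDerivAt_id s).sub_const s).const_mul μ).const_add t
  have h3 : HasFDerivAt (affEq F A) (fderiv ℂ (affEq F A) (s, t)) (s, t + μ * (s - s)) := by
    rw [sub_self, mul_zero, add_zero]
    exact ((contDiff_affEq F A).differentiable (by simp) (s, t)).hasFDerivAt
  have h4 := ((HasFDerivAt.comp_hasDerivAt (f := fun r => (r, t + μ * (r - s))) s h3
    h2).isTheta_sub h1).2
  obtain ⟨c, hc, h5⟩ := h4.exists_nonneg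
  refine ⟨c, hc, ?_⟩
  have h6 := h5.bound
  rw [Filter.prod_pure, Filter.eventually_map] at h6
  filter_upwards [h6] with r hr
  simpa [h0] using hr

/-- The norm of a field with poles has at each point a pole of order at most the sum of the orders
over the fibre. -/
theorem IsPolarField.exists_fibreNorm_le (hF : F.IsHomogeneous d) (hs : IsSmoothForm F)
    (hA : A.det ≠ 0) (hV : eval (vertex A) F ≠ 0) (hu : IsPolarField F d m u) (p : Fin 3 → ℂ)
    (s₀ : ℂ) : ∃ K : ℝ, ∀ᶠ s in 𝓝 s₀,
      ‖s - s₀‖ ^ (∑ t ∈ (fibre F A s₀).toFinset, affOrder m A hA s₀ t) * ‖fibreNorm F A u p s‖ ≤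
        K := by
  classical
  set Y := (fibre F A s₀).toFinset with hY
  set n : ℂ → ℕ := affOrder m A hA s₀ with hn
  have hY0 : ∀ t, affEq F A (s₀, t) = 0 ↔ t ∈ Y := fun t => by
    rw [hY, Multiset.mem_toFinset, mem_fibre hF hV]
  have hμ : ∀ t ∈ Y, ∃ μ : ℂ, fderiv ℂ (affEq F A) (s₀, t) (1, μ) ≠ 0 := fun t ht =>
    exists_transverse_slope hF hs hA ((hY0 t).2 ht)
  choose! μ hμ using hμ
  set τ : ℂ → ℂ → ℂ := fun t s => t + μ t * (s - s₀) with hτ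
  set P : ℝ := ∑ i, ‖p i‖ with hP
  have hP0 : 0 ≤ P := Finset.sum_nonneg fun i _ => norm_nonneg _
  -- the factors of `B` are linear forms through the points of the fibre
  set B : ℂ × ℂ → ℂ := fun z => ∏ t ∈ Y, (z.2 - τ t z.1) ^ n t with hB
  have hb : ∀ t ∈ Y, ∃ M : ℝ, ∀ᶠ z in 𝓝 (s₀, t), affEq F A z = 0 →
      ‖B z‖ * ‖p ⬝ᵥ u (affineVec A z.1 z.2)‖ ≤ M := by
    intro t ht
    -- This form takes the value `z.2 - τ t z.1` at the affine point `z`: it defines the non-tangent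
    -- line of slope `μ t` through the pole. Its power bounds the pole at `t`, and the remaining
    -- factors of `B` are merely bounded there.
    obtain ⟨M, hM⟩ := hu.bounded _ ((affineVec_mem_cone hA).2 ((hY0 t).2 ht))
      (A 2 - μ t • A 1 + (μ t * s₀ - t) • A 0) (by
        rw [add_dotProduct, sub_dotProduct, smul_dotProduct, smul_dotProduct,
          dot_affineVec hA, dot_affineVec hA, dot_affineVec hA]
        simp)
    have h1 := eventually_affineVec hA (z := (s₀, t)) hM
    have hcont : Continuous fun z : ℂ × ℂ => ∏ r ∈ Y.erase t, (z.2 - τ r z.1) ^ n r := by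
      refine continuous_finsetProd _ fun r _ => Continuous.pow (continuous_snd.sub ?_) _
      exact continuous_const.add (continuous_const.mul (continuous_fst.sub continuous_const))
    obtain ⟨M₂, h2⟩ := eventually_norm_le_of_continuousAt (hcont.continuousAt (x := (s₀, t)))
    refine ⟨M₂ * (P * |M|), ?_⟩
    filter_upwards [h1, h2] with z h3 h4 hz
    have hM₂ : 0 ≤ M₂ := (norm_nonneg _).trans h4
    have h5 := h3 hz
    have h6 : (A 2 - μ t • A 1 + (μ t * s₀ - t) • A 0) ⬝ᵥ affineVec A z.1 z.2 = z.2 - τ t z.1 := by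
      rw [add_dotProduct, sub_dotProduct, smul_dotProduct, smul_dotProduct,
        dot_affineVec hA, dot_affineVec hA, dot_affineVec hA]
      simp only [Matrix.cons_val, smul_eq_mul, hτ]
      ring
    rw [h6] at h5
    have h7 : B z = (z.2 - τ t z.1) ^ n t * ∏ r ∈ Y.erase t, (z.2 - τ r z.1) ^ n r :=
      (Finset.mul_prod_erase Y (fun r => (z.2 - τ r z.1) ^ n r) ht).symm
    rw [h7, norm_mul, norm_pow]
    calc ‖z.2 - τ t z.1‖ ^ n t * ‖∏ r ∈ Y.erase t, (z.2 - τ r z.1) ^ n r‖ *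
          ‖p ⬝ᵥ u (affineVec A z.1 z.2)‖
        ≤ ‖z.2 - τ t z.1‖ ^ n t * M₂ * (P * ‖u (affineVec A z.1 z.2)‖) := by
          gcongr
          exact norm_dot_le p _
      _ = M₂ * (P * (‖z.2 - τ t z.1‖ ^ n t * ‖u (affineVec A z.1 z.2)‖)) := by ring
      _ ≤ M₂ * (P * |M|) := by
          gcongr
          exact h5.trans (le_abs_self M)
  choose! M hM using hb
  set M₀ := ∑ t ∈ Y, |M t| with hM₀
  have hM₀' : ∀ t ∈ Y, M t ≤ M₀ := fun t ht =>
    (le_abs_self _).trans (Finset.single_le_sum (f := fun t => |M t|) (fun _ _ => abs_nonneg _) ht)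
  have hM₀0 : 0 ≤ M₀ := Finset.sum_nonneg fun _ _ => abs_nonneg _
  have hfib := eventually_fibre hF hV (s₀ := s₀)
    (p := fun z => ‖B z‖ * ‖p ⬝ᵥ u (affineVec A z.1 z.2)‖ ≤ M₀) fun t ht => by
      filter_upwards [hM t ((hY0 t).1 ht)] with z hz hz'
      exact (hz hz').trans (hM₀' t ((hY0 t).1 ht))
  have hlow : ∀ t ∈ Y, ∃ c : ℝ, 0 ≤ c ∧
      ∀ᶠ r in 𝓝 s₀, ‖r - s₀‖ ≤ c * ‖affEq F A (r, τ t r)‖ := fun t ht =>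
    isBigO_affEq_line ((hY0 t).2 ht) (hμ t ht)
  choose! c hc0 hc using hlow
  set V := ‖eval (vertex A) F‖
  refine ⟨(∏ t ∈ Y, (c t * V) ^ n t) * M₀ ^ d, ?_⟩
  filter_upwards [hfib, (Finset.eventually_all Y).2 hc] with s h1 h2
  -- The local bound `‖B‖ ‖p · u‖ ≤ M₀` is multiplied over the `d` points of the fibre.
  have h3 : ‖((fibre F A s).map fun r => B (s, r)).prod‖ * ‖fibreNorm F A u p s‖ ≤ M₀ ^ d := by
    rw [fibreNorm, ← norm_mul, ← Multiset.prod_map_mul, ← card_fibre hF hV s]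
    refine norm_multiset_prod_le fun r hr => ?_
    rw [norm_mul]
    exact h1 r ((mem_fibre hF hV).1 hr)
  -- Interchanging the two products groups, for each `t`, the distances of all points of the fibre
  -- over `s` from one auxiliary line.
  have h4 : ‖((fibre F A s).map fun r => B (s, r)).prod‖ =
      ∏ t ∈ Y, ‖((fibre F A s).map fun r => r - τ t s).prod‖ ^ n t := by
    simp only [hB]
    rw [Multiset.prod_map_prod, norm_prod]
    refine Finset.prod_congr rfl fun t _ => ?_
    rw [Multiset.prod_map_pow, norm_pow]
  -- Up to the constant `V` and sign, the inner product is the value of the equation on the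
  -- auxiliary line, which vanishes to first order at `s₀`. So the norm of the linear form has a
  -- simple zero even when the fibre is ramified at `t`, and no ramification index enters the
  -- estimate.
  have h5 : ∀ t ∈ Y, ‖s - s₀‖ ^ n t ≤
      (c t * V) ^ n t * ‖((fibre F A s).map fun r => r - τ t s).prod‖ ^ n t := by
    intro t ht
    rw [← mul_pow]
    refine pow_le_pow_left₀ (norm_nonneg _) ((h2 t ht).trans_eq ?_) _
    rw [affEq_eq_prod hF hV, norm_mul, ← mul_assoc, norm_multiset_prod, norm_multiset_prod,
      Multiset.map_map, Multiset.map_map]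
    congr 2
    refine Multiset.map_congr rfl fun r _ => ?_
    exact norm_sub_rev _ _
  calc ‖s - s₀‖ ^ (∑ t ∈ Y, n t) * ‖fibreNorm F A u p s‖
      = (∏ t ∈ Y, ‖s - s₀‖ ^ n t) * ‖fibreNorm F A u p s‖ := by rw [Finset.prod_pow_eq_pow_sum]
    _ ≤ (∏ t ∈ Y, (c t * V) ^ n t * ‖((fibre F A s).map fun r => r - τ t s).prod‖ ^ n t) *
        ‖fibreNorm F A u p s‖ := by
        gcongr with t ht
        exact h5 t ht
    _ = (∏ t ∈ Y, (c t * V) ^ n t) * (‖((fibre F A s).map fun r => B (s, r)).prod‖ *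
        ‖fibreNorm F A u p s‖) := by rw [Finset.prod_mul_distrib, h4, mul_assoc]
    _ ≤ (∏ t ∈ Y, (c t * V) ^ n t) * M₀ ^ d := by
        gcongr
        exact Finset.prod_nonneg fun t ht => pow_nonneg (mul_nonneg (hc0 t ht) (norm_nonneg _)) _

end

end

/-! ### Liouville's theorem across removable singularities, and behaviour at infinity. -/

section

open MvPolynomial (eval)
open ProjectivePlane

/-- A function which is holomorphic and bounded near infinity away from removable singularities is
constant there. -/
theorem exists_eq_const_of_removable {g : ℂ → ℂ} {G : ℂ → Prop}
    (hG : ∀ s₀, ∀ᶠ s in 𝓝[≠] s₀, G s) (hd : ∀ s, G s → DifferentiableAt ℂ g s)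
    (hb : ∀ s₀, ∃ K : ℝ, ∀ᶠ s in 𝓝[≠] s₀, ‖g s‖ ≤ K)
    (hinf : ∃ R K : ℝ, ∀ s, G s → R ≤ ‖s‖ → ‖g s‖ ≤ K) : ∃ c, ∀ s, G s → g s = c := by
  -- The values of `g` off the good set carry no information; they are replaced by limits along
  -- punctured neighbourhoods, and `f` is entire by the removable singularity theorem.
  set f : ℂ → ℂ := fun s => (𝓝[≠] s).limUnder g with hf
  have h1 : ∀ s, G s → f s = g s := fun s hs =>
    (((hd s hs).continuousAt.tendsto).mono_left nhdsWithin_le_nhds).limUnder_eq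
  have h2 : Differentiable ℂ f := by
    intro s₀
    obtain ⟨K, hK⟩ := hb s₀
    have h3 := eventually_nhdsWithin_iff.1 ((hG s₀).and hK)
    obtain ⟨U, hU, hUo, hs₀⟩ := eventually_nhds_iff.1 h3
    have h4 := Complex.differentiableOn_update_limUnder_of_bddAbove (hUo.mem_nhds hs₀)
      (fun x hx => (hd x (hU x hx.1 hx.2).1).differentiableWithinAt)
      ⟨K, by
        rintro _ ⟨x, hx, rfl⟩
        exact (hU x hx.1 hx.2).2⟩
    refine (h4.differentiableAt (hUo.mem_nhds hs₀)).congr_of_eventuallyEq ?_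
    filter_upwards [hUo.mem_nhds hs₀] with x hx
    by_cases hxs : x = s₀
    · subst hxs
      simp [hf]
    · rw [Function.update_of_ne hxs, h1 x (hU x hx hxs).1]
  have h3 : ∀ s, Filter.Tendsto g (𝓝[≠] s) (𝓝 (f s)) := fun s =>
    ((h2 s).continuousAt.tendsto.mono_left nhdsWithin_le_nhds).congr' ((hG s).mono h1)
  obtain ⟨R, K, hRK⟩ := hinf
  have h4 : Bornology.IsBounded (Set.range f) := by
    obtain ⟨B, hB⟩ := (isCompact_closedBall (0 : ℂ) R).exists_bound_of_continuousOn
      h2.continuous.continuousOn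
    refine isBounded_iff_forall_norm_le.2 ⟨max B K, ?_⟩
    rintro _ ⟨s, rfl⟩
    by_cases hs : ‖s‖ ≤ R
    · exact (hB s (by simpa using hs)).trans (le_max_left _ _)
    · refine le_trans ?_ (le_max_right _ _)
      refine le_of_tendsto (h3 s).norm ?_
      have h5 : ∀ᶠ x in 𝓝 s, R < ‖x‖ :=
        continuous_norm.continuousAt.eventually_const_lt (not_le.1 hs)
      filter_upwards [hG s, nhdsWithin_le_nhds h5] with x hx hx'
      exact hRK x hx hx'.le
  exact ⟨f 0, fun s hs => by rw [← h1 s hs]; exact h2.apply_eq_apply_of_bounded h4 s 0⟩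

section

variable {F : MvPolynomial (Fin 3) ℂ} {d : ℕ} {A : Matrix (Fin 3) (Fin 3) ℂ}
  {m : ProjectivePlane → ℕ} {u : (Fin 3 → ℂ) → Fin 3 → ℂ}

/-! ### Smooth curves of degree at least two contain no lines -/

/-- The derivative of `F` in the constant direction `e`. -/
def dirDeriv (F : MvPolynomial (Fin 3) ℂ) (e : Fin 3 → ℂ) : MvPolynomial (Fin 3) ℂ :=
  ∑ i, MvPolynomial.C (e i) * MvPolynomial.pderiv i F

theorem eval_dirDeriv (F : MvPolynomial (Fin 3) ℂ) (e v : Fin 3 → ℂ) :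
    eval v (dirDeriv F e) = gradient F v ⬝ᵥ e := by
  simp only [dirDeriv, map_sum, map_mul, MvPolynomial.eval_C, dotProduct, gradient]
  exact Finset.sum_congr rfl fun i _ => mul_comm _ _

theorem isHomogeneous_dirDeriv (hF : F.IsHomogeneous d) (e : Fin 3 → ℂ) :
    (dirDeriv F e).IsHomogeneous (d - 1) := by
  refine MvPolynomial.IsHomogeneous.sum _ _ _ fun i _ => ?_
  simpa using (MvPolynomial.isHomogeneous_C (Fin 3) (e i)).mul (hF.pderiv (i := i))

/-- If `F` vanished on the line spanned by `f₁` and `f₂`, its gradient along the line would be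
orthogonal to both, so only the component along `e` could be nonzero. By smoothness that component
is a polynomial in `t` without zeros, hence constant. As its formal degree is `d - 1 ≥ 1`, its top
coefficient, which is the component at the point at infinity `f₂`, vanishes. The whole gradient then
vanishes at `f₂`, against smoothness. -/
theorem linePoly_ne_zero_of_smooth (hF : F.IsHomogeneous d) (hd : 2 ≤ d) (hs : IsSmoothForm F)
    {f₁ f₂ e : Fin 3 → ℂ}
    (hspan : ∀ g : Fin 3 → ℂ, g ⬝ᵥ f₁ = 0 → g ⬝ᵥ f₂ = 0 → g ⬝ᵥ e = 0 → g = 0)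
    (hf : ∀ t : ℂ, f₁ + t • f₂ ≠ 0) (hf₂ : f₂ ≠ 0) : linePoly F f₁ f₂ ≠ 0 := by
  intro h0
  have h1 : ∀ t : ℂ, eval (f₁ + t • f₂) F = 0 := fun t => by rw [← eval_linePoly, h0]; simp
  have h2 : ∀ t : ℂ, gradient F (f₁ + t • f₂) ⬝ᵥ f₂ = 0 := fun t => by
    have h3 : HasDerivAt (fun t : ℂ => f₁ + t • f₂) f₂ t := by
      simpa using ((hasDerivAt_id t).smul_const f₂).const_add f₁
    have h4 := hasDerivAt_eval_comp F h3
    simp only [h1] at h4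
    exact h4.unique (hasDerivAt_const t 0)
  have h3 : ∀ t : ℂ, gradient F (f₁ + t • f₂) ⬝ᵥ f₁ = 0 := fun t => by
    have h4 := gradient_dot_self hF (f₁ + t • f₂)
    rwa [h1, mul_zero, dotProduct_add, dotProduct_smul, h2, smul_zero, add_zero] at h4
  have h4 : ∀ t : ℂ, gradient F (f₁ + t • f₂) ⬝ᵥ e ≠ 0 := fun t h5 =>
    hs _ (hf t) (h1 t) (hspan _ (h3 t) (h2 t) h5)
  have h5 : eval f₂ F = 0 := by rw [← coeff_linePoly hF f₁, h0, Polynomial.coeff_zero]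
  have h6 : gradient F f₂ ⬝ᵥ f₁ = 0 := by
    rw [← eval_dirDeriv, ← coeff_linePoly (isHomogeneous_dirDeriv hF f₁) f₁]
    have : linePoly (dirDeriv F f₁) f₁ f₂ = 0 := Polynomial.funext fun t => by
      rw [eval_linePoly, eval_dirDeriv, h3, Polynomial.eval_zero]
    rw [this, Polynomial.coeff_zero]
  have h7 : gradient F f₂ ⬝ᵥ e = 0 := by
    rw [← eval_dirDeriv, ← coeff_linePoly (isHomogeneous_dirDeriv hF e) f₁]
    have h8 : (linePoly (dirDeriv F e) f₁ f₂).degree = 0 := by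
      by_contra h9
      obtain ⟨t, ht⟩ := IsAlgClosed.exists_root _ h9
      rw [Polynomial.IsRoot, eval_linePoly, eval_dirDeriv] at ht
      exact h4 t ht
    rw [Polynomial.eq_C_of_degree_eq_zero h8, Polynomial.coeff_C_of_ne_zero (by omega)]
  refine hs f₂ hf₂ h5 (hspan _ h6 ?_ h7)
  rw [gradient_dot_self hF, h5, mul_zero]

/-- If `w` does not vanish at the vertex, its line is a graph over the first coordinate, and `F`
restricts to it as a nonzero polynomial in `s`. Otherwise the line is vertical, with a single value
of `s`, or it is the line at infinity, which has no affine points. -/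
theorem finite_line_inter (hF : F.IsHomogeneous d) (hd : 2 ≤ d) (hs : IsSmoothForm F)
    (hA : A.det ≠ 0) {w : Fin 3 → ℂ} (hw : w ≠ 0) :
    {s | ∃ t, affEq F A (s, t) = 0 ∧ w ⬝ᵥ affineVec A s t = 0}.Finite := by
  set e := vertex A with he
  set f := A⁻¹ *ᵥ ![0, 1, 0] with hf
  set o := affineVec A 0 0 with ho
  have hvec : ∀ s t : ℂ, affineVec A s t = o + s • f + t • e := fun s t => by
    have := affineVec_add A 0 0 s t
    rwa [zero_add, zero_add, mulVec_inv_eq, ← add_assoc] at this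
  have hspan : ∀ g : Fin 3 → ℂ, g ⬝ᵥ o = 0 → g ⬝ᵥ f = 0 → g ⬝ᵥ e = 0 → g = 0 :=
    fun g h1 h2 h3 => eq_zero_of_dot_eq_zero hA h1 fun a b => by
      rw [mulVec_inv_eq, dotProduct_add, dotProduct_smul, dotProduct_smul, h2, h3, smul_zero,
        smul_zero, add_zero]
  by_cases hwe : w ⬝ᵥ e = 0
  · by_cases hwf : w ⬝ᵥ f = 0
    · refine Set.finite_empty.subset ?_
      rintro s ⟨t, -, ht⟩
      rw [hvec, dotProduct_add, dotProduct_add, dotProduct_smul, dotProduct_smul, hwe, hwf,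
        smul_zero, smul_zero, add_zero, add_zero] at ht
      exact hw (hspan w ht hwf hwe)
    · refine (Set.finite_singleton (-(w ⬝ᵥ o) / (w ⬝ᵥ f))).subset ?_
      rintro s ⟨t, -, ht⟩
      rw [hvec, dotProduct_add, dotProduct_add, dotProduct_smul, dotProduct_smul, hwe, smul_zero,
        add_zero, smul_eq_mul] at ht
      rw [Set.mem_singleton_iff, eq_div_iff hwf]
      linear_combination ht
  · set f₁ := o - (w ⬝ᵥ o / w ⬝ᵥ e) • e with hf₁
    set f₂ := f - (w ⬝ᵥ f / w ⬝ᵥ e) • e with hf₂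
    have hne : ∀ t : ℂ, f₁ + t • f₂ = affineVec A t (-(w ⬝ᵥ o / w ⬝ᵥ e) - t * (w ⬝ᵥ f / w ⬝ᵥ e)) :=
      fun t => by
        rw [hvec, hf₁, hf₂]
        module
    have hf2 : f₂ ≠ 0 := by
      intro h
      have h1 : A 1 ⬝ᵥ f₂ = 1 := by
        have h2 : ∀ i, A i ⬝ᵥ f = ![0, 1, 0] i := fun i =>
          congrFun (ProjectivePlane.mul_inv_mulVec hA ![0, 1, 0]) i
        have h3 : ∀ i, A i ⬝ᵥ e = ![0, 0, 1] i := fun i =>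
          congrFun (ProjectivePlane.mul_inv_mulVec hA ![0, 0, 1]) i
        rw [hf₂, dotProduct_sub, dotProduct_smul, h2, h3]
        simp
      rw [h, dotProduct_zero] at h1
      exact zero_ne_one h1
    have h0 : linePoly F f₁ f₂ ≠ 0 := by
      refine linePoly_ne_zero_of_smooth hF hd hs (e := e) (fun g h1 h2 h3 => ?_)
        (fun t => ?_) hf2
      · rw [hf₁, dotProduct_sub, dotProduct_smul, h3, smul_zero, sub_zero] at h1
        rw [hf₂, dotProduct_sub, dotProduct_smul, h3, smul_zero, sub_zero] at h2
        exact hspan g h1 h2 h3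
      · rw [hne]
        exact affineVec_ne_zero hA _ _
    classical
    refine ((linePoly F f₁ f₂).roots.toFinset.finite_toSet).subset ?_
    rintro s ⟨t, ht, ht'⟩
    rw [Finset.mem_coe, Multiset.mem_toFinset, Polynomial.mem_roots h0, Polynomial.IsRoot,
      eval_linePoly, hne]
    have h1 : -(w ⬝ᵥ o / w ⬝ᵥ e) - s * (w ⬝ᵥ f / w ⬝ᵥ e) = t := by
      rw [hvec, dotProduct_add, dotProduct_add, dotProduct_smul, dotProduct_smul,
        smul_eq_mul, smul_eq_mul] at ht'
      field_simp
      linear_combination -ht'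
    rw [h1]
    exact ht

/-! ### The fibres near infinity -/

/-- The forms of `A` with the first two exchanged. -/
def swapForms (A : Matrix (Fin 3) (Fin 3) ℂ) : Matrix (Fin 3) (Fin 3) ℂ :=
  A.submatrix (Equiv.swap 0 1) id

theorem det_swapForms (hA : A.det ≠ 0) : (swapForms A).det ≠ 0 := by
  rw [swapForms, Matrix.det_permute]
  simpa using hA

theorem eq_of_forms_eq (hA : A.det ≠ 0) {v w : Fin 3 → ℂ} (h : ∀ i, A i ⬝ᵥ v = A i ⬝ᵥ w) :
    v = w := by
  rw [← ProjectivePlane.inv_mul_mulVec hA v, ← ProjectivePlane.inv_mul_mulVec hA w]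
  congr 1
  exact funext h

theorem dot_vertex (hA : A.det ≠ 0) (i : Fin 3) : A i ⬝ᵥ vertex A = ![0, 0, 1] i :=
  congrFun (ProjectivePlane.mul_inv_mulVec hA ![0, 0, 1]) i

theorem vertex_swapForms (hA : A.det ≠ 0) : vertex (swapForms A) = vertex A := by
  refine eq_of_forms_eq (det_swapForms hA) fun i => ?_
  rw [dot_vertex (det_swapForms hA)]
  fin_cases i
  · exact (dot_vertex hA 1).symm
  · exact (dot_vertex hA 0).symm
  · exact (dot_vertex hA 2).symm

/-- The change of coordinates `(s, t) ↦ (1 / s, t / s)`, with the homogeneity factor it costs. The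
vertex of the projection is the same for both systems, so the fibre at infinity becomes the fibre
over zero. -/
theorem affineVec_eq_smul_swapForms (hA : A.det ≠ 0) {s : ℂ} (hs : s ≠ 0) (t : ℂ) :
    affineVec A s t = s • affineVec (swapForms A) s⁻¹ (s⁻¹ * t) := by
  refine eq_of_forms_eq (det_swapForms hA) fun i => ?_
  rw [dotProduct_smul, dot_affineVec (det_swapForms hA)]
  fin_cases i
  · change A 1 ⬝ᵥ affineVec A s t = _
    rw [dot_affineVec hA]
    simp
  · change A 0 ⬝ᵥ affineVec A s t = _
    rw [dot_affineVec hA]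
    simp [hs]
  · change A 2 ⬝ᵥ affineVec A s t = _
    rw [dot_affineVec hA]
    simp [hs]

/-- Each of the `d` points of the fibre contributes a factor `s ^ (d - 2)`, because `u` is
homogeneous of degree `2 - d`. This exponent is the degree of the line bundle in the count of poles.
-/
theorem fibreNorm_swapForms (hF : F.IsHomogeneous d) (hA : A.det ≠ 0)
    (hV : eval (vertex A) F ≠ 0) (hu : IsPolarField F d m u) (p : Fin 3 → ℂ) {s : ℂ} (hs : s ≠ 0)
    (hn : (fibre F A s).Nodup) :
    fibreNorm F (swapForms A) u p s⁻¹ = s ^ (d * (d - 2)) * fibreNorm F A u p s := by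
  have hV' : eval (vertex (swapForms A)) F ≠ 0 := by rwa [vertex_swapForms hA]
  have h0 : ∀ t ∈ fibre F A s, affineVec (swapForms A) s⁻¹ (s⁻¹ * t) ∈ cone F := fun t ht => by
    rw [affineVec_mem_cone (det_swapForms hA)]
    rw [mem_fibre hF hV, affEq, affineVec_eq_smul_swapForms hA hs,
      eval_smul_of_isHomogeneous hF] at ht
    exact (mul_eq_zero.1 ht).resolve_left (pow_ne_zero _ hs)
  -- Distinct points stay distinct under the dilation and both fibres have `d` points, so inclusion
  -- gives equality of multisets.
  have h1 : (fibre F A s).map (s⁻¹ * ·) = fibre F (swapForms A) s⁻¹ := by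
    refine Multiset.eq_of_le_of_card_le ?_ ?_
    · rw [Multiset.le_iff_subset (hn.map fun a b h => mul_left_cancel₀ (inv_ne_zero hs) h)]
      intro r hr
      obtain ⟨t, ht, rfl⟩ := Multiset.mem_map.1 hr
      rw [mem_fibre hF hV', ← affineVec_mem_cone (det_swapForms hA)]
      exact h0 t ht
    · rw [Multiset.card_map, card_fibre hF hV, card_fibre hF hV']
  have h2 : s ^ (d * (d - 2)) = ((fibre F A s).map fun _ => s ^ (d - 2)).prod := by
    rw [Multiset.map_const', Multiset.prod_replicate, card_fibre hF hV, ← pow_mul, mul_comm]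
  rw [fibreNorm, fibreNorm, ← h1, Multiset.map_map, h2, ← Multiset.prod_map_mul]
  refine congrArg _ (Multiset.map_congr rfl fun t ht => ?_)
  rw [Function.comp_apply, affineVec_eq_smul_swapForms hA hs, ← hu.smul _ (h0 t ht) s hs,
    dotProduct_smul, smul_eq_mul]

end

end

section

open MvPolynomial (eval)
open ProjectivePlane

section

variable {F : MvPolynomial (Fin 3) ℂ} {d : ℕ} {A : Matrix (Fin 3) (Fin 3) ℂ}
  {m : ProjectivePlane → ℕ} {u : (Fin 3 → ℂ) → Fin 3 → ℂ}

/-! ### Coordinates in general position -/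

/-- The zero polynomial is not smooth in this sense, since its gradient vanishes everywhere. -/
theorem exists_eval_ne_zero (hs : IsSmoothForm F) : ∃ o, o ≠ 0 ∧ eval o F ≠ 0 := by
  by_contra! h
  have h0 : (fun _ => 1 : Fin 3 → ℂ) ≠ 0 := fun h => one_ne_zero (congrFun h 0)
  have hF : F = 0 := by
    have hX : MvPolynomial.X (R := ℂ) (0 : Fin 3) ≠ 0 := MvPolynomial.X_ne_zero _
    -- The contradiction hypothesis says nothing at the origin; the factor `X 0` removes that point.
    have : F * MvPolynomial.X 0 = 0 := MvPolynomial.funext fun v => by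
      by_cases hv : v = 0
      · simp [hv]
      · simp [h v hv]
    exact (mul_eq_zero.1 this).resolve_right hX
  refine hs _ h0 (h _ h0) ?_
  ext i
  simp [gradient, hF]

/-- Project from a point `o` off the curve, and choose the line at infinity in the pencil of lines
through `o`. Each point of `D` differs from `o`, hence lies on a single line of the pencil, so all
but finitely many members avoid `D`. The line at infinity must pass through `o` because the first
form vanishes at the vertex. -/
theorem exists_forms_general (hF : F.IsHomogeneous d) (hs : IsSmoothForm F)
    (D : Finset ProjectivePlane) (hD : ∀ q ∈ D, eval q.rep F = 0) :
    ∃ A : Matrix (Fin 3) (Fin 3) ℂ, A.det ≠ 0 ∧ eval (vertex A) F ≠ 0 ∧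
      ∀ q ∈ D, A 0 ⬝ᵥ q.rep ≠ 0 := by
  obtain ⟨o, ho, hoF⟩ := exists_eval_ne_zero hs
  obtain ⟨w, hw, how⟩ : ∃ w : Fin 3 → ℂ, w ≠ 0 ∧ o ⬝ᵥ w = 0 := by
    by_cases h : o 0 = 0 ∧ o 1 = 0
    · refine ⟨![1, 0, 0], fun h' => one_ne_zero (congrFun h' 0), ?_⟩
      simp [dotProduct, Fin.sum_univ_three, h.1]
    · refine ⟨![o 1, -o 0, 0], fun h' => h ⟨?_, congrFun h' 0⟩, ?_⟩
      · simpa using congrFun h' 1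
      · simp [dotProduct, Fin.sum_univ_three]
        ring
  obtain ⟨B, hB, hB0, hB1, hB2⟩ := BlowUp.exists_forms ho hw how
  have hB2' : B 2 ⬝ᵥ o = 0 := by rw [hB2, dotProduct_comm, how]
  have hne : ∀ q ∈ D, B 1 ⬝ᵥ q.rep ≠ 0 ∨ B 2 ⬝ᵥ q.rep ≠ 0 := by
    intro q hq
    by_contra! h
    have h1 : q.rep = (B 0 ⬝ᵥ q.rep / B 0 ⬝ᵥ o) • o := by
      refine eq_of_forms_eq hB fun i => ?_
      rw [dotProduct_smul, smul_eq_mul]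
      fin_cases i
      · exact (div_mul_cancel₀ _ hB0).symm
      · change B 1 ⬝ᵥ _ = _ * B 1 ⬝ᵥ _
        rw [h.1, hB1, mul_zero]
      · change B 2 ⬝ᵥ _ = _ * B 2 ⬝ᵥ _
        rw [h.2, hB2', mul_zero]
    have h2 := hD q hq
    rw [h1, eval_smul_of_isHomogeneous hF] at h2
    have h3 : B 0 ⬝ᵥ q.rep / B 0 ⬝ᵥ o ≠ 0 := fun h4 => by
      rw [h4, zero_smul] at h1
      exact q.rep_nonzero h1
    exact (mul_ne_zero (pow_ne_zero _ h3) hoF) h2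
  -- The lines `B 1 + t • B 2` pass through `o`; each point of `D` excludes at most one value of
  -- `t`.
  have hfin : ∀ᶠ t : ℂ in 𝓝[≠] 0, ∀ q ∈ D, (B 1 + t • B 2) ⬝ᵥ q.rep ≠ 0 := by
    refine (Finset.eventually_all D).2 fun q hq => ?_
    have h1 : {t : ℂ | (B 1 + t • B 2) ⬝ᵥ q.rep = 0}.Finite := by
      by_cases h2 : B 2 ⬝ᵥ q.rep = 0
      · refine Set.finite_empty.subset fun t ht => ?_
        rw [Set.mem_ofPred_eq, add_dotProduct, smul_dotProduct, h2, smul_zero, add_zero] at ht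
        exact (hne q hq).elim (fun h => h ht) fun h => h h2
      · refine (Set.finite_singleton (-(B 1 ⬝ᵥ q.rep) / (B 2 ⬝ᵥ q.rep))).subset fun t ht => ?_
        rw [Set.mem_ofPred_eq, add_dotProduct, smul_dotProduct, smul_eq_mul] at ht
        rw [Set.mem_singleton_iff, eq_div_iff h2]
        linear_combination ht
    exact eventually_notMem_of_finite h1 0
  obtain ⟨t, ht⟩ := hfin.exists
  -- The only form not vanishing at `o` is put last, so that the vertex is proportional to `o`. The
  -- cyclic order of the rows and the added multiple leave the determinant unchanged.
  obtain ⟨A, hA0, hA1, hA2⟩ : ∃ A : Matrix (Fin 3) (Fin 3) ℂ,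
      A 0 = B 1 + t • B 2 ∧ A 1 = B 2 ∧ A 2 = B 0 :=
    ⟨Matrix.of ![B 1 + t • B 2, B 2, B 0], rfl, rfl, rfl⟩
  have hA : A.det ≠ 0 := by
    have hA0' : ∀ j, A 0 j = B 1 j + t * B 2 j := fun j => congrFun hA0 j
    have hdet : A.det = B.det := by
      rw [Matrix.det_fin_three, Matrix.det_fin_three]
      simp only [hA0', hA1, hA2]
      ring
    rwa [hdet]
  refine ⟨A, hA, ?_, fun q hq => by rw [hA0]; exact ht q hq⟩
  have hv : vertex A = (B 0 ⬝ᵥ o)⁻¹ • o := by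
    refine eq_of_forms_eq hA fun i => ?_
    rw [dot_vertex hA, dotProduct_smul]
    fin_cases i
    · change (0 : ℂ) = _ • (A 0 ⬝ᵥ o)
      rw [hA0, add_dotProduct, smul_dotProduct, hB1, hB2']
      simp
    · change (0 : ℂ) = _ • (A 1 ⬝ᵥ o)
      rw [hA1, hB2', smul_zero]
    · change (1 : ℂ) = _ • (A 2 ⬝ᵥ o)
      rw [hA2]
      exact (inv_mul_cancel₀ hB0).symm
  rw [hv, eval_smul_of_isHomogeneous hF]
  exact mul_ne_zero (pow_ne_zero _ (inv_ne_zero hB0)) hoF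

/-! ### The number of poles -/

/-- The polynomial vanishing at the first coordinates of the poles. -/
def poleFactor (A : Matrix (Fin 3) (Fin 3) ℂ) (D : Finset ProjectivePlane)
    (m : ProjectivePlane → ℕ) (s : ℂ) : ℂ := ∏ q ∈ D, (s - ratio (A 1) (A 0) q) ^ m q

theorem differentiable_poleFactor (A : Matrix (Fin 3) (Fin 3) ℂ) (D : Finset ProjectivePlane)
    (m : ProjectivePlane → ℕ) : Differentiable ℂ (poleFactor A D m) := fun _ =>
  DifferentiableAt.fun_finsetProd fun _ _ => (differentiableAt_id.sub_const _).pow _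

/-- Different values of `t` over the same `s` are different points of the plane, and only points of
`D` with first coordinate `s` contribute. -/
theorem sum_affOrder_le (hA : A.det ≠ 0) {D : Finset ProjectivePlane} (hm : ∀ q ∉ D, m q = 0)
    (Y : Finset ℂ) (s : ℂ) : ∑ t ∈ Y, affOrder m A hA s t ≤
      ∑ q ∈ D with ratio (A 1) (A 0) q = s, m q := by
  classical
  set f : ℂ → ProjectivePlane := fun t =>
    Projectivization.mk ℂ (affineVec A s t) (affineVec_ne_zero hA s t)
  have hr : ∀ t, ratio (A 1) (A 0) (f t) = s ∧ ratio (A 2) (A 0) (f t) = t := fun t => by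
    simp only [f, ProjectivePlane.ratio_mk, dot_affineVec hA]
    simp
  have hf : Set.InjOn f Y := fun a _ b _ h => by rw [← (hr a).2, h, (hr b).2]
  have h1 : ∑ t ∈ Y, affOrder m A hA s t = ∑ q ∈ Y.image f, m q :=
    (Finset.sum_image hf).symm
  rw [h1]
  refine Finset.sum_le_sum_of_ne_zero fun q hq hq' => ?_
  obtain ⟨t, -, rfl⟩ := Finset.mem_image.1 hq
  exact Finset.mem_filter.2 ⟨not_not.1 fun h => hq' (hm _ h), (hr t).1⟩

theorem exists_poleFactor_le {D : Finset ProjectivePlane} (s₀ : ℂ) :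
    ∃ K : ℝ, 0 ≤ K ∧ ∀ᶠ s in 𝓝 s₀, ‖poleFactor A D m s‖ ≤
      K * ‖s - s₀‖ ^ ∑ q ∈ D with ratio (A 1) (A 0) q = s₀, m q := by
  classical
  have hc : ContinuousAt (fun s => ∏ q ∈ D with ¬ ratio (A 1) (A 0) q = s₀,
      (s - ratio (A 1) (A 0) q) ^ m q) s₀ :=
    (DifferentiableAt.fun_finsetProd (𝕜 := ℂ) fun q _ =>
      (differentiableAt_id.sub_const (ratio (A 1) (A 0) q)).pow (m q)).continuousAt
  obtain ⟨K, hK⟩ := eventually_norm_le_of_continuousAt hc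
  refine ⟨|K|, abs_nonneg K, ?_⟩
  filter_upwards [hK] with s hs
  rw [poleFactor, ← Finset.prod_filter_mul_prod_filter_not D (fun q => ratio (A 1) (A 0) q = s₀),
    norm_mul, mul_comm]
  refine mul_le_mul (hs.trans (le_abs_self K)) (le_of_eq ?_) (norm_nonneg _) (abs_nonneg _)
  rw [← Finset.prod_pow_eq_pow_sum, norm_prod]
  refine Finset.prod_congr rfl fun q hq => ?_
  rw [norm_pow, (Finset.mem_filter.1 hq).2]

theorem poleFactor_growth {D : Finset ProjectivePlane} :
    ∃ K : ℝ, 0 ≤ K ∧ ∀ s : ℂ, 1 ≤ ‖s‖ → ‖poleFactor A D m s‖ ≤ K * ‖s‖ ^ ∑ q ∈ D, m q := by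
  refine ⟨∏ q ∈ D, (1 + ‖ratio (A 1) (A 0) q‖) ^ m q,
    Finset.prod_nonneg fun q _ => by positivity, fun s hs => ?_⟩
  rw [poleFactor, norm_prod, ← Finset.prod_pow_eq_pow_sum, ← Finset.prod_mul_distrib]
  refine Finset.prod_le_prod (fun _ _ => norm_nonneg _) fun q _ => ?_
  rw [norm_pow, ← mul_pow]
  refine pow_le_pow_left₀ (norm_nonneg _) ((norm_sub_le _ _).trans ?_) _
  nlinarith [norm_nonneg (ratio (A 1) (A 0) q)]

/-- Up to the factor `s - s₀` at the poles, the norm of a field with few poles is constant. -/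
theorem IsPolarField.fibreNorm_const (hF : F.IsHomogeneous d) (hs : IsSmoothForm F)
    (hA : A.det ≠ 0) (hV : eval (vertex A) F ≠ 0) (hu : IsPolarField F d m u)
    {D : Finset ProjectivePlane} (hm : ∀ q ∉ D, m q = 0) (hsum : ∑ q ∈ D, m q ≤ d * (d - 2))
    (hD : ∀ q ∈ D, A 0 ⬝ᵥ q.rep ≠ 0) (p : Fin 3 → ℂ) :
    ∃ c, ∀ s, IsRegularFibre F A hA m s → fibreNorm F A u p s * poleFactor A D m s = c := by
  classical
  refine exists_eq_const_of_removable (eventually_isRegularFibre hF hs hA hV hm)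
    (fun s h => (h.differentiableAt hF hV hu p).mul (differentiable_poleFactor A D m s)) ?_ ?_
  · intro s₀
    obtain ⟨K, hK⟩ := hu.exists_fibreNorm_le hF hs hA hV p s₀
    obtain ⟨K', hK'0, hK'⟩ := exists_poleFactor_le (A := A) (D := D) (m := m) s₀
    refine ⟨K' * K, nhdsWithin_le_nhds ?_⟩
    filter_upwards [hK, hK', Metric.closedBall_mem_nhds s₀ one_pos] with s h1 h2 h3
    rw [mem_closedBall_iff_norm] at h3
    rw [norm_mul]
    calc ‖fibreNorm F A u p s‖ * ‖poleFactor A D m s‖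
        ≤ ‖fibreNorm F A u p s‖ *
          (K' * ‖s - s₀‖ ^ ∑ q ∈ D with ratio (A 1) (A 0) q = s₀, m q) := by gcongr
      _ ≤ ‖fibreNorm F A u p s‖ *
          -- The pole factor vanishes at least to the order of the pole of the norm; as `‖s - s₀‖ ≤
          -- 1`, a larger exponent gives a smaller power.
          (K' * ‖s - s₀‖ ^ ∑ t ∈ (fibre F A s₀).toFinset, affOrder m A hA s₀ t) := by
        gcongr 2
        exact pow_le_pow_of_le_one (norm_nonneg _) h3 (sum_affOrder_le hA hm _ _)
      _ = K' * (‖s - s₀‖ ^ (∑ t ∈ (fibre F A s₀).toFinset, affOrder m A hA s₀ t) *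
          ‖fibreNorm F A u p s‖) := by ring
      _ ≤ K' * K := by gcongr
  · have hV' : eval (vertex (swapForms A)) F ≠ 0 := by rwa [vertex_swapForms hA]
    obtain ⟨K, hK⟩ := hu.exists_fibreNorm_le hF hs (det_swapForms hA) hV' p 0
    -- The fibre over `0` in the swapped coordinates lies on the line at infinity `A 0 = 0`, which
    -- contains no point of `D`. So the norm is bounded near that fibre.
    have h0 : ∑ t ∈ (fibre F (swapForms A) 0).toFinset, affOrder m (swapForms A)
        (det_swapForms hA) 0 t = 0 := by
      refine Finset.sum_eq_zero fun t _ => hm _ fun h => ?_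
      refine (ProjectivePlane.dot_rep_mk _ _ _).1 (hD _ h) ?_
      exact dot_affineVec (det_swapForms hA) 0 t 1
    simp only [h0, pow_zero, one_mul] at hK
    obtain ⟨ε, hε, hK⟩ := Metric.eventually_nhds_iff.1 hK
    obtain ⟨K', hK'0, hK'⟩ := poleFactor_growth (A := A) (D := D) (m := m)
    -- The radius ensures both `‖s‖ ≥ 1`, for the growth of the pole factor, and `‖s⁻¹‖ < ε`, for
    -- the bound near the fibre at infinity.
    refine ⟨max 1 (ε⁻¹ + 1), K * K', fun s hreg hR => ?_⟩
    have hs1 : 1 ≤ ‖s‖ := (le_max_left _ _).trans hR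
    have hs2 : ε⁻¹ < ‖s‖ := (lt_add_one _).trans_le ((le_max_right _ _).trans hR)
    have hs0 : s ≠ 0 := norm_pos_iff.1 (one_pos.trans_le hs1)
    have h1 := hK (y := s⁻¹) (by
      rw [dist_zero_right, norm_inv]
      exact inv_lt_of_inv_lt₀ hε hs2)
    rw [fibreNorm_swapForms hF hA hV hu p hs0 (hreg.nodup hF hV), norm_mul, norm_pow] at h1
    rw [norm_mul]
    calc ‖fibreNorm F A u p s‖ * ‖poleFactor A D m s‖
        ≤ ‖fibreNorm F A u p s‖ * (K' * ‖s‖ ^ ∑ q ∈ D, m q) := by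
          gcongr
          exact hK' s hs1
      _ ≤ ‖fibreNorm F A u p s‖ * (K' * ‖s‖ ^ (d * (d - 2))) := by
          gcongr
      _ = (‖s‖ ^ (d * (d - 2)) * ‖fibreNorm F A u p s‖) * K' := by ring
      _ ≤ K * K' := by gcongr

/-- A field on a smooth curve of degree `d ≥ 2` has more than `d (d - 2)` poles. -/
theorem IsPolarField.lt_sum (hF : F.IsHomogeneous d) (hd : 2 ≤ d) (hs : IsSmoothForm F)
    (hu : IsPolarField F d m u) {D : Finset ProjectivePlane} (hm : ∀ q ∉ D, m q = 0)
    (hDF : ∀ q ∈ D, eval q.rep F = 0) : d * (d - 2) < ∑ q ∈ D, m q := by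
  by_contra! hsum
  obtain ⟨A, hA, hV, hD⟩ := exists_forms_general hF hs D hDF
  have hreg : ∀ᶠ s in 𝓝[≠] (0 : ℂ), IsRegularFibre F A hA m s ∧ poleFactor A D m s ≠ 0 := by
    refine (eventually_isRegularFibre hF hs hA hV hm 0).and ?_
    filter_upwards [eventually_notMem_of_finite
      (D.finite_toSet.image (ratio (A 1) (A 0))) 0] with s hs
    exact Finset.prod_ne_zero_iff.2 fun q hq =>
      pow_ne_zero _ (sub_ne_zero.2 fun h => hs ⟨q, hq, h.symm⟩)
  obtain ⟨s₁, h1, h1'⟩ := hreg.exists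
  -- The lines with coefficients `u` at the points over `s₁` meet the curve over finitely many
  -- values of `s`. Choosing `s₂` outside them puts no point over `s₂` on any of these lines.
  have h2 : ∀ᶠ s in 𝓝[≠] (0 : ℂ), ∀ r ∈ (fibre F A s₁).toFinset,
      s ∉ {s | ∃ t, affEq F A (s, t) = 0 ∧ u (affineVec A s₁ r) ⬝ᵥ affineVec A s t = 0} := by
    refine (Finset.eventually_all _).2 fun r hr => eventually_notMem_of_finite ?_ 0
    rw [Multiset.mem_toFinset, mem_fibre hF hV] at hr
    exact finite_line_inter hF hd hs hA
      (hu.analytic _ ((affineVec_mem_cone hA).2 hr) (h1 r hr).2).1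
  obtain ⟨s₂, ⟨h3, -⟩, h4⟩ := (hreg.and h2).exists
  obtain ⟨t₂, ht₂⟩ := Multiset.card_pos_iff_exists_mem.1
    (show 0 < (fibre F A s₂).card by rw [card_fibre hF hV]; omega)
  have ht₂' := (mem_fibre hF hV).1 ht₂
  -- With `p` the point `(s₂, t₂)` of the curve, the norm vanishes over `s₂` because `u` is
  -- orthogonal to its base point, but not over `s₁` by the choice of `s₂`. It cannot be constant
  -- after multiplication by the pole factor, which is nonzero at `s₁`.
  obtain ⟨c, hc⟩ := hu.fibreNorm_const hF hs hA hV hm hsum hD (affineVec A s₂ t₂)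
  have h5 : fibreNorm F A u (affineVec A s₂ t₂) s₂ = 0 :=
    Multiset.prod_eq_zero (Multiset.mem_map.2
      ⟨t₂, ht₂, hu.dot_self _ ((affineVec_mem_cone hA).2 ht₂')⟩)
  have h6 : fibreNorm F A u (affineVec A s₂ t₂) s₁ ≠ 0 := by
    refine Multiset.prod_ne_zero fun h => ?_
    obtain ⟨r, hr, hr'⟩ := Multiset.mem_map.1 h
    rw [dotProduct_comm] at hr'
    exact h4 r (Multiset.mem_toFinset.2 hr) ⟨t₂, ht₂', hr'⟩
  have h7 := hc s₂ h3
  rw [h5, zero_mul] at h7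
  exact mul_ne_zero h6 h1' ((hc s₁ h1).trans h7.symm)

end

end

section

/-! ### Charts of surfaces -/

theorem SurfaceAtlas.exists_openPartialHomeomorph {M : Type*} (a : SurfaceAtlas M)
    {e : PartialEquiv M (ℂ × ℂ)} (he : e ∈ a.charts) :
    letI := a.core.toTopologicalSpace
    letI := a.core.toChartedSpace
    ∃ φ : OpenPartialHomeomorph M (ℂ × ℂ),
      φ ∈ IsManifold.maximalAtlas 𝓘(ℂ, ℂ × ℂ) ω M ∧ φ.toPartialEquiv = e := by
  let := a.core.toTopologicalSpace
  let := a.core.toChartedSpace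
  have := a.isManifold
  exact ⟨a.core.openPartialHomeomorph e he,
    IsManifold.subset_maximalAtlas (Set.mem_iUnion₂.2 ⟨e, he, rfl⟩), rfl⟩

section Surface

variable {S : Type*} [TopologicalSpace S] [ChartedSpace (ℂ × ℂ) S]

theorem chartDeriv_bijective {φ : OpenPartialHomeomorph S (ℂ × ℂ)}
    (hφ : φ ∈ IsManifold.maximalAtlas 𝓘(ℂ, ℂ × ℂ) ω S) {p : S} (hp : p ∈ φ.source) :
    Function.Bijective (chartDeriv φ p) := by
  have hd : φ.MDifferentiable 𝓘(ℂ, ℂ × ℂ) 𝓘(ℂ, ℂ × ℂ) :=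
    ⟨(contMDiffOn_of_mem_maximalAtlas hφ).mdifferentiableOn (by simp),
      (contMDiffOn_symm_of_mem_maximalAtlas hφ).mdifferentiableOn (by simp)⟩
  exact hd.mfderiv_bijective hp

theorem exists_chart_comp [IsManifold 𝓘(ℂ, ℂ × ℂ) ω S] {N : Type*} [TopologicalSpace N] [ChartedSpace (ℂ × ℂ) N]
    (Φ : PartialDiffeomorph 𝓘(ℂ, ℂ × ℂ) 𝓘(ℂ, ℂ × ℂ) S N ω) {ε : OpenPartialHomeomorph N (ℂ × ℂ)}
    (hε : ε ∈ IsManifold.maximalAtlas 𝓘(ℂ, ℂ × ℂ) ω N) :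
    ∃ χ ∈ IsManifold.maximalAtlas 𝓘(ℂ, ℂ × ℂ) ω S,
      χ.source = Φ.source ∩ Φ ⁻¹' ε.source ∧ ∀ q, χ q = ε (Φ q) := by
  refine ⟨Φ.toOpenPartialHomeomorph.trans ε, ?_, rfl, fun q => rfl⟩
  refine OpenPartialHomeomorph.mem_maximalAtlas_of_contMDiffOn _ ?_ ?_
  · exact (contMDiffOn_of_mem_maximalAtlas hε).comp
      (Φ.contMDiffOn_toFun.mono Set.inter_subset_left) fun q hq => hq.2
  · exact Φ.contMDiffOn_invFun.comp
      ((contMDiffOn_symm_of_mem_maximalAtlas hε).mono Set.inter_subset_left) fun q hq => hq.2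

/-! ### The vertical line field of a linearization -/

/-- `χ` is the pull back by `Φ` of a chart of the normal bundle. -/
def IsVerticalChart (C : EmbeddedCurve S)
    (Φ : PartialDiffeomorph 𝓘(ℂ, ℂ × ℂ) 𝓘(ℂ, ℂ × ℂ) S C.NormalBundle ω)
    (χ : OpenPartialHomeomorph S (ℂ × ℂ)) : Prop :=
  χ ∈ IsManifold.maximalAtlas 𝓘(ℂ, ℂ × ℂ) ω S ∧ ∃ ψ e, C.IsNormalChart ψ e ∧
    χ.source = Φ.source ∩ Φ ⁻¹' e.source ∧ ∀ q, χ q = e (Φ q)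

variable {C : EmbeddedCurve S}
  {Φ : PartialDiffeomorph 𝓘(ℂ, ℂ × ℂ) 𝓘(ℂ, ℂ × ℂ) S C.NormalBundle ω}
  {χ χ' : OpenPartialHomeomorph S (ℂ × ℂ)}

theorem exists_isVerticalChart [IsManifold 𝓘(ℂ, ℂ × ℂ) ω S] {q : S} (hq : q ∈ Φ.source) :
    ∃ χ, IsVerticalChart C Φ χ ∧ q ∈ χ.source := by
  obtain ⟨e, ⟨ψ, he⟩, hqe⟩ := C.normalAtlas.cover (Φ q)
  obtain ⟨ε, hε, rfl⟩ := C.normalAtlas.exists_openPartialHomeomorph (e := e) ⟨ψ, he⟩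
  obtain ⟨χ, h1, h2, h3⟩ := exists_chart_comp Φ hε
  exact ⟨χ, ⟨h1, ψ, _, he, h2, h3⟩, by rw [h2]; exact ⟨hq, hqe⟩⟩

/-- The second coordinate is a linear isomorphism on each fibre of the normal bundle, so it vanishes
exactly on the zero section, which corresponds to the curve under `Φ`. -/
theorem IsVerticalChart.isAdaptedChart (h : IsVerticalChart C Φ χ) (hC : C.carrier ⊆ Φ.source)
    (hΦ : Φ '' C.carrier = C.zeroSection) : IsAdaptedChart C.carrier χ := by
  refine ⟨h.1, fun q hq => ?_⟩
  obtain ⟨-, ψ, e, he, h1, h2⟩ := h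
  rw [h1] at hq
  have h3 : q ∈ C.carrier ↔ Φ q ∈ C.zeroSection := by
    rw [← hΦ]
    refine ⟨fun h => ⟨q, h, rfl⟩, ?_⟩
    rintro ⟨q', hq', h4⟩
    rwa [← Φ.injOn (hC hq') hq.1 h4]
  have h4 : ((Φ q).1 : S) ∈ ψ.source := by
    have := hq.2
    rw [Set.mem_preimage, he.source_eq] at this
    exact this
  rw [h2, he.apply_eq _ hq.2, h3]
  constructor
  · rintro ⟨p, hp⟩
    rw [← hp]
    exact map_zero _
  · intro h5
    refine ⟨(Φ q).1, ?_⟩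
    have h6 : (Φ q).2 = 0 := (C.normalCoord_bijective (Φ q).1.2 he.adapted h4).1 (by
      rw [map_zero]
      exact h5)
    exact Sigma.ext rfl (by rw [h6])

/-- The first coordinate of a normal chart depends only on the base point, so changes of vertical
charts map fibres `x = const` to fibres. Their differentials therefore preserve the vertical
direction, which makes `verticalLine` independent of the chart. -/
theorem IsVerticalChart.fst_chartDeriv (h : IsVerticalChart C Φ χ) (h' : IsVerticalChart C Φ χ')
    {q : S} (hq : q ∈ χ.source) (hq' : q ∈ χ'.source) {v : TangentSpace 𝓘(ℂ, ℂ × ℂ) q}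
    (hv : (chartDeriv χ q v).1 = 0) : (chartDeriv χ' q v).1 = 0 := by
  rw [chartDeriv_transition h.1 h'.1 hq hq']
  have hd := transition_hasFDerivAt h.1 h'.1 (χ.map_source hq) (by rwa [χ.left_inv hq])
  obtain ⟨h0, ψ, e, he, h1, h2⟩ := h
  obtain ⟨h0', ψ', e', he', h1', h2'⟩ := h'
  have ho : IsOpen (χ.target ∩ χ.symm ⁻¹' χ'.source) :=
    χ.isOpen_inter_preimage_symm χ'.open_source
  set z := χ q with hz
  have hmem : (z.1, z.2) ∈ χ.target ∩ χ.symm ⁻¹' χ'.source := by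
    refine ⟨χ.map_source hq, ?_⟩
    change χ.symm z ∈ χ'.source
    rwa [hz, χ.left_inv hq]
  -- The right-hand side does not involve `y.2`; differentiating in the second variable gives zero.
  have h3 : ∀ y ∈ χ.target ∩ χ.symm ⁻¹' χ'.source,
      ((χ' ∘ χ.symm) y).1 = (ψ' (ψ.symm (y.1, 0))).1 := by
    intro y hy
    have h4 : χ.symm y ∈ χ.source := χ.map_target hy.1
    have h5 := χ.right_inv hy.1
    rw [h2] at h5
    rw [h1] at h4
    have h6 := hy.2
    rw [Set.mem_preimage, h1'] at h6
    have h7 : y ∈ e.target := by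
      rw [← h5]
      exact e.map_source h4.2
    have h8 : Φ (χ.symm y) = e.symm y := by
      rw [← h5, e.left_inv h4.2, h5]
    rw [Function.comp_apply, h2', he'.apply_eq _ h6.2, h8]
    exact congrArg (fun p => (ψ' p).1) (he.symm_base h7).2.1
  have hc : Continuous fun t : ℂ => (z.1, t) := by fun_prop
  have h4 : (fun t : ℂ => ((χ' ∘ χ.symm) (z.1, t)).1) =ᶠ[𝓝 z.2]
      fun _ => (ψ' (ψ.symm (z.1, 0))).1 := by
    filter_upwards [(ho.preimage hc).mem_nhds hmem] with t ht
    exact h3 _ ht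
  have h5 : HasDerivAt (fun t : ℂ => (z.1, t)) ((0 : ℂ), (1 : ℂ)) z.2 :=
    (hasDerivAt_const _ _).prodMk (hasDerivAt_id _)
  have h6 := HasFDerivAt.comp_hasDerivAt (f := fun t : ℂ => (z.1, t)) z.2
    (hasFDerivAt_fst.comp z hd) h5
  have h7 := h6.unique ((hasDerivAt_const z.2 _).congr_of_eventuallyEq h4)
  have h8 : chartDeriv χ q v = (chartDeriv χ q v).2 • ((0 : ℂ), (1 : ℂ)) := by
    ext
    · simpa using hv
    · simp
  rw [h8, map_smul]
  exact mul_eq_zero_of_right _ h7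

variable (C Φ) in
/-- The directions of the fibres of the normal bundle, transported by `Φ`. -/
def verticalLine (q : S) : Submodule ℂ (TangentSpace 𝓘(ℂ, ℂ × ℂ) q) :=
  ⨅ χ : {χ : OpenPartialHomeomorph S (ℂ × ℂ) // IsVerticalChart C Φ χ ∧ q ∈ χ.source},
    LinearMap.ker (LinearMap.fst ℂ ℂ ℂ ∘ₗ chartDeriv χ.1 q)

theorem IsVerticalChart.mem_verticalLine (h : IsVerticalChart C Φ χ) {q : S} (hq : q ∈ χ.source)
    (v : TangentSpace 𝓘(ℂ, ℂ × ℂ) q) : v ∈ verticalLine C Φ q ↔ (chartDeriv χ q v).1 = 0 := by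
  rw [verticalLine, Submodule.mem_iInf]
  exact ⟨fun h1 => h1 ⟨χ, h, hq⟩, fun h1 χ' => h.fst_chartDeriv χ'.2.1 hq χ'.2.2 h1⟩

theorem IsVerticalChart.isLocalGenerator (h : IsVerticalChart C Φ χ)
    (hC : C.carrier ⊆ Φ.source) (hΦ : Φ '' C.carrier = C.zeroSection) {p : C}
    (hp : (p : S) ∈ χ.source) :
    IsLocalGenerator C (fun q => verticalLine C Φ q) p χ (fun _ => 0) (fun _ => 1) where
  adapted := h.isAdaptedChart hC hΦ
  mem_source := hp
  analyticAt_fst := analyticAt_const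
  analyticAt_snd := analyticAt_const
  ne_zero h := one_ne_zero (congrArg Prod.snd h)
  span_eq := by
    filter_upwards [(χ.open_source.preimage continuous_subtype_val).mem_nhds hp] with q hq
    ext w
    rw [Submodule.mem_map, Submodule.mem_span_singleton]
    constructor
    · rintro ⟨v, hv, rfl⟩
      refine ⟨(chartDeriv χ q v).2, ?_⟩
      rw [h.mem_verticalLine hq] at hv
      ext
      · simpa using hv.symm
      · simp
    · rintro ⟨c, rfl⟩
      obtain ⟨v, hv⟩ := (chartDeriv_bijective h.1 hq).2 (c • ((0 : ℂ), (1 : ℂ)))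
      refine ⟨v, ?_, hv⟩
      rw [h.mem_verticalLine hq, hv]
      simp

/-- A curve with a linearizable neighbourhood has a transverse line field. -/
theorem EmbeddedCurve.HasLinearizableNhd.exists_isTransverse [IsManifold 𝓘(ℂ, ℂ × ℂ) ω S]
    (h : C.HasLinearizableNhd) :
    ∃ X : LineField C, X.IsTransverse := by
  obtain ⟨Φ, hC, hΦ⟩ := h
  refine ⟨⟨fun q => verticalLine C Φ q, fun p => ?_⟩, fun p => ?_⟩
  · obtain ⟨χ, hχ, hp⟩ := exists_isVerticalChart (hC p.2)
    exact ⟨χ, _, _, hχ.isLocalGenerator hC hΦ hp⟩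
  · obtain ⟨χ, hχ, hp⟩ := exists_isVerticalChart (hC p.2)
    have hb := chartDeriv_bijective hχ.1 hp
    have hT : ∀ v, v ∈ C.tangentLine p ↔ (chartDeriv χ p v).2 = 0 := fun v => by
      rw [C.tangentLine_eq_ker p.2 (hχ.isAdaptedChart hC hΦ) hp]
      rfl
    change IsCompl (verticalLine C Φ p) _
    constructor
    · rw [Submodule.disjoint_def]
      intro v hv hv'
      rw [hχ.mem_verticalLine hp] at hv
      rw [hT] at hv'
      exact hb.1 (by rw [map_zero]; exact Prod.ext hv hv')
    · rw [codisjoint_iff, Submodule.eq_top_iff']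
      intro v
      obtain ⟨a, ha⟩ := hb.2 (0, (chartDeriv χ p v).2)
      obtain ⟨b, hb'⟩ := hb.2 ((chartDeriv χ p v).1, 0)
      refine Submodule.mem_sup.2 ⟨a, ?_, b, ?_, hb.1 ?_⟩
      · rw [hχ.mem_verticalLine hp, ha]
      · rw [hT, hb']
      · rw [map_add, ha, hb']
        ext <;> simp

end Surface

end

section

open MvPolynomial (eval)

/-! ### Normalized homogeneous coordinates -/

/-- The homogeneous coordinates of a point at which the linear form `α` takes the value `1`. -/
def normLift (α : Fin 3 → ℂ) (q : ProjectivePlane) : Fin 3 → ℂ := (α ⬝ᵥ q.rep)⁻¹ • q.rep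

/-- The normalization cancels the scalar by which the chosen representative differs from `v`, so
later computations may use any homogeneous coordinates. -/
theorem normLift_mk (α v : Fin 3 → ℂ) (hv : v ≠ 0) :
    normLift α (Projectivization.mk ℂ v hv) = (α ⬝ᵥ v)⁻¹ • v := by
  obtain ⟨c, hc⟩ := Projectivization.exists_smul_eq_mk_rep ℂ v hv
  have hc0 : (c : ℂ) ≠ 0 := c.ne_zero
  rw [normLift, ← hc, Units.smul_def, dotProduct_smul, smul_smul, smul_eq_mul, mul_inv, mul_right_comm,
    inv_mul_cancel₀ hc0, one_mul]

theorem normLift_eq_normLift {α : Fin 3 → ℂ} (β : Fin 3 → ℂ) {q : ProjectivePlane}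
    (hα : α ⬝ᵥ q.rep ≠ 0) : normLift β q = (β ⬝ᵥ normLift α q)⁻¹ • normLift α q := by
  rw [normLift, normLift, dotProduct_smul, smul_smul, smul_eq_mul, mul_inv, inv_inv, mul_right_comm,
    mul_inv_cancel₀ hα, one_mul]

theorem dot_normLift_ne_zero {α : Fin 3 → ℂ} {q : ProjectivePlane} :
    α ⬝ᵥ normLift α q ≠ 0 ↔ α ⬝ᵥ q.rep ≠ 0 := by
  rw [normLift, dotProduct_smul, smul_eq_mul]
  constructor
  · exact fun h => right_ne_zero_of_mul h
  · exact fun h => mul_ne_zero (inv_ne_zero h) h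

/-! ### The polar of a tangent direction -/

variable {F : MvPolynomial (Fin 3) ℂ} {d : ℕ}

/-- The coordinates of the line through `v` with direction `V`, normalized by the derivative of `F`
in the direction `V`. -/
def polar (F : MvPolynomial (Fin 3) ℂ) (v V : Fin 3 → ℂ) : Fin 3 → ℂ :=
  (gradient F v ⬝ᵥ V)⁻¹ • crossProduct v V

/-- The numerator `v × V` and the denominator `∇F(v) · V` both scale with `V`, and both ignore
multiples of `v`: the first by antisymmetry, the second by Euler's relation on the cone. Hence the
polar depends only on the direction in the plane. -/
theorem polar_smul_add (hF : F.IsHomogeneous d) {v : Fin 3 → ℂ} (hv : eval v F = 0) {c : ℂ}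
    (hc : c ≠ 0) (k : ℂ) (V : Fin 3 → ℂ) : polar F v (c • V + k • v) = polar F v V := by
  have h : gradient F v ⬝ᵥ v = 0 := by rw [gradient_dot_self hF, hv, mul_zero]
  rw [polar, polar, dotProduct_add, dotProduct_smul, dotProduct_smul, h, smul_zero, add_zero,
    map_add, map_smul, map_smul, cross_self, smul_zero, add_zero, smul_smul, smul_eq_mul, mul_inv,
    mul_right_comm, inv_mul_cancel₀ hc, one_mul]

/-- Degree one in the cross product and `d - 1` in the gradient, which leaves the degree `2 - d`
required of a polar field. -/
theorem polar_smul_left (hF : F.IsHomogeneous d) (hd : 2 ≤ d) {c : ℂ} (hc : c ≠ 0)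
    (v V : Fin 3 → ℂ) : c ^ (d - 2) • polar F (c • v) V = polar F v V := by
  have h1 : c ^ (d - 1) = c ^ (d - 2) * c := by
    rw [← pow_succ]
    congr 1
    omega
  have h2 : c ^ (d - 2) ≠ 0 := pow_ne_zero _ hc
  rw [polar, polar, gradient_smul hF, smul_dotProduct, LinearMap.map_smul₂, smul_smul, smul_smul,
    h1, smul_eq_mul]
  congr 1
  rw [mul_inv, mul_inv]
  field_simp

theorem dot_polar (v V : Fin 3 → ℂ) : v ⬝ᵥ polar F v V = 0 := by
  rw [polar, dotProduct_smul, dot_self_cross, smul_zero]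

/-- Expand the triple product of `v × V` with `∇F(v)`: since `v · ∇F(v) = 0`, only the multiple of
`v` by `∇F(v) · V` remains, up to sign. It is nonzero, so `v × V` cannot vanish. -/
theorem polar_ne_zero (hF : F.IsHomogeneous d) {v V : Fin 3 → ℂ} (hv0 : v ≠ 0)
    (hv : eval v F = 0) (hV : gradient F v ⬝ᵥ V ≠ 0) : polar F v V ≠ 0 := by
  have h : v ⬝ᵥ gradient F v = 0 := by rw [dotProduct_comm, gradient_dot_self hF, hv, mul_zero]
  refine smul_ne_zero (inv_ne_zero hV) fun h0 => ?_
  have h1 := cross_cross_eq_smul_sub_smul v V (gradient F v)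
  rw [h0, h, zero_smul, zero_sub, LinearMap.map_zero₂, dotProduct_comm] at h1
  exact smul_ne_zero hV hv0 (neg_eq_zero.1 h1.symm)

/-! ### Line fields along curves mapped to a plane curve -/

section Surface

variable {S : Type*} [TopologicalSpace S] [ChartedSpace (ℂ × ℂ) S] {C : EmbeddedCurve S}

theorem LineField.exists_direction (X : LineField C) (p : C) : ∃ ξ ∈ X.line p, ξ ≠ 0 := by
  obtain ⟨φ, a, b, h⟩ := X.holomorphic p
  have h1 := h.span_eq.self_of_nhds
  have h2 : (a (φ p).1, b (φ p).1) ∈ (X.line p).map (chartDeriv φ p) := by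
    rw [h1]
    exact Submodule.mem_span_singleton_self _
  obtain ⟨ξ, hξ, hξ'⟩ := h2
  refine ⟨ξ, hξ, ?_⟩
  rintro rfl
  rw [map_zero] at hξ'
  exact h.ne_zero hξ'.symm

/-- A nonzero vector of the line of `X` at `p`. -/
def LineField.direction (X : LineField C) (p : C) : TangentSpace 𝓘(ℂ, ℂ × ℂ) (p : S) :=
  (X.exists_direction p).choose

/-- A map `π` from a surface to the plane which maps the curve `C` to the plane curve `F = 0`, with
an inverse `s` of the map between the curves. -/
structure IsPlaneModel (F : MvPolynomial (Fin 3) ℂ) (C : EmbeddedCurve S)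
    (π : S → ProjectivePlane) (s : (Fin 3 → ℂ) → S) : Prop where
  contMDiffAt : ∀ z ∈ C.carrier, ∀ α : Fin 3 → ℂ, α ⬝ᵥ (π z).rep ≠ 0 →
    ContMDiffAt 𝓘(ℂ, ℂ × ℂ) 𝓘(ℂ, Fin 3 → ℂ) ω (fun z => normLift α (π z)) z
  eval_eq_zero : ∀ z ∈ C.carrier, eval (π z).rep F = 0
  mem : ∀ v ∈ cone F, s v ∈ C.carrier
  proj : ∀ v (hv : v ∈ cone F), π (s v) = Projectivization.mk ℂ v hv.1
  smul : ∀ v ∈ cone F, ∀ c : ℂ, c ≠ 0 → s (c • v) = s v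
  tendsto : ∀ v ∈ cone F, Filter.Tendsto s (𝓝[cone F] v) (𝓝 (s v))

open Classical in
/-- The polars of the images of the directions of a line field. -/
def polarField (F : MvPolynomial (Fin 3) ℂ) (X : LineField C) (π : S → ProjectivePlane)
    (s : (Fin 3 → ℂ) → S) (v : Fin 3 → ℂ) : Fin 3 → ℂ :=
  if h : s v ∈ C.carrier then
    polar F v (mfderiv 𝓘(ℂ, ℂ × ℂ) 𝓘(ℂ, Fin 3 → ℂ) (fun z => normLift (star v) (π z)) (s v)
      (X.direction ⟨s v, h⟩))
  else 0

/-- Normalized homogeneous coordinates of the image of a point, in terms of the chart `φ`. -/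
def chartLift (π : S → ProjectivePlane) (φ : OpenPartialHomeomorph S (ℂ × ℂ)) (α : Fin 3 → ℂ)
    (y : ℂ × ℂ) : Fin 3 → ℂ := normLift α (π (φ.symm y))

/-- The derivative of the equation `F` along the local generator `(a, b)` of a line field. -/
def generatorDeriv (F : MvPolynomial (Fin 3) ℂ) (π : S → ProjectivePlane)
    (φ : OpenPartialHomeomorph S (ℂ × ℂ)) (α : Fin 3 → ℂ) (a b : ℂ → ℂ) (t : ℂ) : ℂ :=
  fderiv ℂ (fun y => eval (chartLift π φ α y) F) (t, 0) (a t, b t)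

variable {X : LineField C} {π : S → ProjectivePlane} {s : (Fin 3 → ℂ) → S}
  {φ : OpenPartialHomeomorph S (ℂ × ℂ)} {α : Fin 3 → ℂ} {a b : ℂ → ℂ}

theorem IsPlaneModel.contDiffAt_chartLift (h : IsPlaneModel F C π s)
    (hφ : φ ∈ IsManifold.maximalAtlas 𝓘(ℂ, ℂ × ℂ) ω S) {z : S} (hz : z ∈ φ.source)
    (hzC : z ∈ C.carrier) (hα : α ⬝ᵥ (π z).rep ≠ 0) :
    ContDiffAt ℂ ω (chartLift π φ α) (φ z) := by
  rw [← contMDiffAt_iff_contDiffAt]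
  have h1 := h.contMDiffAt z hzC α hα
  rw [← φ.left_inv hz] at h1
  exact h1.comp (φ z) (contMDiffAt_symm_of_mem_maximalAtlas hφ (φ.map_source hz))

theorem contDiff_dotProduct (β : Fin 3 → ℂ) : ContDiff ℂ ω fun w : Fin 3 → ℂ => β ⬝ᵥ w := by
  simp only [dotProduct, Fin.sum_univ_three]
  fun_prop

/-- Renormalizing homogeneous coordinates changes tangent vectors only by a scalar and a multiple of
the base vector, the two changes that `polar` does not see. -/
theorem exists_fderiv_normalize (β : Fin 3 → ℂ) {w : Fin 3 → ℂ} (hw : β ⬝ᵥ w ≠ 0) :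
    ∃ L : (Fin 3 → ℂ) →L[ℂ] Fin 3 → ℂ,
      HasFDerivAt (fun w : Fin 3 → ℂ => (β ⬝ᵥ w)⁻¹ • w) L w ∧
      ∀ V, ∃ k : ℂ, L V = (β ⬝ᵥ w)⁻¹ • V + k • w := by
  have h1 : DifferentiableAt ℂ (fun w : Fin 3 → ℂ => (β ⬝ᵥ w)⁻¹) w :=
    ((contDiff_dotProduct β).differentiable (by simp) w).inv hw
  exact ⟨_, h1.hasFDerivAt.smul (hasFDerivAt_id w), fun V => ⟨_, rfl⟩⟩

/-- The field is defined with the normalizing form `star v`, because `star v ⬝ᵥ v` is nonzero for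
every nonzero `v`; but this form varies with `v` and not holomorphically. Here it is replaced by a
fixed form `α`, the polar being independent of the normalization, so that holomorphy can be read in
a chart. -/
theorem IsPlaneModel.polar_mfderiv_eq (h : IsPlaneModel F C π s) (hF : F.IsHomogeneous d)
    (hφ : φ ∈ IsManifold.maximalAtlas 𝓘(ℂ, ℂ × ℂ) ω S) {v : Fin 3 → ℂ} (hv : v ∈ cone F)
    (hs : s v ∈ φ.source) (hα : α ⬝ᵥ v ≠ 0) (ξ : TangentSpace 𝓘(ℂ, ℂ × ℂ) (s v)) :
    polar F v (mfderiv 𝓘(ℂ, ℂ × ℂ) 𝓘(ℂ, Fin 3 → ℂ) (fun z => normLift (star v) (π z)) (s v) ξ) =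
      polar F v (fderiv ℂ (chartLift π φ α) (φ (s v)) (chartDeriv φ (s v) ξ)) := by
  have hπ := h.proj v hv
  have hα' : α ⬝ᵥ (π (s v)).rep ≠ 0 := by
    rw [hπ, ProjectivePlane.dot_rep_mk]
    exact hα
  have hv' : star v ⬝ᵥ v ≠ 0 := by
    open scoped ComplexOrder in
    rw [Ne, dotProduct_star_self_eq_zero]
    exact hv.1
  have h1 := h.contDiffAt_chartLift hφ hs (h.mem v hv) hα'
  have h2 := (h1.differentiableAt (by simp)).hasFDerivAt
  have hw : chartLift π φ α (φ (s v)) = (α ⬝ᵥ v)⁻¹ • v := by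
    rw [chartLift, φ.left_inv hs, hπ, normLift_mk]
  have hw' : star v ⬝ᵥ chartLift π φ α (φ (s v)) ≠ 0 := by
    rw [hw, dotProduct_smul]
    exact mul_ne_zero (inv_ne_zero hα) hv'
  obtain ⟨L, hL, hL'⟩ := exists_fderiv_normalize (star v) hw'
  have h3 := (hL.comp (φ (s v)) h2).hasMFDerivAt
  have h4 : MDifferentiableAt 𝓘(ℂ, ℂ × ℂ) 𝓘(ℂ, ℂ × ℂ) φ (s v) :=
    (contMDiffAt_of_mem_maximalAtlas hφ hs).mdifferentiableAt (by simp)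
  have h5 := h3.comp (s v) h4.hasMFDerivAt
  have h6 : (fun z => normLift (star v) (π z)) =ᶠ[𝓝 (s v)]
      ((fun w : Fin 3 → ℂ => (star v ⬝ᵥ w)⁻¹ • w) ∘ chartLift π φ α) ∘ φ := by
    have h7 : ∀ᶠ z in 𝓝 (s v), α ⬝ᵥ normLift α (π z) ≠ 0 := by
      have hc := (h.contMDiffAt _ (h.mem v hv) α hα').continuousAt
      exact ((contDiff_dotProduct α).continuous.continuousAt.comp hc).eventually_ne (dot_normLift_ne_zero.2 hα')
    filter_upwards [h7, φ.open_source.mem_nhds hs] with z hz hz'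
    rw [normLift_eq_normLift (star v) (dot_normLift_ne_zero.1 hz)]
    simp only [Function.comp_apply, chartLift, φ.left_inv hz']
  rw [(h5.congr_of_eventuallyEq h6).mfderiv]
  obtain ⟨k, hk⟩ := hL' (fderiv ℂ (chartLift π φ α) (φ (s v)) (chartDeriv φ (s v) ξ))
  change polar F v (L (fderiv ℂ (chartLift π φ α) (φ (s v)) (chartDeriv φ (s v) ξ))) = _
  rw [hk, hw, smul_smul]
  exact polar_smul_add hF hv.2 (inv_ne_zero (by rwa [← hw])) _ _

/-- The polar field in terms of a local generator. -/
theorem IsPlaneModel.eventually_polarField_eq (h : IsPlaneModel F C π s) (hF : F.IsHomogeneous d)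
    {v : Fin 3 → ℂ} (hv : v ∈ cone F) (hg : IsLocalGenerator C X.line ⟨s v, h.mem v hv⟩ φ a b)
    (hα : α ⬝ᵥ v ≠ 0) :
    ∀ᶠ w in 𝓝[cone F] v, w ∈ cone F ∧ s w ∈ φ.source ∧ φ (s w) = ((φ (s w)).1, 0) ∧
      α ⬝ᵥ w ≠ 0 ∧ w = (α ⬝ᵥ w) • chartLift π φ α ((φ (s w)).1, 0) ∧
      polarField F X π s w = polar F w (fderiv ℂ (chartLift π φ α) ((φ (s w)).1, 0)
        (a (φ (s w)).1, b (φ (s w)).1)) := by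
  have h1 : ∀ᶠ w in 𝓝[cone F] v, s w ∈ φ.source :=
    (h.tendsto v hv).eventually (φ.open_source.mem_nhds hg.mem_source)
  have h2 := hg.span_eq
  rw [nhds_subtype_eq_comap, Filter.eventually_comap] at h2
  have h3 := (h.tendsto v hv).eventually h2
  have h4 : ∀ᶠ w in 𝓝[cone F] v, α ⬝ᵥ w ≠ 0 :=
    nhdsWithin_le_nhds ((contDiff_dotProduct α).continuous.continuousAt.eventually_ne hα)
  filter_upwards [h1, h3, h4, self_mem_nhdsWithin] with w h5 h6 h7 h8
  have hmem := h.mem w h8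
  have h9 : φ (s w) = ((φ (s w)).1, 0) := Prod.ext rfl ((hg.adapted.2 _ h5).1 hmem)
  refine ⟨h8, h5, h9, h7, ?_, ?_⟩
  · rw [← h9, chartLift, φ.left_inv h5, h.proj w h8, normLift_mk, smul_smul, mul_inv_cancel₀ h7,
      one_smul]
  · rw [polarField, dif_pos hmem, h.polar_mfderiv_eq hF hg.adapted.1 h8 h5 h7]
    have h10 := h6 ⟨s w, hmem⟩ rfl
    have hdir := (X.exists_direction ⟨s w, hmem⟩).choose_spec
    have h11 : chartDeriv φ (s w) (X.direction ⟨s w, hmem⟩) ∈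
        (X.line ⟨s w, hmem⟩).map (chartDeriv φ (s w)) := ⟨_, hdir.1, rfl⟩
    rw [h10, Submodule.mem_span_singleton] at h11
    obtain ⟨c, hc⟩ := h11
    -- A nonzero vector of the line is a nonzero multiple of the generator, so the polar may be
    -- computed with the generator.
    have hc0 : c ≠ 0 := by
      rintro rfl
      rw [zero_smul] at hc
      exact hdir.2 ((chartDeriv_bijective hg.adapted.1 h5).1 (by rw [map_zero]; exact hc.symm))
    rw [← hc, ← h9, map_smul]
    have := polar_smul_add hF h8.2 hc0 0
      (fderiv ℂ (chartLift π φ α) (φ (s w)) (a (φ (s w)).1, b (φ (s w)).1))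
    rwa [zero_smul, add_zero] at this

end Surface

end

/-! ### Holomorphy and pole bounds of the polar field. -/

section

open MvPolynomial (eval)
open Filter

theorem ContDiffAt.polar {E : Type*} [NormedAddCommGroup E] [NormedSpace ℂ E]
    {F : MvPolynomial (Fin 3) ℂ} {v V : E → Fin 3 → ℂ} {x : E} (hv : ContDiffAt ℂ ω v x)
    (hV : ContDiffAt ℂ ω V x) (h : gradient F (v x) ⬝ᵥ V x ≠ 0) :
    ContDiffAt ℂ ω (fun x => polar F (v x) (V x)) x := by
  have hv' : ∀ i, ContDiffAt ℂ ω (fun x => v x i) x := contDiffAt_pi.1 hv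
  have hV' : ∀ i, ContDiffAt ℂ ω (fun x => V x i) x := contDiffAt_pi.1 hV
  have hg : ∀ i, ContDiffAt ℂ ω (fun x => gradient F (v x) i) x :=
    contDiffAt_pi.1 ((contDiff_gradient F).contDiffAt.comp x hv)
  have h1 : ContDiffAt ℂ ω (fun x => gradient F (v x) ⬝ᵥ V x) x := by
    simp only [dotProduct]
    exact ContDiffAt.sum fun i _ => (hg i).mul (hV' i)
  refine (h1.inv h).smul (contDiffAt_pi.2 fun i => ?_)
  simp only [cross_apply]
  fin_cases i
  · exact ((hv' 1).mul (hV' 2)).sub ((hv' 2).mul (hV' 1))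
  · exact ((hv' 2).mul (hV' 0)).sub ((hv' 0).mul (hV' 2))
  · exact ((hv' 0).mul (hV' 1)).sub ((hv' 1).mul (hV' 0))

section Surface

variable {S : Type*} [TopologicalSpace S] [ChartedSpace (ℂ × ℂ) S] {C : EmbeddedCurve S}
  {F : MvPolynomial (Fin 3) ℂ} {d : ℕ} {X : LineField C} {π : S → ProjectivePlane}
  {s : (Fin 3 → ℂ) → S} {φ : OpenPartialHomeomorph S (ℂ × ℂ)} {α : Fin 3 → ℂ} {a b : ℂ → ℂ}
  {m : ProjectivePlane → ℕ} {v : Fin 3 → ℂ}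

theorem IsPlaneModel.contDiffAt_chartLift_section (h : IsPlaneModel F C π s) (hv : v ∈ cone F)
    (hφ : IsAdaptedChart C.carrier φ) (hs : s v ∈ φ.source) (hα : α ⬝ᵥ v ≠ 0) :
    ContDiffAt ℂ ω (chartLift π φ α) ((φ (s v)).1, 0) := by
  have h1 : φ (s v) = ((φ (s v)).1, 0) := Prod.ext rfl ((hφ.2 _ hs).1 (h.mem v hv))
  rw [← h1]
  refine h.contDiffAt_chartLift hφ.1 hs (h.mem v hv) ?_
  rw [h.proj v hv, ProjectivePlane.dot_rep_mk]
  exact hα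

/-- The image of a local generator of a line field. -/
def generatorLift (π : S → ProjectivePlane) (φ : OpenPartialHomeomorph S (ℂ × ℂ))
    (α : Fin 3 → ℂ) (a b : ℂ → ℂ) (t : ℂ) : Fin 3 → ℂ :=
  fderiv ℂ (chartLift π φ α) (t, 0) (a t, b t)

theorem IsPlaneModel.contDiffAt_generatorLift (h : IsPlaneModel F C π s) (hv : v ∈ cone F)
    (hg : IsLocalGenerator C X.line ⟨s v, h.mem v hv⟩ φ a b) (hα : α ⬝ᵥ v ≠ 0) :
    ContDiffAt ℂ ω (generatorLift π φ α a b) (φ (s v)).1 := by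
  have h1 := h.contDiffAt_chartLift_section hv hg.adapted hg.mem_source hα
  have h2 : ContDiffAt ℂ ω (fderiv ℂ (chartLift π φ α)) ((φ (s v)).1, 0) :=
    h1.fderiv_right (m := ω) (by simp)
  have h3 : ContDiffAt ℂ ω (fun t : ℂ => (t, (0 : ℂ))) (φ (s v)).1 := by fun_prop
  have h4 : ContDiffAt ℂ ω (fun t : ℂ => (a t, b t)) (φ (s v)).1 :=
    hg.analyticAt_fst.contDiffAt.prodMk hg.analyticAt_snd.contDiffAt
  exact (h2.comp (φ (s v)).1 h3).clm_apply h4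

/-- The chain rule identifies the derivative along the generator at the normalized coordinates;
passing to `w` costs the factor of degree `d - 1` of the gradient. So the poles of the polar field
are governed by `generatorDeriv`. -/
theorem IsPlaneModel.gradient_dot_generatorLift (h : IsPlaneModel F C π s)
    (hF : F.IsHomogeneous d) (hv : v ∈ cone F)
    (hg : IsLocalGenerator C X.line ⟨s v, h.mem v hv⟩ φ a b) (hα : α ⬝ᵥ v ≠ 0) :
    ∀ᶠ w in 𝓝[cone F] v, gradient F w ⬝ᵥ generatorLift π φ α a b (φ (s w)).1 =
      (α ⬝ᵥ w) ^ (d - 1) * generatorDeriv F π φ α a b (φ (s w)).1 := by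
  filter_upwards [h.eventually_polarField_eq hF hv hg hα] with w hw
  obtain ⟨hw, hs, h0, hα', h1, -⟩ := hw
  have h2 := (h.contDiffAt_chartLift_section hw hg.adapted hs hα').differentiableAt (by simp)
  rw [generatorDeriv, hasFDerivAt_eval_comp F h2.hasFDerivAt, generatorLift]
  conv_lhs => rw [h1]
  rw [gradient_smul hF, smul_dotProduct, smul_eq_mul]
  congr 2
  rw [← h1]

theorem IsPlaneModel.tendsto_coord (h : IsPlaneModel F C π s) (hv : v ∈ cone F)
    (hs : s v ∈ φ.source) :
    Tendsto (fun w => (φ (s w)).1) (𝓝[cone F] v) (𝓝 (φ (s v)).1) :=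
  ((continuous_fst.continuousAt.comp (φ.continuousAt hs)).tendsto).comp (h.tendsto v hv)

theorem continuousAt_crossProduct {E : Type*} [TopologicalSpace E] {f g : E → Fin 3 → ℂ} {x : E}
    (hf : ContinuousAt f x) (hg : ContinuousAt g x) :
    ContinuousAt (fun y => crossProduct (f y) (g y)) x := by
  have hf' : ∀ i, ContinuousAt (fun y => f y i) x := continuousAt_pi.1 hf
  have hg' : ∀ i, ContinuousAt (fun y => g y i) x := continuousAt_pi.1 hg
  refine continuousAt_pi.2 fun i => ?_
  simp only [cross_apply]
  fin_cases i
  · exact ((hf' 1).mul (hg' 2)).sub ((hf' 2).mul (hg' 1))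
  · exact ((hf' 2).mul (hg' 0)).sub ((hf' 0).mul (hg' 2))
  · exact ((hf' 0).mul (hg' 1)).sub ((hf' 1).mul (hg' 0))

/-- A form vanishing at `v` is `O(t - t₀)` along the curve, so its `n`-th power is dominated by `(t
- t₀) ^ n`, hence by the denominator of the polar. All other factors are continuous at `v`. -/
theorem IsPlaneModel.bounded_polarField (h : IsPlaneModel F C π s) (hF : F.IsHomogeneous d)
    (hv : v ∈ cone F) (hg : IsLocalGenerator C X.line ⟨s v, h.mem v hv⟩ φ a b)
    (hα : α ⬝ᵥ v ≠ 0) {n : ℕ}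
    (hθ : ∃ M : ℝ, ∀ᶠ t in 𝓝 (φ (s v)).1,
      ‖t - (φ (s v)).1‖ ^ n ≤ M * ‖generatorDeriv F π φ α a b t‖)
    {β : Fin 3 → ℂ} (hβ : β ⬝ᵥ v = 0) :
    ∃ M : ℝ, ∀ᶠ w in 𝓝[cone F] v, ‖β ⬝ᵥ w‖ ^ n * ‖polarField F X π s w‖ ≤ M := by
  obtain ⟨M, hM⟩ := hθ
  have htend := h.tendsto_coord hv hg.mem_source
  set t₀ := (φ (s v)).1 with ht₀
  have hev := h.eventually_polarField_eq hF hv hg hα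
  have hself := hev.self_of_nhdsWithin hv
  have hαc : Continuous fun w : Fin 3 → ℂ => α ⬝ᵥ w := (contDiff_dotProduct α).continuous
  -- the vanishing of `β` along the curve
  have h1 : DifferentiableAt ℂ (fun t : ℂ => β ⬝ᵥ chartLift π φ α (t, 0)) t₀ := by
    have h2 := (h.contDiffAt_chartLift_section hv hg.adapted hg.mem_source hα).differentiableAt
      (by simp)
    have h3 : DifferentiableAt ℂ (fun t : ℂ => (t, (0 : ℂ))) t₀ := by fun_prop
    have h4 : DifferentiableAt ℂ (fun w : Fin 3 → ℂ => β ⬝ᵥ w) (chartLift π φ α (t₀, 0)) :=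
      (contDiff_dotProduct β).differentiable (by simp) _
    exact DifferentiableAt.comp (g := fun z => β ⬝ᵥ chartLift π φ α z)
      (f := fun t : ℂ => (t, (0 : ℂ))) t₀ (h4.comp (t₀, (0 : ℂ)) h2) h3
  have h2 : β ⬝ᵥ chartLift π φ α (t₀, 0) = 0 := by
    have h3 := hself.2.2.2.2.1
    rw [h3, dotProduct_smul, smul_eq_mul, mul_eq_zero] at hβ
    exact hβ.resolve_left hα
  obtain ⟨L, hL0, hL⟩ := h1.isBigO_sub.exists_pos
  replace hL := hL.bound
  simp only [h2, sub_zero] at hL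
  obtain ⟨K₁, hK₁⟩ := eventually_norm_le_of_continuousAt
    ((hαc.continuousAt (x := v)).pow n)
  obtain ⟨K₂, hK₂⟩ := eventually_norm_le_of_continuousAt
    (((hαc.continuousAt (x := v)).pow (d - 1)).inv₀ (pow_ne_zero _ hα))
  have h5 := (h.contDiffAt_generatorLift hv hg hα).continuousAt
  have h6 : ContinuousAt (fun z : (Fin 3 → ℂ) × ℂ =>
      crossProduct z.1 (generatorLift π φ α a b z.2)) (v, t₀) :=
    continuousAt_crossProduct continuousAt_fst
      (ContinuousAt.comp (f := Prod.snd) (x := (v, t₀)) h5 continuousAt_snd)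
  obtain ⟨K₃, hK₃⟩ := eventually_norm_le_of_continuousAt h6
  have h7 : Tendsto (fun w => (w, (φ (s w)).1)) (𝓝[cone F] v) (𝓝 (v, t₀)) :=
    (tendsto_nhdsWithin_of_tendsto_nhds tendsto_id).prodMk_nhds htend
  refine ⟨K₁ * (L ^ n * |M|) * K₂ * K₃, ?_⟩
  filter_upwards [hev, h.gradient_dot_generatorLift hF hv hg hα, nhdsWithin_le_nhds hK₁,
    nhdsWithin_le_nhds hK₂, h7.eventually hK₃, htend.eventually hM, htend.eventually hL]
    with w hw hgr k1 k2 k3 km kl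
  obtain ⟨-, -, -, hα', hw', hu⟩ := hw
  set t := (φ (s w)).1
  have e1 : polarField F X π s w = polar F w (generatorLift π φ α a b t) := hu
  have e2 : ‖β ⬝ᵥ w‖ = ‖α ⬝ᵥ w‖ * ‖β ⬝ᵥ chartLift π φ α (t, 0)‖ := by
    conv_lhs => rw [hw', dotProduct_smul, smul_eq_mul, norm_mul]
  have e3 : ‖β ⬝ᵥ chartLift π φ α (t, 0)‖ ^ n ≤
      L ^ n * |M| * ‖generatorDeriv F π φ α a b t‖ := by
    calc _ ≤ (L * ‖t - t₀‖) ^ n := pow_le_pow_left₀ (norm_nonneg _) kl n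
      _ = L ^ n * ‖t - t₀‖ ^ n := mul_pow _ _ _
      _ ≤ _ := by
        rw [mul_assoc]
        refine mul_le_mul_of_nonneg_left (km.trans ?_) (pow_nonneg hL0.le n)
        exact mul_le_mul_of_nonneg_right (le_abs_self M) (norm_nonneg _)
  -- Where the denominator vanishes, the convention `0⁻¹ = 0` makes the estimate trivial, so no
  -- separate statement at the pole is needed.
  have e4 : ‖β ⬝ᵥ chartLift π φ α (t, 0)‖ ^ n * ‖generatorDeriv F π φ α a b t‖⁻¹ ≤
      L ^ n * |M| := by
    rcases eq_or_ne ‖generatorDeriv F π φ α a b t‖ 0 with h0 | h0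
    · rw [h0, inv_zero, mul_zero]
      positivity
    · rw [← div_eq_mul_inv, div_le_iff₀ (lt_of_le_of_ne (norm_nonneg _) h0.symm)]
      exact e3
  rw [Pi.pow_apply, norm_pow] at k1
  rw [Pi.inv_apply, Pi.pow_apply, norm_inv] at k2
  rw [e1, polar, hgr, norm_smul, mul_inv, norm_mul, norm_inv, norm_inv, e2, mul_pow]
  calc _ = ‖α ⬝ᵥ w‖ ^ n *
        (‖β ⬝ᵥ chartLift π φ α (t, 0)‖ ^ n * ‖generatorDeriv F π φ α a b t‖⁻¹) *
        ‖(α ⬝ᵥ w) ^ (d - 1)‖⁻¹ * ‖crossProduct w (generatorLift π φ α a b t)‖ := by ring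
    _ ≤ _ := by
      have hK₁ : 0 ≤ K₁ := (pow_nonneg (norm_nonneg _) _).trans k1
      have hK₂ : 0 ≤ K₂ := (inv_nonneg.2 (norm_nonneg _)).trans k2
      gcongr

theorem IsLocalGenerator.congr_point {p q : C} (h : IsLocalGenerator C X.line p φ a b)
    (hpq : (q : S) = p) : IsLocalGenerator C X.line q φ a b := by
  rwa [Subtype.ext hpq]

/-- The polar field of a line field along a curve mapped isomorphically to a smooth plane curve. -/
theorem IsPlaneModel.isPolarField (h : IsPlaneModel F C π s) (hF : F.IsHomogeneous d)
    (hd : 2 ≤ d)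
    (hreg : ∀ v (hv : v ∈ cone F), m (Projectivization.mk ℂ v hv.1) = 0 →
      ContMDiffAt 𝓘(ℂ, Fin 3 → ℂ) 𝓘(ℂ, ℂ × ℂ) ω s v)
    (hθ : ∀ v (hv : v ∈ cone F), ∃ φ a b α,
      IsLocalGenerator C X.line ⟨s v, h.mem v hv⟩ φ a b ∧ α ⬝ᵥ v ≠ 0 ∧
        ∃ M : ℝ, ∀ᶠ t in 𝓝 (φ (s v)).1,
          ‖t - (φ (s v)).1‖ ^ m (Projectivization.mk ℂ v hv.1) ≤
            M * ‖generatorDeriv F π φ α a b t‖) :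
    IsPolarField F d m (polarField F X π s) where
  smul v hv c hc := by
    obtain ⟨φ, a, b, α, hg, hα, -⟩ := hθ v hv
    have hv' : c • v ∈ cone F :=
      ⟨smul_ne_zero hc hv.1, by rw [eval_smul_of_isHomogeneous hF, hv.2, mul_zero]⟩
    have hs := h.smul v hv c hc
    have h1 := ((h.eventually_polarField_eq hF hv hg hα).self_of_nhdsWithin hv).2.2.2.2.2
    have hα' : α ⬝ᵥ (c • v) ≠ 0 := by
      rw [dotProduct_smul]
      exact smul_ne_zero hc hα
    have h2 := ((h.eventually_polarField_eq hF hv' (hg.congr_point hs)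
      hα').self_of_nhdsWithin hv').2.2.2.2.2
    rw [h1, h2, hs, polar_smul_left hF hd hc]
  dot_self v hv := by
    rw [polarField, dif_pos (h.mem v hv)]
    exact dot_polar _ _
  analytic v hv hm := by
    obtain ⟨φ, a, b, α, hg, hα, M, hM⟩ := hθ v hv
    have hev := h.eventually_polarField_eq hF hv hg hα
    -- For multiplicity zero the assumed estimate reads `1 ≤ M * ‖generatorDeriv‖`, which excludes a
    -- zero of the denominator.
    have h1 : generatorDeriv F π φ α a b (φ (s v)).1 ≠ 0 := fun h0 => by
      have := hM.self_of_nhds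
      rw [hm, pow_zero, h0, norm_zero, mul_zero] at this
      exact absurd this (not_le.2 one_pos)
    have h2 : gradient F v ⬝ᵥ generatorLift π φ α a b (φ (s v)).1 ≠ 0 := by
      rw [(h.gradient_dot_generatorLift hF hv hg hα).self_of_nhdsWithin hv]
      exact mul_ne_zero (pow_ne_zero _ hα) h1
    have h3 : ContMDiffAt 𝓘(ℂ, Fin 3 → ℂ) 𝓘(ℂ, ℂ × ℂ) ω (φ ∘ s) v :=
      (contMDiffAt_of_mem_maximalAtlas hg.adapted.1 hg.mem_source).comp v (hreg v hv hm)
    have h4 : ContDiffAt ℂ ω (fun w => (φ (s w)).1) v :=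
      (contMDiffAt_iff_contDiffAt.1 h3).fst
    refine ⟨?_, fun w => polar F w (generatorLift π φ α a b (φ (s w)).1), ?_, ?_⟩
    · rw [(hev.self_of_nhdsWithin hv).2.2.2.2.2]
      exact polar_ne_zero hF hv.1 hv.2 h2
    · refine ContDiffAt.analyticAt ?_
      exact ContDiffAt.polar contDiffAt_id
        (ContDiffAt.comp (g := generatorLift π φ α a b) (f := fun w => (φ (s w)).1) v
          (h.contDiffAt_generatorLift hv hg hα) h4) h2
    · filter_upwards [hev] with w hw
      exact hw.2.2.2.2.2
  bounded v hv β hβ := by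
    obtain ⟨φ, a, b, α, hg, hα, hM⟩ := hθ v hv
    exact h.bounded_polarField hF hv hg hα hM hβ

end Surface

end

section

open MvPolynomial (eval)
open Filter ProjectivePlane

/-! ### Estimates along a curve -/

theorem fderiv_fst_eq_zero {G : ℂ × ℂ → ℂ} {t₀ : ℂ} (hG : DifferentiableAt ℂ G (t₀, 0))
    (h0 : ∀ᶠ t in 𝓝 t₀, G (t, 0) = 0) : fderiv ℂ G (t₀, 0) (1, 0) = 0 := by
  have h1 : HasDerivAt (fun t : ℂ => (t, (0 : ℂ))) (1, 0) t₀ :=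
    (hasDerivAt_id t₀).prodMk (hasDerivAt_const t₀ 0)
  have h2 : HasDerivAt (G ∘ fun t : ℂ => (t, (0 : ℂ))) (fderiv ℂ G (t₀, 0) (1, 0)) t₀ :=
    hG.hasFDerivAt.comp_hasDerivAt t₀ h1
  have h3 : G ∘ (fun t : ℂ => (t, (0 : ℂ))) =ᶠ[𝓝 t₀] fun _ => 0 := h0
  exact h2.unique ((hasDerivAt_const t₀ 0).congr_of_eventuallyEq h3)

theorem eventually_le_mul_of_ne_zero {f : ℂ → ℂ} {t₀ : ℂ} (hf : ContinuousAt f t₀)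
    (h0 : f t₀ ≠ 0) : ∃ M : ℝ, 0 ≤ M ∧ ∀ᶠ t in 𝓝 t₀, ∀ z : ℂ, ‖z‖ ≤ M * ‖f t * z‖ := by
  obtain ⟨M, hM⟩ := eventually_norm_le_of_continuousAt (hf.inv₀ h0)
  refine ⟨M, (norm_nonneg _).trans hM.self_of_nhds, ?_⟩
  filter_upwards [hM, hf.eventually_ne h0] with t ht ht' z
  calc ‖z‖ = ‖(f t)⁻¹‖ * ‖f t * z‖ := by
        rw [← norm_mul, inv_mul_cancel_left₀ ht']
    _ ≤ _ := mul_le_mul_of_nonneg_right ht (norm_nonneg _)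

/-- The derivative of an equation of a smooth curve along a vector field, estimated by the normal
component of the vector field. -/
theorem exists_norm_le_fderiv {G : ℂ × ℂ → ℂ} {t₀ : ℂ} (hG : ContDiffAt ℂ ω G (t₀, 0))
    (h0 : ∀ᶠ t in 𝓝 t₀, G (t, 0) = 0) (h1 : fderiv ℂ G (t₀, 0) ≠ 0) (a b : ℂ → ℂ) :
    ∃ M : ℝ, 0 ≤ M ∧ ∀ᶠ t in 𝓝 t₀, ‖b t‖ ≤ M * ‖fderiv ℂ G (t, 0) (a t, b t)‖ := by
  have h2 : fderiv ℂ G (t₀, 0) (0, 1) ≠ 0 :=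
    (clm_prod_ne_zero h1).resolve_left
      (not_not.2 (fderiv_fst_eq_zero (hG.differentiableAt (by simp)) h0))
  have hi : Continuous fun t : ℂ => (t, (0 : ℂ)) := by fun_prop
  have h3 : ContinuousAt (fun t : ℂ => fderiv ℂ G (t, 0) (0, 1)) t₀ := by
    have h4 : ContDiffAt ℂ ω (fderiv ℂ G) (t₀, 0) := hG.fderiv_right (m := ω) (by simp)
    exact (ContinuousAt.comp (g := fderiv ℂ G) (f := fun t : ℂ => (t, (0 : ℂ))) h4.continuousAt
      hi.continuousAt).clm_apply continuousAt_const
  obtain ⟨M, hM0, hM⟩ := eventually_le_mul_of_ne_zero h3 h2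
  refine ⟨M, hM0, ?_⟩
  have h5 : ∀ᶠ z in 𝓝 (t₀, (0 : ℂ)), DifferentiableAt ℂ G z := by
    filter_upwards [hG.analyticAt.eventually_analyticAt] with z hz using hz.differentiableAt
  filter_upwards [hM, hi.continuousAt.eventually h5, h0.eventually_nhds] with t ht hd ht0
  -- `G` vanishes on the axis, so only its normal derivative contributes, multiplied by `b`; that
  -- derivative is nonzero at `t₀` and hence bounded below nearby.
  rw [clm_prod_eq, fderiv_fst_eq_zero hd ht0, mul_zero, zero_add, mul_comm (b t)]
  exact ht (b t)

theorem exists_pow_le_of_analyticOrderAt {b : ℂ → ℂ} {t₀ : ℂ} (hb : AnalyticAt ℂ b t₀) {n : ℕ}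
    (hn : analyticOrderAt b t₀ = n) :
    ∃ M : ℝ, ∀ᶠ t in 𝓝 t₀, ‖t - t₀‖ ^ n ≤ M * ‖b t‖ := by
  obtain ⟨g, hg, hg0, hbg⟩ := hb.analyticOrderAt_eq_natCast.1 hn
  obtain ⟨M, -, hM⟩ := eventually_le_mul_of_ne_zero hg.continuousAt hg0
  refine ⟨M, ?_⟩
  filter_upwards [hM, hbg] with t ht ht'
  rw [ht', smul_eq_mul, mul_comm _ (g t), ← norm_pow]
  exact ht _

section Surface

variable {S : Type*} [TopologicalSpace S] {π : S → ProjectivePlane}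
  {χ : OpenPartialHomeomorph S (ℂ × ℂ)} {α : Fin 3 → ℂ} {p : S}

/-- `V` gives homogeneous coordinates of the images of the points, in terms of the chart `χ`. -/
def IsChartLift (π : S → ProjectivePlane) (χ : OpenPartialHomeomorph S (ℂ × ℂ))
    (V : ℂ × ℂ → Fin 3 → ℂ) : Prop :=
  ∀ z ∈ χ.target, ∃ h, π (χ.symm z) = Projectivization.mk ℂ (V z) h

theorem IsChartLift.normLift_eq {V : ℂ × ℂ → Fin 3 → ℂ} (h : IsChartLift π χ V)
    (hp : p ∈ χ.source) (α : Fin 3 → ℂ) :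
    normLift α (π p) = (α ⬝ᵥ V (χ p))⁻¹ • V (χ p) := by
  obtain ⟨h0, h1⟩ := h (χ p) (χ.map_source hp)
  rw [χ.left_inv hp] at h1
  rw [h1, normLift_mk]

theorem IsChartLift.dot_ne_zero {V : ℂ × ℂ → Fin 3 → ℂ} (h : IsChartLift π χ V)
    (hp : p ∈ χ.source) : α ⬝ᵥ (π p).rep ≠ 0 ↔ α ⬝ᵥ V (χ p) ≠ 0 := by
  obtain ⟨h0, h1⟩ := h (χ p) (χ.map_source hp)
  rw [χ.left_inv hp] at h1
  rw [h1, dot_rep_mk]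

end Surface

section Surface

variable {S : Type*} [TopologicalSpace S] [ChartedSpace (ℂ × ℂ) S] {C : EmbeddedCurve S}
  {F : MvPolynomial (Fin 3) ℂ} {d : ℕ} {X : LineField C} {π : S → ProjectivePlane}
  {s : (Fin 3 → ℂ) → S} {φ χ : OpenPartialHomeomorph S (ℂ × ℂ)} {α : Fin 3 → ℂ} {a b : ℂ → ℂ}
  {A : Matrix (Fin 3) (Fin 3) ℂ} {p : S} {v : Fin 3 → ℂ}

theorem fderiv_comp_transition_ne_zero (hφ : φ ∈ IsManifold.maximalAtlas 𝓘(ℂ, ℂ × ℂ) ω S)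
    (hχ : χ ∈ IsManifold.maximalAtlas 𝓘(ℂ, ℂ × ℂ) ω S) (hp : p ∈ φ.source) (hp' : p ∈ χ.source)
    {g : ℂ × ℂ → ℂ} (hg : DifferentiableAt ℂ g (χ p)) (h : fderiv ℂ g (χ p) ≠ 0) :
    fderiv ℂ (g ∘ χ ∘ φ.symm) (φ p) ≠ 0 := by
  intro h0
  refine h (ContinuousLinearMap.ext fun w => ?_)
  obtain ⟨ξ, hξ⟩ := (chartDeriv_bijective hχ hp').2 w
  have h1 := transition_hasFDerivAt hφ hχ (φ.map_source hp) (by rwa [φ.left_inv hp])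
  have h2 : HasFDerivAt g (fderiv ℂ g (χ p)) ((χ ∘ φ.symm) (φ p)) := by
    rw [Function.comp_apply, φ.left_inv hp]
    exact hg.hasFDerivAt
  have h3 := (h2.comp (φ p) h1).fderiv
  rw [h0] at h3
  rw [← hξ, chartDeriv_transition hφ hχ hp hp']
  exact (congrArg (fun L : ℂ × ℂ →L[ℂ] ℂ => L (chartDeriv φ p ξ)) h3).symm

theorem IsChartLift.contMDiffAt {V : ℂ × ℂ → Fin 3 → ℂ} (h : IsChartLift π χ V)
    (hV : ContDiff ℂ ω V) (hχ : χ ∈ IsManifold.maximalAtlas 𝓘(ℂ, ℂ × ℂ) ω S)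
    (hp : p ∈ χ.source) (hα : α ⬝ᵥ (π p).rep ≠ 0) :
    ContMDiffAt 𝓘(ℂ, ℂ × ℂ) 𝓘(ℂ, Fin 3 → ℂ) ω (fun z => normLift α (π z)) p := by
  have h1 : ContDiffAt ℂ ω (fun z => (α ⬝ᵥ V z)⁻¹ • V z) (χ p) :=
    ((contDiff_dot hV α).contDiffAt.inv ((h.dot_ne_zero hp).1 hα)).smul hV.contDiffAt
  refine ((contMDiffAt_iff_contDiffAt.2 h1).comp p
    (contMDiffAt_of_mem_maximalAtlas hχ hp)).congr_of_eventuallyEq ?_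
  filter_upwards [χ.open_source.mem_nhds hp] with q hq using h.normLift_eq hq α

theorem contMDiffAt_of_affine_coords (hχ : χ ∈ IsManifold.maximalAtlas 𝓘(ℂ, ℂ × ℂ) ω S)
    (h0 : A 0 ⬝ᵥ v ≠ 0) (h : ∀ᶠ w in 𝓝 v, s w ∈ χ.source ∧
      χ (s w) = ((A 1 ⬝ᵥ w) / (A 0 ⬝ᵥ w), (A 2 ⬝ᵥ w) / (A 0 ⬝ᵥ w))) :
    ContMDiffAt 𝓘(ℂ, Fin 3 → ℂ) 𝓘(ℂ, ℂ × ℂ) ω s v := by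
  have h1 : ContDiffAt ℂ ω
      (fun w : Fin 3 → ℂ => ((A 1 ⬝ᵥ w) / (A 0 ⬝ᵥ w), (A 2 ⬝ᵥ w) / (A 0 ⬝ᵥ w))) v :=
    ((contDiff_dotProduct (A 1)).contDiffAt.div (contDiff_dotProduct (A 0)).contDiffAt h0).prodMk
      ((contDiff_dotProduct (A 2)).contDiffAt.div (contDiff_dotProduct (A 0)).contDiffAt h0)
  have h2 := h.self_of_nhds
  have h3 := contMDiffAt_symm_of_mem_maximalAtlas hχ (χ.map_source h2.1)
  rw [h2.2] at h3
  refine (h3.comp v (contMDiffAt_iff_contDiffAt.2 h1)).congr_of_eventuallyEq ?_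
  filter_upwards [h] with w hw
  rw [Function.comp_apply, ← hw.2, χ.left_inv hw.1]

theorem IsPlaneModel.eventually_eval_chartLift (h : IsPlaneModel F C π s) (hF : F.IsHomogeneous d)
    (hφ : IsAdaptedChart C.carrier φ) {t₀ : ℂ} (ht : (t₀, 0) ∈ φ.target) :
    ∀ᶠ t in 𝓝 t₀, eval (chartLift π φ α (t, 0)) F = 0 := by
  have hi : Continuous fun t : ℂ => (t, (0 : ℂ)) := by fun_prop
  filter_upwards [hi.continuousAt.eventually (φ.open_target.mem_nhds ht)] with t ht
  have h1 : φ.symm (t, 0) ∈ C.carrier :=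
    (hφ.2 _ (φ.map_target ht)).2 (by rw [φ.right_inv ht])
  rw [chartLift, normLift, eval_smul_of_isHomogeneous hF, h.eval_eq_zero _ h1, mul_zero]

/-- Where affine coordinates of the plane are also a chart of the surface, `F` in the adapted chart
is `affEq` after a change of coordinates. It is therefore a submersive equation of the curve, and
its derivative along the generator vanishes no faster than the normal component `b`. -/
theorem IsPlaneModel.exists_norm_le_generatorDeriv (h : IsPlaneModel F C π s)
    (hF : F.IsHomogeneous d) (hsm : IsSmoothForm F) (hv : v ∈ cone F)
    (hg : IsLocalGenerator C X.line ⟨s v, h.mem v hv⟩ φ a b)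
    (hχ : χ ∈ IsManifold.maximalAtlas 𝓘(ℂ, ℂ × ℂ) ω S) (hs : s v ∈ χ.source) (hA : A.det ≠ 0)
    (hV : IsChartLift π χ fun z => affineVec A z.1 z.2) :
    ∃ M : ℝ, 0 ≤ M ∧ ∀ᶠ t in 𝓝 (φ (s v)).1,
      ‖b t‖ ≤ M * ‖generatorDeriv F π φ (A 0) a b t‖ := by
  have hA1 : ∀ z : ℂ × ℂ, A 0 ⬝ᵥ affineVec A z.1 z.2 = 1 := fun z => dot_affineVec hA _ _ 0
  have hα : A 0 ⬝ᵥ v ≠ 0 := by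
    rw [← dot_rep_mk _ v hv.1, ← h.proj v hv, hV.dot_ne_zero hs, hA1]
    exact one_ne_zero
  have hsv : φ (s v) = ((φ (s v)).1, 0) :=
    Prod.ext rfl ((hg.adapted.2 _ hg.mem_source).1 (h.mem v hv))
  have ht := φ.map_source hg.mem_source
  rw [hsv] at ht
  refine exists_norm_le_fderiv (G := fun y => eval (chartLift π φ (A 0) y) F)
    ((contDiff_eval F).contDiffAt.comp _
      (h.contDiffAt_chartLift_section hv hg.adapted hg.mem_source hα))
    (h.eventually_eval_chartLift hF hg.adapted ht) ?_ a b
  have h1 : (fun y => eval (chartLift π φ (A 0) y) F) =ᶠ[𝓝 (φ (s v))]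
      affEq F A ∘ χ ∘ φ.symm := by
    have h2 : ∀ᶠ y in 𝓝 (φ (s v)), φ.symm y ∈ χ.source := by
      have h3 := φ.continuousAt_symm (φ.map_source hg.mem_source)
      refine h3.eventually ?_
      rw [φ.left_inv hg.mem_source]
      exact χ.open_source.mem_nhds hs
    filter_upwards [h2] with y hy
    rw [chartLift, hV.normLift_eq hy, hA1, inv_one, one_smul]
    rfl
  have h4 : affEq F A (χ (s v)) = 0 := by
    have h5 : eval (normLift (A 0) (π (s v))) F = 0 := by
      rw [normLift, eval_smul_of_isHomogeneous hF, h.eval_eq_zero _ (h.mem v hv), mul_zero]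
    rw [hV.normLift_eq hs, hA1, inv_one, one_smul] at h5
    exact h5
  rw [← hsv, h1.fderiv_eq]
  exact fderiv_comp_transition_ne_zero hg.adapted.1 hχ hg.mem_source hs
    ((contDiff_affEq F A).differentiable (by simp) _) (fderiv_affEq_ne_zero hF hsm hA h4)

end Surface

end

/-! ### Orders of tangency, and the bound for plane curves. -/

section

open MvPolynomial (eval)
open Filter ProjectivePlane

theorem eval_rep_mk {F : MvPolynomial (Fin 3) ℂ} {d : ℕ} (hF : F.IsHomogeneous d) {v : Fin 3 → ℂ}
    (hv : v ≠ 0) : eval (Projectivization.mk ℂ v hv).rep F = 0 ↔ eval v F = 0 := by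
  obtain ⟨c, hc⟩ := Projectivization.exists_smul_eq_mk_rep ℂ v hv
  rw [← hc, Units.smul_def, eval_smul_of_isHomogeneous hF, mul_eq_zero,
    or_iff_right (pow_ne_zero _ c.ne_zero)]

section Surface

variable {S : Type*} [TopologicalSpace S] [ChartedSpace (ℂ × ℂ) S] {C : EmbeddedCurve S}
  {X : LineField C} {p : C} {φ : OpenPartialHomeomorph S (ℂ × ℂ)} {a b : ℂ → ℂ}

/-- If the normal component vanished, the generator would give a nonzero vector common to the line
and the tangent line. -/
theorem IsLocalGenerator.snd_ne_zero (hg : IsLocalGenerator C X.line p φ a b)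
    (hX : X.IsTransverse) : b (φ p).1 ≠ 0 := by
  intro hb
  have h1 : (a (φ p).1, b (φ p).1) ∈ (X.line p).map (chartDeriv φ p) := by
    rw [hg.span_eq.self_of_nhds]
    exact Submodule.mem_span_singleton_self _
  obtain ⟨ξ, hξ, hξ'⟩ := h1
  have h2 : ξ ∈ C.tangentLine p := by
    rw [C.tangentLine_eq_ker p.2 hg.adapted hg.mem_source, LinearMap.mem_ker]
    exact (congrArg Prod.snd hξ').trans hb
  have h3 : ξ = 0 := Submodule.disjoint_def.1 (hX p).disjoint ξ hξ h2
  rw [h3, map_zero] at hξ'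
  exact hg.ne_zero hξ'.symm

theorem LineField.IsTransverse.tang_eq_zero (hX : X.IsTransverse) : X.tang = 0 := by
  have h1 : ∀ q, X.tangOrder q = 0 := fun q => by
    obtain ⟨φ, a, b, hg⟩ := X.holomorphic q
    refine le_antisymm (sInf_le ⟨φ, a, b, hg, ?_⟩) zero_le
    exact (hg.analyticAt_snd.analyticOrderAt_eq_zero.2 (hg.snd_ne_zero hX)).symm
  rw [LineField.tang]
  simp [h1]

/-- An infimum in `ℕ∞` over a nonempty set is attained. Working with a generator that realizes it
makes the independence of the order from the generator unnecessary. -/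
theorem LineField.exists_isLocalGenerator (X : LineField C) (p : C) :
    ∃ φ a b, IsLocalGenerator C X.line p φ a b ∧ X.tangOrder p = analyticOrderAt b (φ p).1 := by
  obtain ⟨φ, a, b, hg⟩ := X.holomorphic p
  exact csInf_mem (s := {n | ∃ φ a b, IsLocalGenerator C X.line p φ a b ∧
    n = analyticOrderAt b (φ p).1}) ⟨_, φ, a, b, hg, rfl⟩

theorem LineField.sum_le_tang (X : LineField C) (s : Finset C) :
    ∑ p ∈ s, X.tangOrder p ≤ X.tang := le_iSup (fun s : Finset C => ∑ p ∈ s, X.tangOrder p) s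

theorem LineField.tangOrder_le_tang (X : LineField C) (p : C) : X.tangOrder p ≤ X.tang := by
  simpa using X.sum_le_tang {p}

/-- Each tangency counts at least one, so arbitrarily many of them would make the supremum of the
partial sums infinite. -/
theorem LineField.finite_tangOrder_ne_zero (hX : X.tang ≠ ⊤) :
    {p | X.tangOrder p ≠ 0}.Finite := by
  by_contra h
  obtain ⟨N, hN⟩ := ENat.ne_top_iff_exists.1 hX
  obtain ⟨s, hs, hs'⟩ := Set.Infinite.exists_subset_card_eq h (N + 1)
  have h1 := X.sum_le_tang s
  have h2 : ((N + 1 : ℕ) : ℕ∞) ≤ ∑ p ∈ s, X.tangOrder p := by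
    rw [← hs', Finset.card_eq_sum_ones, Nat.cast_sum]
    refine Finset.sum_le_sum fun p hp => ?_
    rw [Nat.cast_one]
    exact Order.one_le_iff_ne_zero.2 (hs hp)
  rw [← hN] at h1
  exact absurd (Nat.cast_le.1 (h2.trans h1)) (by omega)

end Surface

/-! ### Line fields along plane curves -/

open Classical in
/-- The point of the plane with given homogeneous coordinates. -/
def planePoint (v : Fin 3 → ℂ) : ProjectivePlane :=
  if h : v ≠ 0 then Projectivization.mk ℂ v h else Projectivization.mk ℂ 1 one_ne_zero

theorem planePoint_eq {v : Fin 3 → ℂ} (h : v ≠ 0) : planePoint v = Projectivization.mk ℂ v h :=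
  dif_pos h

theorem exists_planeChart {A : Matrix (Fin 3) (Fin 3) ℂ} (hA : A.det ≠ 0) :
    ∃ χ : OpenPartialHomeomorph ProjectivePlane (ℂ × ℂ),
      χ ∈ IsManifold.maximalAtlas 𝓘(ℂ, ℂ × ℂ) ω ProjectivePlane ∧
      χ.source = {x | A 0 ⬝ᵥ x.rep ≠ 0} ∧
      (∀ x, χ x = (ratio (A 1) (A 0) x, ratio (A 2) (A 0) x)) ∧
      IsChartLift id χ fun z => affineVec A z.1 z.2 := by
  obtain ⟨χ, h1, h2⟩ := ProjectivePlane.surfaceAtlas.exists_openPartialHomeomorph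
    (e := affineChart A hA) ⟨A, hA, rfl⟩
  refine ⟨χ, h1, congrArg PartialEquiv.source h2, fun x => ?_, fun z _ => ?_⟩
  · exact congrArg (fun e : PartialEquiv ProjectivePlane (ℂ × ℂ) => e x) h2
  · exact ⟨affineVec_ne_zero hA _ _,
      congrArg (fun e : PartialEquiv ProjectivePlane (ℂ × ℂ) => e.symm z) h2⟩

theorem contMDiffAt_planePoint {v : Fin 3 → ℂ} (hv : v ≠ 0) :
    ContMDiffAt 𝓘(ℂ, Fin 3 → ℂ) 𝓘(ℂ, ℂ × ℂ) ω planePoint v := by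
  obtain ⟨A, hA, h0⟩ := exists_affine_forms (Projectivization.mk ℂ v hv)
  rw [dot_rep_mk] at h0
  obtain ⟨χ, hχ, hs, hχe, -⟩ := exists_planeChart hA
  refine contMDiffAt_of_affine_coords hχ h0 ?_
  have h1 : ∀ᶠ w in 𝓝 v, A 0 ⬝ᵥ w ≠ 0 :=
    (contDiff_dotProduct (A 0)).continuous.continuousAt.eventually_ne h0
  filter_upwards [h1, eventually_ne_nhds hv] with w hw hw0
  rw [planePoint_eq hw0, hs, hχe, ratio_mk, ratio_mk]
  exact ⟨(dot_rep_mk _ _ _).2 hw, rfl⟩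

variable {C : EmbeddedCurve ProjectivePlane} {F : MvPolynomial (Fin 3) ℂ} {d : ℕ}

theorem isPlaneModel_id (hF : F.IsHomogeneous d) (hC : C.carrier = {x | eval x.rep F = 0}) :
    IsPlaneModel F C id planePoint where
  contMDiffAt z _ α hα := by
    obtain ⟨A, hA, h0⟩ := exists_affine_forms z
    obtain ⟨χ, hχ, hs, -, hV⟩ := exists_planeChart hA
    exact hV.contMDiffAt (contDiff_affineVec A contDiff_fst contDiff_snd) hχ
      (by rw [hs]; exact h0) hα
  eval_eq_zero z hz := by
    rw [hC] at hz
    exact hz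
  mem v hv := by
    rw [hC, planePoint_eq hv.1]
    exact (eval_rep_mk hF hv.1).2 hv.2
  proj v hv := planePoint_eq hv.1
  smul v hv c hc := by
    rw [planePoint_eq hv.1, planePoint_eq (smul_ne_zero hc hv.1), Projectivization.mk_eq_mk_iff']
    exact ⟨c, rfl⟩
  tendsto v hv :=
    tendsto_nhdsWithin_of_tendsto_nhds (contMDiffAt_planePoint hv.1).continuousAt.tendsto

/-- The polar field of `X` has poles bounded by the orders of tangency, since the derivative of `F`
along a generator is comparable from below with its normal component. Assuming the bound fails makes
all orders finite and the tangencies finitely many, as `IsPolarField.lt_sum` requires. -/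
theorem pow_le_tang (hF : F.IsHomogeneous d) (hd : 2 ≤ d) (hsm : IsSmoothForm F)
    (hC : C.carrier = {x | eval x.rep F = 0}) (X : LineField C) :
    (((d - 1) ^ 2 : ℕ) : ℕ∞) ≤ X.tang := by
  classical
  by_contra! hlt
  have htop : X.tang ≠ ⊤ := (hlt.trans (ENat.natCast_lt_top _)).ne
  have hord : ∀ p, ((X.tangOrder p).toNat : ℕ∞) = X.tangOrder p := fun p =>
    ENat.natCast_toNat (ne_top_of_le_ne_top htop (X.tangOrder_le_tang p))
  let m : ProjectivePlane → ℕ := fun q =>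
    if h : q ∈ C.carrier then (X.tangOrder ⟨q, h⟩).toNat else 0
  have hmodel := isPlaneModel_id hF hC
  have hu : IsPolarField F d m (polarField F X id planePoint) := by
    refine hmodel.isPolarField hF hd (fun v hv _ => contMDiffAt_planePoint hv.1) fun v hv => ?_
    obtain ⟨φ, a, b, hg, hb⟩ := X.exists_isLocalGenerator ⟨planePoint v, hmodel.mem v hv⟩
    obtain ⟨A, hA, h0⟩ := exists_affine_forms (Projectivization.mk ℂ v hv.1)
    obtain ⟨χ, hχ, hs, -, hV⟩ := exists_planeChart hA
    refine ⟨φ, a, b, A 0, hg, (dot_rep_mk _ _ _).1 h0, ?_⟩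
    have hm : m (Projectivization.mk ℂ v hv.1) =
        (X.tangOrder ⟨planePoint v, hmodel.mem v hv⟩).toNat := by
      simp only [m, ← planePoint_eq hv.1]
      exact dif_pos (hmodel.mem v hv)
    rw [← hord] at hb
    obtain ⟨M, hM⟩ := exists_pow_le_of_analyticOrderAt hg.analyticAt_snd hb.symm
    obtain ⟨N, hN0, hN⟩ := hmodel.exists_norm_le_generatorDeriv hF hsm hv hg hχ
      (by rw [hs, planePoint_eq hv.1]; exact h0) hA hV
    have hM0 : M ≤ |M| := le_abs_self M
    refine ⟨|M| * N, ?_⟩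
    rw [hm]
    filter_upwards [hM, hN] with t h1 h2
    calc _ ≤ M * ‖b t‖ := h1
      _ ≤ |M| * ‖b t‖ := by gcongr
      _ ≤ |M| * (N * ‖generatorDeriv F id φ (A 0) a b t‖) := by gcongr
      _ = _ := (mul_assoc _ _ _).symm
  have hfin := LineField.finite_tangOrder_ne_zero htop
  have h1 := hu.lt_sum hF hd hsm (D := hfin.toFinset.image Subtype.val) (fun q hq => ?_) ?_
  · rw [Finset.sum_image fun x _ y _ h => Subtype.ext h] at h1
    replace h1 : d * (d - 2) < ∑ p ∈ hfin.toFinset, m p := h1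
    have h2 : ((∑ p ∈ hfin.toFinset, m p : ℕ) : ℕ∞) ≤ X.tang := by
      rw [Nat.cast_sum]
      refine le_trans (Finset.sum_le_sum fun p _ => ?_) (X.sum_le_tang hfin.toFinset)
      simp only [m, dif_pos p.2]
      exact (hord p).le
    have h3 := Nat.cast_lt.1 (h2.trans_lt hlt)
    obtain ⟨e, rfl⟩ := Nat.exists_eq_add_of_le' hd
    -- The strict inequality for the number of poles supplies the missing one in `(d - 1)² = d(d -
    -- 2) + 1`.
    have h4 : (e + 2 - 1) ^ 2 = (e + 2) * (e + 2 - 2) + 1 := by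
      simp only [Nat.add_sub_cancel, show e + 2 - 1 = e + 1 from rfl]
      ring
    omega
  · by_cases h : q ∈ C.carrier
    · simp only [m, dif_pos h]
      by_contra h'
      refine hq (Finset.mem_image.2 ⟨⟨q, h⟩, hfin.mem_toFinset.2 fun h0 => h' ?_, rfl⟩)
      rw [h0]
      rfl
    · exact dif_neg h
  · intro q hq
    obtain ⟨p, -, rfl⟩ := Finset.mem_image.1 hq
    exact hC.le p.2

end

section

open MvPolynomial (eval)
open Filter ProjectivePlane

/-! ### Straightening curves -/

section Surface

variable {S : Type*} [TopologicalSpace S] [ChartedSpace (ℂ × ℂ) S] [IsManifold 𝓘(ℂ, ℂ × ℂ) ω S]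
  {χ : OpenPartialHomeomorph S (ℂ × ℂ)} {p : S}

theorem exists_chart_of_coords (hχ : χ ∈ IsManifold.maximalAtlas 𝓘(ℂ, ℂ × ℂ) ω S)
    (hp : p ∈ χ.source) {g : ℂ × ℂ → ℂ × ℂ} (hg : ContDiff ℂ ω g)
    (hinj : Function.Injective (fderiv ℂ g (χ p))) :
    ∃ φ ∈ IsManifold.maximalAtlas 𝓘(ℂ, ℂ × ℂ) ω S, p ∈ φ.source ∧ φ.source ⊆ χ.source ∧
      ∀ q, φ q = g (χ q) := by
  let L : (ℂ × ℂ) ≃L[ℂ] ℂ × ℂ :=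
    (LinearEquiv.ofInjectiveEndo (fderiv ℂ g (χ p)).toLinearMap hinj).toContinuousLinearEquiv
  have hL : HasFDerivAt g (L : ℂ × ℂ →L[ℂ] ℂ × ℂ) (χ p) := by
    have h1 : (L : ℂ × ℂ →L[ℂ] ℂ × ℂ) = fderiv ℂ g (χ p) := by
      ext <;> rfl
    rw [h1]
    exact (hg.differentiable (by simp) _).hasFDerivAt
  have hω : (ω : WithTop ℕ∞) ≠ 0 := by simp
  set f := hg.contDiffAt.toOpenPartialHomeomorph g hL hω with hf
  have hfg : ∀ z, f z = g z := fun _ => rfl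
  have hs : χ p ∈ f.source := hg.contDiffAt.mem_toOpenPartialHomeomorph_source hL hω
  have hω' : (ω : WithTop ℕ∞) ≠ (⊤ : ℕ∞) := by simp
  -- The inverse function theorem gives a homeomorphism; it is restricted to the points where it and
  -- its inverse are analytic, so that the composite is a chart of the maximal atlas.
  set e := f.restrContDiff ℂ ω hω' with he
  have hs' : χ p ∈ e.source := by
    refine ⟨hs, hg.contDiffAt, f.contDiffAt_symm (f₀' := L) (f.map_source hs) ?_ ?_⟩
    · rw [f.left_inv hs]
      exact hL
    · exact hg.contDiffAt
  refine ⟨χ.trans e, ?_, ?_, ?_, fun q => rfl⟩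
  · refine OpenPartialHomeomorph.mem_maximalAtlas_of_contMDiffOn _ ?_ ?_
    · exact (contMDiffOn_iff_contDiffOn.2 (f.contDiffOn_restrContDiff_source ℂ hω')).comp
        ((contMDiffOn_of_mem_maximalAtlas hχ).mono Set.inter_subset_left) fun q hq => hq.2
    · exact (contMDiffOn_symm_of_mem_maximalAtlas hχ).comp
        ((contMDiffOn_iff_contDiffOn.2 (f.contDiffOn_restrContDiff_target ℂ hω')).mono
          Set.inter_subset_left) fun q hq => hq.2
  · exact ⟨hp, hs'⟩
  · exact fun q hq => hq.1

/-- A submersive equation `g` is completed to local coordinates `(l, g)` by whichever of the two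
linear coordinates is independent of its differential. -/
theorem exists_isAdaptedChart {Γ : Set S} (hχ : χ ∈ IsManifold.maximalAtlas 𝓘(ℂ, ℂ × ℂ) ω S)
    (hp : p ∈ χ.source) {g : ℂ × ℂ → ℂ} (hg : ContDiff ℂ ω g)
    (hΓ : ∀ q ∈ χ.source, q ∈ Γ ↔ g (χ q) = 0) (h : fderiv ℂ g (χ p) ≠ 0) :
    ∃ φ, IsAdaptedChart Γ φ ∧ p ∈ φ.source := by
  have hd := (hg.differentiable (by simp) (χ p)).hasFDerivAt
  have key : ∃ l : ℂ × ℂ →L[ℂ] ℂ,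
      Function.Injective (fderiv ℂ (fun z => (l z, g z)) (χ p)) := by
    rcases clm_prod_ne_zero h with h1 | h1
    · refine ⟨ContinuousLinearMap.snd ℂ ℂ ℂ, ?_⟩
      rw [((ContinuousLinearMap.snd ℂ ℂ ℂ).hasFDerivAt.prodMk hd).fderiv,
        injective_iff_map_eq_zero]
      intro w hw
      have h2 : w.2 = 0 := congrArg Prod.fst hw
      have h3 : fderiv ℂ g (χ p) w = 0 := congrArg Prod.snd hw
      rw [clm_prod_eq, h2, zero_mul, add_zero] at h3
      exact Prod.ext ((mul_eq_zero.1 h3).resolve_right h1) h2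
    · refine ⟨ContinuousLinearMap.fst ℂ ℂ ℂ, ?_⟩
      rw [((ContinuousLinearMap.fst ℂ ℂ ℂ).hasFDerivAt.prodMk hd).fderiv,
        injective_iff_map_eq_zero]
      intro w hw
      have h2 : w.1 = 0 := congrArg Prod.fst hw
      have h3 : fderiv ℂ g (χ p) w = 0 := congrArg Prod.snd hw
      rw [clm_prod_eq, h2, zero_mul, zero_add] at h3
      exact Prod.ext h2 ((mul_eq_zero.1 h3).resolve_right h1)
  obtain ⟨l, hl⟩ := key
  obtain ⟨φ, h1, h2, h3, h4⟩ := exists_chart_of_coords hχ hp (l.contDiff.prodMk hg) hl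
  refine ⟨φ, ⟨h1, fun q hq => ?_⟩, h2⟩
  rw [h4, hΓ q (h3 hq)]

end Surface

/-! ### The equation of a curve in the coordinates of a blow-up -/

/-- `f.1` and `f.2` are the coefficients of an expansion of the affine equation of `F` at the
origin. -/
structure IsExpansion (F : MvPolynomial (Fin 3) ℂ) (A : Matrix (Fin 3) (Fin 3) ℂ)
    (f : (ℂ × ℂ → ℂ) × (ℂ × ℂ → ℂ)) : Prop where
  contDiff_fst : ContDiff ℂ ω f.1
  contDiff_snd : ContDiff ℂ ω f.2
  eq : ∀ z, affEq F A z = affEq F A 0 + z.1 * f.1 z + z.2 * f.2 z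

/-- A first-order expansion with polynomial remainder coefficients, built by induction: multiplying
by a homogeneous coordinate, which is affine in `(x, y)`, preserves the form. It allows division by
`x` after the substitution `y = x u`. -/
theorem exists_isExpansion (F : MvPolynomial (Fin 3) ℂ) (A : Matrix (Fin 3) (Fin 3) ℂ) :
    ∃ f, IsExpansion F A f := by
  induction F using MvPolynomial.induction_on with
  | C c =>
    refine ⟨(fun _ => 0, fun _ => 0), contDiff_const, contDiff_const, fun z => ?_⟩
    simp [affEq]
  | add F G hF hG =>
    obtain ⟨f, h1, h2, h3⟩ := hF
    obtain ⟨g, h4, h5, h6⟩ := hG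
    refine ⟨(fun z => f.1 z + g.1 z, fun z => f.2 z + g.2 z), h1.add h4, h2.add h5, fun z => ?_⟩
    have h7 : ∀ z, affEq (F + G) A z = affEq F A z + affEq G A z := fun z => by simp [affEq]
    rw [h7, h7, h3, h6]
    ring
  | mul_X F i hF =>
    obtain ⟨f, h1, h2, h3⟩ := hF
    have hl : ∀ z : ℂ × ℂ, affineVec A z.1 z.2 i = A⁻¹ i 0 + A⁻¹ i 1 * z.1 + A⁻¹ i 2 * z.2 := by
      intro z
      simp [affineVec, Matrix.mulVec, dotProduct, Fin.sum_univ_three]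
    have h4 : ContDiff ℂ ω fun z : ℂ × ℂ => affineVec A z.1 z.2 i := by
      simp only [hl]
      fun_prop
    refine ⟨(fun z => affEq F A 0 * A⁻¹ i 1 + f.1 z * affineVec A z.1 z.2 i,
      fun z => affEq F A 0 * A⁻¹ i 2 + f.2 z * affineVec A z.1 z.2 i),
      contDiff_const.add (h1.mul h4), contDiff_const.add (h2.mul h4), fun z => ?_⟩
    have h7 : ∀ z, affEq (F * MvPolynomial.X i) A z = affEq F A z * affineVec A z.1 z.2 i :=
      fun z => by simp [affEq]
    rw [h7, h7, h3, hl 0]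
    simp only [hl z, Prod.fst_zero, Prod.snd_zero]
    ring

/-- The equation of the strict transform in the coordinates `(x, u)`, `y = x u`. -/
def strictEq (f : (ℂ × ℂ → ℂ) × (ℂ × ℂ → ℂ)) (z : ℂ × ℂ) : ℂ :=
  f.1 (z.1, z.1 * z.2) + z.2 * f.2 (z.1, z.1 * z.2)

variable {F : MvPolynomial (Fin 3) ℂ} {A : Matrix (Fin 3) (Fin 3) ℂ} {d : ℕ}
  {f : (ℂ × ℂ → ℂ) × (ℂ × ℂ → ℂ)}

theorem IsExpansion.contDiff_strictEq (h : IsExpansion F A f) : ContDiff ℂ ω (strictEq f) := by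
  have h1 : ContDiff ℂ ω fun z : ℂ × ℂ => (z.1, z.1 * z.2) := by fun_prop
  exact (h.contDiff_fst.comp h1).add (_root_.contDiff_snd.mul (h.contDiff_snd.comp h1))

theorem IsExpansion.affEq_eq (h : IsExpansion F A f) (h0 : affEq F A 0 = 0) (z : ℂ × ℂ) :
    affEq F A (z.1, z.1 * z.2) = z.1 * strictEq f z := by
  rw [h.eq, h0, strictEq]
  ring

theorem IsExpansion.fderiv_eq (h : IsExpansion F A f) (w : ℂ × ℂ) :
    fderiv ℂ (affEq F A) 0 w = w.1 * f.1 0 + w.2 * f.2 0 := by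
  have h1 := (h.contDiff_fst.differentiable (by simp) 0).hasFDerivAt
  have h2 := (h.contDiff_snd.differentiable (by simp) 0).hasFDerivAt
  have h3 := ((hasFDerivAt_fst (𝕜 := ℂ) (p := (0 : ℂ × ℂ))).mul h1).const_add (affEq F A 0)
  have h4 := h3.add ((hasFDerivAt_snd (𝕜 := ℂ) (p := (0 : ℂ × ℂ))).mul h2)
  have h5 : affEq F A =ᶠ[𝓝 0] _ := Eventually.of_forall h.eq
  rw [(h4.congr_of_eventuallyEq h5).fderiv]
  simp [mul_comm]

/-- On the exceptional line the strict equation is `f.1 0 + u * f.2 0`. If it vanished together with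
`f.2 0`, both partial derivatives of the affine equation would be zero at the centre. -/
theorem IsExpansion.ne_zero (h : IsExpansion F A f) (hF : F.IsHomogeneous d)
    (hsm : IsSmoothForm F) (hA : A.det ≠ 0) (h0 : affEq F A 0 = 0) {u : ℂ}
    (hu : strictEq f (0, u) = 0) : f.2 0 ≠ 0 := by
  intro h2
  refine fderiv_affEq_ne_zero hF hsm hA h0 (ContinuousLinearMap.ext fun w => ?_)
  have h3 : ((0 : ℂ), (0 : ℂ)) = 0 := rfl
  rw [strictEq, zero_mul, h3, h2, mul_zero, add_zero] at hu
  rw [h.fderiv_eq, hu, h2]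
  simp

/-- Restricted to `x = 0` the strict equation is affine in `u`. With `IsExpansion.ne_zero`, this
shows that the strict transform is smooth over a centre and crosses the exceptional line
transversally. -/
theorem IsExpansion.fderiv_strictEq (h : IsExpansion F A f) (u : ℂ) :
    fderiv ℂ (strictEq f) (0, u) (0, 1) = f.2 0 := by
  have h1 : HasDerivAt (fun t : ℂ => ((0 : ℂ), t)) (0, 1) u :=
    (hasDerivAt_const u 0).prodMk (hasDerivAt_id u)
  have h2 := (h.contDiff_strictEq.differentiable (by simp) (0, u)).hasFDerivAt.comp_hasDerivAt u h1
  have h3 : HasDerivAt (fun t : ℂ => f.1 0 + t * f.2 0) (1 * f.2 0) u :=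
    ((hasDerivAt_id u).mul_const _).const_add _
  have h4 : (strictEq f ∘ fun t : ℂ => ((0 : ℂ), t)) = fun t => f.1 0 + t * f.2 0 := by
    ext t
    simp only [Function.comp_apply, strictEq, zero_mul]
    rfl
  rw [h4] at h2
  rw [h2.unique h3, one_mul]

end

section

open MvPolynomial (eval)
open Filter ProjectivePlane

theorem smul_affineVec {A : Matrix (Fin 3) (Fin 3) ℂ} (hA : A.det ≠ 0) {w : Fin 3 → ℂ}
    (h0 : A 0 ⬝ᵥ w ≠ 0) :
    (A 0 ⬝ᵥ w) • affineVec A (A 1 ⬝ᵥ w / A 0 ⬝ᵥ w) (A 2 ⬝ᵥ w / A 0 ⬝ᵥ w) = w := by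
  refine eq_of_forms_eq hA fun i => ?_
  rw [dotProduct_smul, dot_affineVec hA, smul_eq_mul]
  fin_cases i
  · exact mul_one _
  · exact mul_div_cancel₀ _ h0
  · exact mul_div_cancel₀ _ h0

theorem apply_eq_zero_of_mem_closure {M : Type*} [TopologicalSpace M] {U : Set M}
    (χ : OpenPartialHomeomorph M (ℂ × ℂ)) {g : ℂ × ℂ → ℂ} (hg : Continuous g)
    (h : ∀ q ∈ χ.source, q ∈ U → g (χ q) = 0) {q : M} (hq : q ∈ χ.source) (hU : q ∈ closure U) :
    g (χ q) = 0 := by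
  by_contra h0
  obtain ⟨r, ⟨hr, hr'⟩, hrU⟩ := mem_closure_iff.1 hU _
    (χ.continuousOn.isOpen_inter_preimage χ.open_source (isOpen_ne_fun hg continuous_const))
    ⟨hq, h0⟩
  exact hr' (h r hr hrU)

namespace BlowUp

variable {P : Finset ProjectivePlane} {F : MvPolynomial (Fin 3) ℂ} {d : ℕ}
  {A : Matrix (Fin 3) (Fin 3) ℂ} {χ : OpenPartialHomeomorph (BlowUp P) (ℂ × ℂ)} {x : BlowUp P}
  {p : P} {f : (ℂ × ℂ → ℂ) × (ℂ × ℂ → ℂ)}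

/-! ### Charts of the blow-up -/

theorem exists_ordinaryChart (hx : ∀ q ∈ P, x.point ≠ q) (hA : A.det ≠ 0)
    (h0 : A 0 ⬝ᵥ x.point.rep ≠ 0) :
    ∃ χ ∈ IsManifold.maximalAtlas 𝓘(ℂ, ℂ × ℂ) ω (BlowUp P),
      IsOrdinaryChart A χ.toPartialEquiv ∧ x ∈ χ.source := by
  obtain ⟨e, he⟩ := exists_isOrdinaryChart x hA
  obtain ⟨χ, hχ, rfl⟩ := surfaceAtlas.exists_openPartialHomeomorph (e := e) (Or.inl ⟨A, he⟩)
  exact ⟨χ, hχ, he, by rw [he.source_eq]; exact ⟨h0, hx⟩⟩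

theorem exists_exceptionalChart (hx : x.point = p) (hA : A.det ≠ 0)
    (h0 : A 0 ⬝ᵥ p.1.rep ≠ 0) (h1 : A 1 ⬝ᵥ p.1.rep = 0) (h2 : A 2 ⬝ᵥ p.1.rep = 0)
    (hl : A⁻¹ᵀ 2 ⬝ᵥ (x.line p).rep ≠ 0) :
    ∃ χ ∈ IsManifold.maximalAtlas 𝓘(ℂ, ℂ × ℂ) ω (BlowUp P),
      IsExceptionalChart p A χ.toPartialEquiv ∧ x ∈ χ.source := by
  obtain ⟨e, he⟩ := exists_isExceptionalChart x p hA h1 h2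
  obtain ⟨χ, hχ, rfl⟩ := surfaceAtlas.exists_openPartialHomeomorph (e := e) (Or.inr ⟨p, A, he⟩)
  refine ⟨χ, hχ, he, ?_⟩
  rw [he.source_eq]
  exact ⟨by rw [hx]; exact h0, fun q _ hq => by rw [hx]; exact hq.symm, hl⟩

theorem exists_exceptionalChart_mem (hx : x.point = p) : ∃ A,
    ∃ χ ∈ IsManifold.maximalAtlas 𝓘(ℂ, ℂ × ℂ) ω (BlowUp P),
      IsExceptionalChart p A χ.toPartialEquiv ∧ x ∈ χ.source := by
  have hc := dot_eq_zero (x.center_mem p)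
  obtain ⟨A, hA, h0, h1, h2⟩ := exists_forms p.1.rep_nonzero (x.line p).rep_nonzero hc
  refine ⟨A, exists_exceptionalChart hx hA h0 h1 (by rw [h2, dotProduct_comm]; exact hc) ?_⟩
  rw [← h2, inv_transpose_dot hA]
  simp

theorem Lifts.isChartLift {V : ℂ × ℂ → Fin 3 → ℂ} {W : P → ℂ × ℂ → Fin 3 → ℂ}
    (h : Lifts χ.toPartialEquiv V W) : IsChartLift point χ V := h.point_eq

theorem IsOrdinaryChart.eval_eq_zero_iff (he : IsOrdinaryChart A χ.toPartialEquiv)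
    (hF : F.IsHomogeneous d) (hx : x ∈ χ.source) :
    eval x.point.rep F = 0 ↔ affEq F A (χ x) = 0 := by
  have h1 := he.point_eq (χ.map_source hx)
  have h2 : χ.toPartialEquiv.symm (χ x) = x := χ.left_inv hx
  rw [h2] at h1
  rw [h1, eval_rep_mk hF]
  rfl

theorem IsExceptionalChart.eval_eq_zero_iff (he : IsExceptionalChart p A χ.toPartialEquiv)
    (hF : F.IsHomogeneous d) (hx : x ∈ χ.source) :
    eval x.point.rep F = 0 ↔ affEq F A ((χ x).1, (χ x).1 * (χ x).2) = 0 := by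
  rw [(he.eq_mk hx).1, eval_rep_mk hF]
  rfl

theorem IsExceptionalChart.dot_ne_zero (he : IsExceptionalChart p A χ.toPartialEquiv) :
    A 0 ⬝ᵥ p.1.rep ≠ 0 := fun h0 => p.1.rep_nonzero <| by
  refine eq_of_forms_eq he.det_ne_zero fun i => ?_
  rw [dotProduct_zero]
  fin_cases i
  exacts [h0, he.center_one, he.center_two]

/-- The second and third forms vanish at the centre, so it is the origin of the affine coordinates.
-/
theorem IsExceptionalChart.mk_eq (he : IsExceptionalChart p A χ.toPartialEquiv) :
    Projectivization.mk ℂ (affineVec A 0 0) (affineVec_ne_zero he.det_ne_zero 0 0) = p := by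
  have h1 := smul_affineVec he.det_ne_zero he.dot_ne_zero
  rw [he.center_one, he.center_two, zero_div] at h1
  conv_rhs => rw [← Projectivization.mk_rep p.1]
  rw [Projectivization.mk_eq_mk_iff']
  exact ⟨(A 0 ⬝ᵥ p.1.rep)⁻¹, by rw [inv_smul_eq_iff₀ he.dot_ne_zero, h1]⟩

theorem IsExceptionalChart.affEq_zero (he : IsExceptionalChart p A χ.toPartialEquiv)
    (hF : F.IsHomogeneous d) (hp : eval p.1.rep F = 0) : affEq F A 0 = 0 := by
  rw [← he.mk_eq, eval_rep_mk hF] at hp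
  exact hp

theorem IsExceptionalChart.point_eq_iff (he : IsExceptionalChart p A χ.toPartialEquiv)
    (hx : x ∈ χ.source) : x.point ∈ P ↔ (χ x).1 = 0 := by
  have hs : x ∈ χ.toPartialEquiv.source := hx
  rw [he.source_eq] at hs
  constructor
  · intro h
    have h1 : x.point = p := by
      by_contra h2
      exact hs.2.1 _ h h2 rfl
    have h3 : (χ x).1 = ratio (A 1) (A 0) x.point := congrArg Prod.fst (he.apply_eq x hx)
    rw [h3, h1, ratio, he.center_one, zero_div]
  · intro h
    have h1 := (he.eq_mk hx).1
    have h2 : (χ.toPartialEquiv x).1 = 0 := h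
    simp only [h2, zero_mul] at h1
    rw [h1, he.mk_eq]
    exact p.2

/-! ### The strict transform in charts -/

theorem IsOrdinaryChart.mem_strictTransform_iff (he : IsOrdinaryChart A χ.toPartialEquiv)
    (hF : F.IsHomogeneous d) (hx : x ∈ χ.source) :
    x ∈ strictTransform P {x | eval x.rep F = 0} ↔ affEq F A (χ x) = 0 := by
  constructor
  · intro h
    refine apply_eq_zero_of_mem_closure χ (contDiff_affEq F A).continuous (fun q hq hqU => ?_) hx h
    exact (he.eval_eq_zero_iff hF hq).1 hqU.1
  · intro h
    have hs : x ∈ χ.toPartialEquiv.source := hx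
    rw [he.source_eq] at hs
    exact subset_closure ⟨(he.eval_eq_zero_iff hF hx).2 h, fun h' => hs.2 _ h' rfl⟩

/-- Off the exceptional line the factor `x` is invertible, so the strict equation cuts out the
preimage of the curve, and by continuity it vanishes on the closure. Conversely, its zeros on the
exceptional line are limits of zeros with `x ≠ 0`. -/
theorem IsExceptionalChart.mem_strictTransform_iff (he : IsExceptionalChart p A χ.toPartialEquiv)
    (hF : F.IsHomogeneous d) (hsm : IsSmoothForm F) (hp : eval p.1.rep F = 0)
    (hf : IsExpansion F A f) (hx : x ∈ χ.source) :
    x ∈ strictTransform P {x | eval x.rep F = 0} ↔ strictEq f (χ x) = 0 := by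
  have h0 := he.affEq_zero hF hp
  have key : ∀ q ∈ χ.source, (χ q).1 ≠ 0 →
      (q.point ∈ {x : ProjectivePlane | eval x.rep F = 0} \ (P : Set ProjectivePlane) ↔
        strictEq f (χ q) = 0) := by
    intro q hq hq0
    have h1 : q.point ∉ (P : Set ProjectivePlane) := fun h => hq0 ((he.point_eq_iff hq).1 h)
    refine (and_iff_left h1).trans ((he.eval_eq_zero_iff hF hq).trans ?_)
    rw [hf.affEq_eq h0, mul_eq_zero, or_iff_right hq0]
  constructor
  · intro h
    refine apply_eq_zero_of_mem_closure χ hf.contDiff_strictEq.continuous (fun q hq hqU => ?_) hx h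
    exact (key q hq fun h => hqU.2 ((he.point_eq_iff hq).2 h)).1 hqU
  · intro h
    by_cases hx0 : (χ x).1 = 0
    · have hχx : χ x = (0, (χ x).2) := Prod.ext hx0 rfl
      have h2 : fderiv ℂ (strictEq f) (χ x) (0, 1) ≠ 0 := by
        rw [hχx, hf.fderiv_strictEq]
        rw [hχx] at h
        exact hf.ne_zero hF hsm he.det_ne_zero h0 h
      -- The strict transform is a graph `u = η(x)` here, so the points `(t, η t)` with `t ≠ 0`
      -- approach `x` from outside the exceptional line.
      obtain ⟨η, hη, hη0, hηe⟩ := exists_implicit_snd hf.contDiff_strictEq.contDiffAt h h2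
      rw [hx0] at hη hη0
      have h3 : Tendsto (fun t : ℂ => (t, η t)) (𝓝 0) (𝓝 (χ x)) := by
        have := continuousAt_id.prodMk hη.continuousAt
        rw [ContinuousAt, id, hη0, ← hχx] at this
        exact this
      have h4 : Tendsto (fun t : ℂ => χ.symm (t, η t)) (𝓝[≠] 0) (𝓝 x) := by
        have h5 := (χ.continuousAt_symm (χ.map_source hx)).tendsto.comp h3
        rw [χ.left_inv hx] at h5
        exact h5.mono_left nhdsWithin_le_nhds
      refine mem_closure_of_tendsto h4 ?_
      filter_upwards [nhdsWithin_le_nhds (h3.eventually hηe), self_mem_nhdsWithin,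
        nhdsWithin_le_nhds (h3.eventually (χ.open_target.mem_nhds (χ.map_source hx)))]
        with t h5 h6 h7
      have h8 := key _ (χ.map_target h7)
      rw [χ.right_inv h7] at h8
      exact (h8 h6).2 (h5.2 rfl)
    · exact subset_closure ((key x hx hx0).2 h)

theorem eval_eq_zero_of_mem_strictTransform (hF : F.IsHomogeneous d)
    (hP : ∀ p ∈ P, eval p.rep F = 0) (hx : x ∈ strictTransform P {x | eval x.rep F = 0}) :
    eval x.point.rep F = 0 := by
  by_cases h : x.point ∈ P
  · exact hP _ h
  · obtain ⟨A, hA, h0⟩ := exists_affine_forms x.point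
    obtain ⟨χ, -, he, hs⟩ := exists_ordinaryChart (fun q hq h' => h (h' ▸ hq)) hA h0
    exact (he.eval_eq_zero_iff hF hs).2 ((he.mem_strictTransform_iff hF hs).1 hx)

/-- The strict transform of a smooth plane curve at points of the curve is smooth. -/
theorem exists_isAdaptedChart_strictTransform (hF : F.IsHomogeneous d) (hsm : IsSmoothForm F)
    (hP : ∀ p ∈ P, eval p.rep F = 0) (hx : x ∈ strictTransform P {x | eval x.rep F = 0}) :
    ∃ φ, IsAdaptedChart (strictTransform P {x | eval x.rep F = 0}) φ ∧ x ∈ φ.source := by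
  by_cases h : x.point ∈ P
  · obtain ⟨A, χ, hχ, he, hs⟩ := exists_exceptionalChart_mem (x := x) (p := ⟨_, h⟩) rfl
    obtain ⟨f, hf⟩ := exists_isExpansion F A
    refine exists_isAdaptedChart hχ hs hf.contDiff_strictEq
      (fun q hq => he.mem_strictTransform_iff hF hsm (hP _ h) hf hq) fun h0 => ?_
    have hx0 : χ x = (0, (χ x).2) := Prod.ext ((he.point_eq_iff hs).1 h) rfl
    have h1 := (he.mem_strictTransform_iff hF hsm (hP _ h) hf hs).1 hx
    have h2 := hf.fderiv_strictEq (χ x).2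
    rw [← hx0, h0] at h2
    rw [hx0] at h1
    exact hf.ne_zero hF hsm he.det_ne_zero (he.affEq_zero hF (hP _ h)) h1 h2.symm
  · obtain ⟨A, hA, h0⟩ := exists_affine_forms x.point
    obtain ⟨χ, hχ, he, hs⟩ := exists_ordinaryChart (fun q hq h' => h (h' ▸ hq)) hA h0
    exact exists_isAdaptedChart hχ hs (contDiff_affEq F A)
      (fun q hq => he.mem_strictTransform_iff hF hq)
      (fderiv_affEq_ne_zero hF hsm hA ((he.mem_strictTransform_iff hF hs).1 hx))

end BlowUp

end

section

open MvPolynomial (eval)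
open Filter ProjectivePlane

namespace BlowUp

variable {P : Finset ProjectivePlane} {F : MvPolynomial (Fin 3) ℂ} {d : ℕ}

/-! ### The strict transform as a model of the plane curve -/

/-- `τ` maps a point of the plane to a point above it, and a centre of the blow-up to the direction
of the tangent line of `F = 0`. -/
def IsTangentLift (F : MvPolynomial (Fin 3) ℂ) (τ : ProjectivePlane → BlowUp P) : Prop :=
  ∀ q, (τ q).point = q ∧ ∀ p : P, q = p → ∀ h : gradient F p.1.rep ≠ 0,
    (τ q).line p = Projectivization.mk ℂ (gradient F p.1.rep) h

theorem exists_isTangentLift (hF : F.IsHomogeneous d) (hsm : IsSmoothForm F)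
    (hP : ∀ p ∈ P, eval p.rep F = 0) : ∃ τ : ProjectivePlane → BlowUp P, IsTangentLift F τ := by
  classical
  have hg : ∀ p : P, gradient F p.1.rep ≠ 0 := fun p => hsm _ p.1.rep_nonzero (hP p p.2)
  have ho : ∀ p : P, (p : ProjectivePlane).orthogonal (Projectivization.mk ℂ _ (hg p)) := fun p => by
    have h1 := Projectivization.orthogonal_mk p.1.rep_nonzero (hg p)
    rw [Projectivization.mk_rep] at h1
    rw [h1, dotProduct_comm, gradient_dot_self hF, hP p p.2, mul_zero]
  refine ⟨fun q => ⟨q, fun p => if q = p then Projectivization.mk ℂ _ (hg p) else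
    Projectivization.cross p q, fun p => ?_, fun p => ?_⟩, fun q => ⟨rfl, fun p hp _ => ?_⟩⟩
  · by_cases h : q = p
    · simp only [if_pos h]
      exact ho p
    · simp only [if_neg h]
      exact Projectivization.orthogonal_cross_left (Ne.symm h)
  · by_cases h : q = p
    · simp only [if_pos h]
      exact h.symm ▸ ho p
    · simp only [if_neg h]
      exact Projectivization.orthogonal_cross_right (Ne.symm h)
  · simp only [if_pos hp]

theorem eq_of_point_eq {x y : BlowUp P} (h : x.point = y.point) (hx : ∀ q ∈ P, x.point ≠ q) :
    x = y := by
  refine BlowUp.ext h (funext fun q => ?_)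
  rw [line_eq_cross x q (hx q q.2), line_eq_cross y q (h ▸ hx q q.2), h]

/-- Coordinates of the blow-up adapted to the tangent line of the curve at a centre. -/
structure IsTangentChart (F : MvPolynomial (Fin 3) ℂ) (τ : ProjectivePlane → BlowUp P) (p : P)
    (A : Matrix (Fin 3) (Fin 3) ℂ) (f : (ℂ × ℂ → ℂ) × (ℂ × ℂ → ℂ))
    (χ : OpenPartialHomeomorph (BlowUp P) (ℂ × ℂ)) : Prop where
  isExceptionalChart : IsExceptionalChart p A χ.toPartialEquiv
  mem_source : τ p ∈ χ.source
  apply_eq_zero : χ (τ p) = 0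
  isExpansion : IsExpansion F A f
  expansion_fst : f.1 0 = 0
  expansion_snd : f.2 0 ≠ 0

/-- Taking the gradient at the centre as the form `A 2` makes the tangent line the axis `y = 0`, of
slope zero. The lifted point is then the origin of the exceptional chart, and the linear term of the
equation in `x` is absent. -/
theorem IsTangentLift.exists_isTangentChart {τ : ProjectivePlane → BlowUp P}
    (hτ : IsTangentLift F τ) (hF : F.IsHomogeneous d) (hsm : IsSmoothForm F) {p : P}
    (hp : eval p.1.rep F = 0) : ∃ A f χ, IsTangentChart F τ p A f χ := by
  have hg : gradient F p.1.rep ≠ 0 := hsm _ p.1.rep_nonzero hp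
  have hpg : gradient F p.1.rep ⬝ᵥ p.1.rep = 0 := by rw [gradient_dot_self hF, hp, mul_zero]
  obtain ⟨A, hA, h0, h1, h2⟩ := exists_forms p.1.rep_nonzero hg (by rw [dotProduct_comm, hpg])
  have hline := (hτ p).2 p rfl hg
  obtain ⟨χ, -, he, hs⟩ := exists_exceptionalChart (hτ p).1 hA h0 h1 (by rw [h2, hpg]) (by
    rw [hline, dot_rep_mk, ← h2, inv_transpose_dot hA]
    simp)
  obtain ⟨f, hf⟩ := exists_isExpansion F A
  have haff := he.affEq_zero hF hp
  have hf1 : f.1 0 = 0 := by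
    have h3 := hf.fderiv_eq (1, 0)
    rw [fderiv_affEq] at h3
    have h4 := smul_affineVec hA h0
    rw [h1, h2, hpg, zero_div] at h4
    have h5 : A 2 = (A 0 ⬝ᵥ p.1.rep) ^ (d - 1) • gradient F (affineVec A 0 0) := by
      rw [← gradient_smul hF, h4, h2]
    have h6 : A 2 ⬝ᵥ (A⁻¹ *ᵥ ![0, 1, 0]) = 0 := congrFun (mul_inv_mulVec hA ![0, 1, 0]) 2
    rw [h5, smul_dotProduct, smul_eq_mul, mul_eq_zero,
      or_iff_right (pow_ne_zero _ h0)] at h6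
    have h7 : gradient F (affineVec A 0 0) ⬝ᵥ (A⁻¹ *ᵥ ![0, 1, 0]) =
      (1 : ℂ) * f.1 0 + 0 * f.2 0 := h3
    rw [h6] at h7
    simpa using h7.symm
  refine ⟨A, f, χ, he, hs, ?_, hf, hf1, ?_⟩
  · have h3 : χ (τ p) = _ := he.apply_eq _ hs
    rw [h3, (hτ p).1, hline, ratio_mk, ratio, h1, ← h2, inv_transpose_dot hA]
    simp
  · refine hf.ne_zero hF hsm hA haff (u := 0) ?_
    rw [strictEq, zero_mul, zero_mul, add_zero]
    exact hf1

theorem IsTangentLift.mem_strictTransform {τ : ProjectivePlane → BlowUp P}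
    (hτ : IsTangentLift F τ) (hF : F.IsHomogeneous d) (hsm : IsSmoothForm F)
    {q : ProjectivePlane} (hq : eval q.rep F = 0) :
    τ q ∈ strictTransform P {x | eval x.rep F = 0} := by
  by_cases h : q ∈ P
  · obtain ⟨A, f, χ, ht⟩ := hτ.exists_isTangentChart hF hsm (p := ⟨q, h⟩) hq
    rw [ht.isExceptionalChart.mem_strictTransform_iff hF hsm hq ht.isExpansion ht.mem_source,
      ht.apply_eq_zero, strictEq]
    simp only [Prod.fst_zero, Prod.snd_zero, zero_mul, add_zero]
    exact ht.expansion_fst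
  · refine subset_closure ?_
    rw [Set.mem_ofPred_eq, (hτ q).1]
    exact ⟨hq, h⟩

theorem IsTangentLift.contMDiffAt {τ : ProjectivePlane → BlowUp P} (hτ : IsTangentLift F τ)
    {v : Fin 3 → ℂ} (hv : v ≠ 0) (hvP : Projectivization.mk ℂ v hv ∉ P) :
    ContMDiffAt 𝓘(ℂ, Fin 3 → ℂ) 𝓘(ℂ, ℂ × ℂ) ω (fun v => τ (planePoint v)) v := by
  obtain ⟨A, hA, h0⟩ := exists_affine_forms (Projectivization.mk ℂ v hv)
  have hpt : (τ (planePoint v)).point = Projectivization.mk ℂ v hv := by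
    rw [(hτ _).1, planePoint_eq hv]
  obtain ⟨χ, hχ, he, hs⟩ := exists_ordinaryChart (x := τ (planePoint v))
    (fun q hq h => hvP (by rw [← hpt, h]; exact hq)) hA (by rw [hpt]; exact h0)
  rw [dot_rep_mk] at h0
  refine contMDiffAt_of_affine_coords hχ h0 ?_
  have h1 : ∀ᶠ w in 𝓝 v, A 0 ⬝ᵥ w ≠ 0 :=
    (contDiff_dotProduct (A 0)).continuous.continuousAt.eventually_ne h0
  have h2 : ∀ᶠ w in 𝓝 v, ∀ q ∈ P, crossProduct q.rep w ≠ 0 := by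
    rw [Finset.eventually_all]
    intro q hq
    have hc : Continuous fun w : Fin 3 → ℂ => crossProduct q.rep w :=
      (LinearMap.toContinuousLinearMap (crossProduct q.rep)).continuous
    refine hc.continuousAt.eventually_ne fun h => hvP ?_
    rw [(mk_eq_iff_cross v hv q).2 h]
    exact hq
  filter_upwards [h1, h2, eventually_ne_nhds hv] with w hw hwP hw0
  have hpt' : (τ (planePoint w)).point = Projectivization.mk ℂ w hw0 := by
    rw [(hτ _).1, planePoint_eq hw0]
  have hs' : τ (planePoint w) ∈ χ.toPartialEquiv.source := by
    rw [he.source_eq]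
    refine ⟨by rw [hpt']; exact (dot_rep_mk _ _ _).2 hw, fun q hq h => hwP q hq ?_⟩
    rw [hpt'] at h
    exact (mk_eq_iff_cross w hw0 q).1 h
  refine ⟨hs', (he.apply_eq _ hs').trans ?_⟩
  rw [hpt', ratio_mk, ratio_mk]

/-- Only continuity along the cone can be expected at a centre, since the direction from the centre
has no limit in the plane. On the curve, the relation `x f₁ + y f₂ = 0` gives the slope as `-f₁ /
f₂`, which extends continuously because `f₂` is nonzero at the centre. -/
theorem IsTangentLift.tendsto {τ : ProjectivePlane → BlowUp P} (hτ : IsTangentLift F τ)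
    (hF : F.IsHomogeneous d) (hsm : IsSmoothForm F) {v : Fin 3 → ℂ} (hv : v ∈ cone F) :
    Tendsto (fun v => τ (planePoint v)) (𝓝[cone F] v) (𝓝 (τ (planePoint v))) := by
  by_cases hvP : Projectivization.mk ℂ v hv.1 ∈ P
  swap
  · exact tendsto_nhdsWithin_of_tendsto_nhds (hτ.contMDiffAt hv.1 hvP).continuousAt.tendsto
  set p : P := ⟨_, hvP⟩ with hp
  have hpF : eval p.1.rep F = 0 := (eval_rep_mk hF hv.1).2 hv.2
  obtain ⟨A, f, χ, ht⟩ := hτ.exists_isTangentChart hF hsm hpF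
  have he := ht.isExceptionalChart
  have hA := he.det_ne_zero
  have h0 : A 0 ⬝ᵥ v ≠ 0 := (dot_rep_mk _ _ hv.1).1 he.dot_ne_zero
  have h1 : A 1 ⬝ᵥ v = 0 := not_not.1 ((dot_rep_mk _ _ hv.1).not.1 (not_not.2 he.center_one))
  have h2 : A 2 ⬝ᵥ v = 0 := not_not.1 ((dot_rep_mk _ _ hv.1).not.1 (not_not.2 he.center_two))
  have hpv : planePoint v = p := planePoint_eq hv.1
  let c : (Fin 3 → ℂ) → ℂ × ℂ := fun w => (A 1 ⬝ᵥ w / A 0 ⬝ᵥ w, A 2 ⬝ᵥ w / A 0 ⬝ᵥ w)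
  have hc : ContinuousAt c v := by
    have hd := fun i => (contDiff_dotProduct (A i)).continuous.continuousAt (x := v)
    exact ((hd 1).div (hd 0) h0).prodMk ((hd 2).div (hd 0) h0)
  have hcv : c v = 0 := by
    simp only [c, h1, h2, zero_div]
    rfl
  have hf1 : ContinuousAt (fun w => f.1 (c w)) v :=
    ht.isExpansion.contDiff_fst.continuous.continuousAt.comp hc
  have hf2 : ContinuousAt (fun w => f.2 (c w)) v :=
    ht.isExpansion.contDiff_snd.continuous.continuousAt.comp hc
  have hf2v : f.2 (c v) ≠ 0 := by
    rw [hcv]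
    exact ht.expansion_snd
  -- Coordinates `(x, u)` of the lift, with the slope computed from the equation instead of the
  -- quotient `y / x`; continuous on a full neighbourhood and equal to the lift on the cone.
  let z : (Fin 3 → ℂ) → ℂ × ℂ := fun w => ((c w).1, -(f.1 (c w) / f.2 (c w)))
  have hz : ContinuousAt z v := hc.fst.prodMk (hf1.div hf2 hf2v).neg
  have hzv : z v = χ (τ (planePoint v)) := by
    rw [hpv, ht.apply_eq_zero]
    simp only [z, hcv, ht.expansion_fst, zero_div, neg_zero]
    rfl
  have hs : τ (planePoint v) ∈ χ.source := by
    rw [hpv]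
    exact ht.mem_source
  have h3 : Tendsto (fun w => χ.symm (z w)) (𝓝 v) (𝓝 (τ (planePoint v))) := by
    have h4 := χ.continuousAt_symm (χ.map_source hs)
    rw [← hzv] at h4
    have h5 := h4.tendsto.comp hz
    rw [hzv, χ.left_inv hs] at h5
    exact h5
  refine (tendsto_nhdsWithin_of_tendsto_nhds h3).congr' ?_
  have h4 : ∀ᶠ w in 𝓝 v, z w ∈ χ.target := by
    refine hz.eventually (χ.open_target.mem_nhds ?_)
    rw [hzv]
    exact χ.map_source hs
  have h5 : ∀ᶠ w in 𝓝 v, A 0 ⬝ᵥ w ≠ 0 :=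
    (contDiff_dotProduct (A 0)).continuous.continuousAt.eventually_ne h0
  filter_upwards [nhdsWithin_le_nhds h4, nhdsWithin_le_nhds h5, self_mem_nhdsWithin,
    nhdsWithin_le_nhds (hf2.eventually_ne hf2v)] with w hw hw0 hwF hwf
  have h6 := smul_affineVec hA hw0
  have h7 : affEq F A (c w) = 0 := by
    have h8 := hwF.2
    rw [← h6, eval_smul_of_isHomogeneous hF, mul_eq_zero, or_iff_right (pow_ne_zero _ hw0)] at h8
    exact h8
  have h8 : (z w).1 * (z w).2 = (c w).2 := by
    rw [ht.isExpansion.eq, he.affEq_zero hF hpF] at h7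
    simp only [z]
    field_simp
    linear_combination -h7
  have h9 : (χ.symm (z w)).point = planePoint w := by
    have h10 := (he.eq_mk (χ.map_target hw)).1
    have h11 : χ.toPartialEquiv (χ.symm (z w)) = z w := χ.right_inv hw
    simp only [h11, h8] at h10
    rw [h10, planePoint_eq hwF.1, Projectivization.mk_eq_mk_iff']
    exact ⟨(A 0 ⬝ᵥ w)⁻¹, by rw [inv_smul_eq_iff₀ hw0]; exact h6.symm⟩
  -- Off the centres a point of the blow-up is determined by its image in the plane. At a centre,
  -- which must be `p` in this chart, both points are the origin of the tangent chart.
  by_cases hwP : planePoint w ∈ P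
  · have h10 := (he.point_eq_iff (χ.map_target hw)).1 (by rw [h9]; exact hwP)
    rw [χ.right_inv hw] at h10
    have h11 : c w = 0 := Prod.ext h10 (by rw [← h8, h10, zero_mul]; rfl)
    have h12 : z w = χ (τ p) := by
      rw [ht.apply_eq_zero]
      simp only [z, h11, ht.expansion_fst, zero_div, neg_zero]
      rfl
    have h13 : planePoint w = p := by
      rw [← h9, h12, χ.left_inv ht.mem_source, (hτ p).1]
    rw [h12, χ.left_inv ht.mem_source, h13]
  · exact eq_of_point_eq (h9.trans (hτ _).1.symm) fun q hq h => hwP (by rw [← h9, h]; exact hq)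

end BlowUp

end

/-! ### Transverse fields along the strict transform. -/

section

open MvPolynomial (eval)
open Filter ProjectivePlane

namespace BlowUp

variable {P : Finset ProjectivePlane} {F : MvPolynomial (Fin 3) ℂ} {d : ℕ}
  {C : EmbeddedCurve (BlowUp P)} {X : LineField C} {s : (Fin 3 → ℂ) → BlowUp P}

/-- The inverse section is the tangent lift. It is holomorphic on open sets away from the centres
only, which suffices because the polar field needs to be analytic only where no pole is allowed. -/
theorem exists_isPlaneModel (hF : F.IsHomogeneous d) (hsm : IsSmoothForm F)
    (hP : ∀ p ∈ P, eval p.rep F = 0)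
    (hC : C.carrier = strictTransform P {x | eval x.rep F = 0}) :
    ∃ s, IsPlaneModel F C point s ∧ ∀ v (hv : v ∈ cone F), Projectivization.mk ℂ v hv.1 ∉ P →
      ContMDiffAt 𝓘(ℂ, Fin 3 → ℂ) 𝓘(ℂ, ℂ × ℂ) ω s v := by
  obtain ⟨τ, hτ⟩ := exists_isTangentLift hF hsm hP
  refine ⟨fun v => τ (planePoint v), ⟨fun z _ α hα => ?_, fun z hz => ?_, fun v hv => ?_,
    fun v hv => ?_, fun v hv c hc => ?_, fun v hv => hτ.tendsto hF hsm hv⟩,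
    fun v hv => hτ.contMDiffAt hv.1⟩
  · by_cases h : z.point ∈ P
    · obtain ⟨A, χ, hχ, he, hs⟩ := exists_exceptionalChart_mem (x := z) (p := ⟨_, h⟩) rfl
      exact he.lifts.isChartLift.contMDiffAt he.lifts.contDiff_point hχ hs hα
    · obtain ⟨A, hA, h0⟩ := exists_affine_forms z.point
      obtain ⟨χ, hχ, he, hs⟩ := exists_ordinaryChart (fun q hq h' => h (h' ▸ hq)) hA h0
      exact he.lifts.isChartLift.contMDiffAt he.lifts.contDiff_point hχ hs hα
  · rw [hC] at hz
    exact eval_eq_zero_of_mem_strictTransform hF hP hz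
  · rw [hC, planePoint_eq hv.1]
    exact hτ.mem_strictTransform hF hsm ((eval_rep_mk hF hv.1).2 hv.2)
  · rw [(hτ _).1, planePoint_eq hv.1]
  · congr 1
    rw [planePoint_eq hv.1, planePoint_eq (smul_ne_zero hc hv.1), Projectivization.mk_eq_mk_iff']
    exact ⟨c, rfl⟩

/-- In the exceptional chart `F` is `x` times the strict equation. Along the curve the strict
equation is zero, so the derivative of `F` is `x` times the derivative of the strict equation. The
second factor is bounded below for a field with nonzero normal component, and `x` has a simple zero
along the curve. Hence the pole at a centre is at most simple. -/
theorem exists_norm_le_generatorDeriv_exceptional (h : IsPlaneModel F C point s)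
    (hF : F.IsHomogeneous d) (hsm : IsSmoothForm F) (hP : ∀ p ∈ P, eval p.rep F = 0)
    (hC : C.carrier = strictTransform P {x | eval x.rep F = 0}) {v : Fin 3 → ℂ}
    (hv : v ∈ cone F) (hvP : Projectivization.mk ℂ v hv.1 ∈ P)
    {φ : OpenPartialHomeomorph (BlowUp P) (ℂ × ℂ)} {a b : ℂ → ℂ}
    (hg : IsLocalGenerator C X.line ⟨s v, h.mem v hv⟩ φ a b) (hb : b (φ (s v)).1 ≠ 0) :
    ∃ α : Fin 3 → ℂ, α ⬝ᵥ v ≠ 0 ∧ ∃ M : ℝ, ∀ᶠ t in 𝓝 (φ (s v)).1,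
      ‖t - (φ (s v)).1‖ ≤ M * ‖generatorDeriv F point φ α a b t‖ := by
  obtain ⟨A, χ, hχ, he, hs⟩ := exists_exceptionalChart_mem (x := s v) (p := ⟨_, hvP⟩) (h.proj v hv)
  obtain ⟨f, hf⟩ := exists_isExpansion F A
  have hA := he.det_ne_zero
  have haff := he.affEq_zero hF (hP _ hvP)
  have hφ := hg.adapted.1
  have hφs : s v ∈ φ.source := hg.mem_source
  have hsv : φ (s v) = ((φ (s v)).1, 0) :=
    Prod.ext rfl ((hg.adapted.2 _ hφs).1 (h.mem v hv))
  have hmem : ∀ x ∈ χ.source, x ∈ C.carrier ↔ strictEq f (χ x) = 0 := fun x hx => by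
    rw [hC]
    exact he.mem_strictTransform_iff hF hsm (hP _ hvP) hf hx
  have hχv : χ (s v) = (0, (χ (s v)).2) :=
    Prod.ext ((he.point_eq_iff hs).1 (by rw [h.proj v hv]; exact hvP)) rfl
  have hf2 : f.2 0 ≠ 0 := by
    have h1 := (hmem _ hs).1 (h.mem v hv)
    rw [hχv] at h1
    exact hf.ne_zero hF hsm hA haff h1
  refine ⟨A 0, (dot_rep_mk _ _ hv.1).1 he.dot_ne_zero, ?_⟩
  set t₀ := (φ (s v)).1 with ht₀
  set τ : ℂ × ℂ → ℂ × ℂ := χ ∘ φ.symm with hτ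
  have hsrc : ∀ᶠ y in 𝓝 (t₀, (0 : ℂ)), y ∈ φ.target ∧ φ.symm y ∈ χ.source := by
    rw [← hsv]
    refine Eventually.and (φ.open_target.mem_nhds (φ.map_source hφs)) ?_
    refine (φ.continuousAt_symm (φ.map_source hφs)).eventually ?_
    rw [φ.left_inv hφs]
    exact χ.open_source.mem_nhds hs
  have hi : Continuous fun t : ℂ => (t, (0 : ℂ)) := by fun_prop
  have hτd : ContDiffAt ℂ ω τ (t₀, 0) :=
    (transition_contDiffOn hφ hχ).contDiffAt (hsrc.mono fun y hy => hy)
  have hτ0 : τ (t₀, 0) = χ (s v) := by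
    rw [← hsv, hτ, Function.comp_apply, φ.left_inv hφs]
  have hGd : ContDiffAt ℂ ω (strictEq f ∘ τ) (t₀, 0) := hf.contDiff_strictEq.contDiffAt.comp _ hτd
  have hG0 : ∀ᶠ t in 𝓝 t₀, (strictEq f ∘ τ) (t, 0) = 0 := by
    filter_upwards [hi.continuousAt.eventually hsrc] with t ht
    exact (hmem _ ht.2).1 ((hg.adapted.2 _ (φ.map_target ht.1)).2 (by rw [φ.right_inv ht.1]))
  have hG1 : fderiv ℂ (strictEq f ∘ τ) (t₀, 0) ≠ 0 := by
    rw [← hsv]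
    refine fderiv_comp_transition_ne_zero hφ hχ hφs hs
      (hf.contDiff_strictEq.differentiable (by simp) _) fun h0 => hf2 ?_
    rw [← hf.fderiv_strictEq (χ (s v)).2, ← hχv, h0]
    rfl
  obtain ⟨M₁, hM₁0, hM₁⟩ := exists_norm_le_fderiv hGd hG0 hG1 a b
  obtain ⟨M₂, hM₂0, hM₂⟩ := eventually_le_mul_of_ne_zero hg.analyticAt_snd.continuousAt hb
  -- the order of vanishing of the equation of the exceptional line along the curve
  have hτ' := (hτd.differentiableAt (by simp)).hasFDerivAt
  have h1 : HasDerivAt (fun t : ℂ => (t, (0 : ℂ))) (1, 0) t₀ :=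
    (hasDerivAt_id t₀).prodMk (hasDerivAt_const t₀ 0)
  have h2 : HasDerivAt (fun t : ℂ => (τ (t, 0)).1) (fderiv ℂ τ (t₀, 0) (1, 0)).1 t₀ :=
    HasFDerivAt.comp_hasDerivAt (f := fun t : ℂ => (t, (0 : ℂ))) t₀ hτ'.fst h1
  -- A tangent vector of the curve with no `x` component would lie in the exceptional direction; the
  -- strict equation has nonzero derivative `f.2 0` there, so the vector would be zero.
  have h3 : (fderiv ℂ τ (t₀, 0) (1, 0)).1 ≠ 0 := by
    intro h0
    have h4 := fderiv_fst_eq_zero (hGd.differentiableAt (by simp)) hG0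
    have h5 := (hf.contDiff_strictEq.differentiable (by simp) (τ (t₀, 0))).hasFDerivAt
    rw [(h5.comp (t₀, (0 : ℂ)) hτ').fderiv, ContinuousLinearMap.comp_apply, clm_prod_eq, h0,
      zero_mul, zero_add, hτ0, hχv, hf.fderiv_strictEq, mul_eq_zero, or_iff_left hf2] at h4
    obtain ⟨ξ, hξ⟩ := (chartDeriv_bijective hφ hφs).2 (1, 0)
    have h6 := chartDeriv_transition hφ hχ hφs hs ξ
    rw [hξ, hsv] at h6
    have h7 : chartDeriv χ (s v) ξ = 0 := h6.trans (Prod.ext h0 h4)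
    have h8 : ξ = 0 := (chartDeriv_bijective hχ hs).1 (by rw [h7, map_zero])
    rw [h8, map_zero] at hξ
    exact one_ne_zero (congrArg Prod.fst hξ).symm
  obtain ⟨M₃, hM₃0, hM₃⟩ := (h2.isTheta_sub h3).2.exists_nonneg
  replace hM₃ := hM₃.bound
  rw [Filter.prod_pure, Filter.eventually_map] at hM₃
  refine ⟨M₃ * (M₂ * M₁), ?_⟩
  have hd : ∀ᶠ y in 𝓝 (t₀, (0 : ℂ)),
      DifferentiableAt ℂ τ y ∧ DifferentiableAt ℂ (strictEq f ∘ τ) y := by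
    filter_upwards [hτd.analyticAt.eventually_analyticAt, hGd.analyticAt.eventually_analyticAt]
      with y hy hy' using ⟨hy.differentiableAt, hy'.differentiableAt⟩
  filter_upwards [hM₁, hM₂, hM₃, hG0, hi.continuousAt.eventually hd,
    hi.continuousAt.eventually hsrc.eventually_nhds] with t k1 k2 k3 k4 k5 k6
  have e1 : (fun y => eval (chartLift point φ (A 0) y) F) =ᶠ[𝓝 (t, 0)]
      fun y => (τ y).1 * (strictEq f ∘ τ) y := by
    filter_upwards [k6] with y hy
    rw [chartLift, he.lifts.isChartLift.normLift_eq hy.2, dot_affineVec hA]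
    simp only [Matrix.cons_val_zero, inv_one, one_smul]
    exact hf.affEq_eq haff _
  have e2 : generatorDeriv F point φ (A 0) a b t =
      (τ (t, 0)).1 * fderiv ℂ (strictEq f ∘ τ) (t, 0) (a t, b t) := by
    have hfst : DifferentiableAt ℂ (fun y => (τ y).1) (t, 0) := k5.1.fst
    rw [generatorDeriv, e1.fderiv_eq, fderiv_fun_mul hfst k5.2, k4]
    simp
  have e3 : ‖t - t₀‖ ≤ M₃ * ‖(τ (t, 0)).1‖ := by
    have h9 : (τ (t₀, 0)).1 = 0 := by rw [hτ0, hχv]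
    rw [h9, sub_zero] at k3
    exact k3
  have e4 : 1 ≤ M₂ * ‖b t‖ := by simpa using k2 1
  rw [e2, norm_mul]
  calc ‖t - t₀‖ ≤ M₃ * ‖(τ (t, 0)).1‖ * 1 := by rw [mul_one]; exact e3
    _ ≤ M₃ * ‖(τ (t, 0)).1‖ * (M₂ * (M₁ *
        ‖fderiv ℂ (strictEq f ∘ τ) (t, 0) (a t, b t)‖)) := by
      gcongr
      exact e4.trans (by gcongr)
    _ = _ := by ring

/-- The polar field of a transverse line field has at most simple poles at the centres and no
others, so at most `d(d - 2)` in all, while a polar field has more than that. -/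
theorem not_isTransverse (hF : F.IsHomogeneous d) (hd : 2 ≤ d) (hsm : IsSmoothForm F)
    (hP : ∀ p ∈ P, eval p.rep F = 0) (hcard : P.card ≤ d * (d - 2))
    (hC : C.carrier = strictTransform P {x | eval x.rep F = 0}) (X : LineField C) :
    ¬ X.IsTransverse := by
  classical
  intro hX
  obtain ⟨s, hs, hreg⟩ := exists_isPlaneModel hF hsm hP hC
  let m : ProjectivePlane → ℕ := fun q => if q ∈ P then 1 else 0
  have hu : IsPolarField F d m (polarField F X point s) := by
    refine hs.isPolarField hF hd (fun v hv hm => hreg v hv fun h => ?_) fun v hv => ?_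
    · simp [m, h] at hm
    · obtain ⟨φ, a, b, hg⟩ := X.holomorphic ⟨s v, hs.mem v hv⟩
      have hb := hg.snd_ne_zero hX
      by_cases h : Projectivization.mk ℂ v hv.1 ∈ P
      · obtain ⟨α, hα, hM⟩ :=
          exists_norm_le_generatorDeriv_exceptional hs hF hsm hP hC hv h hg hb
        refine ⟨φ, a, b, α, hg, hα, ?_⟩
        simpa only [m, if_pos h, pow_one] using hM
      · obtain ⟨A, hA, h0⟩ := exists_affine_forms (s v).point
        obtain ⟨χ, hχ, he, hsχ⟩ := exists_ordinaryChart
          (fun q hq h' => h (by rw [← hs.proj v hv, h']; exact hq)) hA h0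
        obtain ⟨N, hN0, hN⟩ := hs.exists_norm_le_generatorDeriv hF hsm hv hg hχ hsχ hA
          he.lifts.isChartLift
        obtain ⟨M, hM0, hM⟩ := eventually_le_mul_of_ne_zero hg.analyticAt_snd.continuousAt hb
        refine ⟨φ, a, b, A 0, hg, (dot_rep_mk _ _ hv.1).1 (by rw [← hs.proj v hv]; exact h0),
          M * N, ?_⟩
        filter_upwards [hM, hN] with t h1 h2
        simp only [m, if_neg h, pow_zero]
        calc (1 : ℝ) ≤ M * ‖b t‖ := by simpa using h1 1
          _ ≤ M * (N * ‖generatorDeriv F point φ (A 0) a b t‖) := by gcongr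
          _ = _ := (mul_assoc _ _ _).symm
  have h1 := hu.lt_sum hF hd hsm (D := P) (fun q hq => if_neg hq) hP
  have h2 : ∑ q ∈ P, m q = P.card := by
    rw [Finset.card_eq_sum_ones]
    exact Finset.sum_congr rfl fun q hq => if_pos hq
  omega

end BlowUp

end

end CurvesInSurfaces

end

/-! ### The main theorem. -/

open CurvesInSurfaces
theorem mainTheorem7 (d : ℕ) (hd : 1 ≤ d) (C : EmbeddedCurve ProjectivePlane)
    (hC : IsSmoothPlaneCurve C.carrier d) :
    (∀ X : LineField C, (((d - 1) ^ 2 : ℕ) : ℕ∞) ≤ X.tang) ∧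
    (1 < d →
      (¬ ∃ X : LineField C, X.IsTransverse) ∧
      ¬ C.HasLinearizableNhd ∧
      ∀ P : Finset ProjectivePlane, (P : Set ProjectivePlane) ⊆ C.carrier →
        P.card = d ^ 2 - 2 * d →
        ∃ C' : EmbeddedCurve (BlowUp P),
          C'.carrier = BlowUp.strictTransform P C.carrier ∧
          (¬ ∃ X : LineField C', X.IsTransverse) ∧
          ¬ C'.HasLinearizableNhd) := by
  obtain ⟨F, hF, hCF, hpd⟩ := hC
  have hsm : IsSmoothForm F := fun v hv h0 => Function.ne_iff.2 (hpd v hv h0)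
  have h1 : ∀ X : LineField C, (((d - 1) ^ 2 : ℕ) : ℕ∞) ≤ X.tang := fun X => by
    -- For a line the bound is `0`; the argument with polar fields needs degree at least two.
    rcases hd.eq_or_lt with rfl | hd
    · simp
    · exact pow_le_tang hF hd hsm hCF X
  refine ⟨h1, fun hd => ?_⟩
  have h2 : ¬ ∃ X : LineField C, X.IsTransverse := by
    rintro ⟨X, hX⟩
    have h3 := h1 X
    -- A transverse field has no tangencies, whereas `(d - 1)²` is positive for `d > 1`.
    rw [hX.tang_eq_zero, nonpos_iff_eq_zero, Nat.cast_eq_zero] at h3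
    exact pow_ne_zero 2 (by omega) h3
  refine ⟨h2, fun h => h2 h.exists_isTransverse, fun P hP hcard => ?_⟩
  have hPF : ∀ p ∈ P, MvPolynomial.eval p.rep F = 0 := fun p hp => hCF.le (hP hp)
  have hle : P.card ≤ d * (d - 2) := by rw [hcard, Nat.mul_sub, pow_two, mul_comm 2 d]
  let C' : EmbeddedCurve (BlowUp P) :=
    ⟨BlowUp.strictTransform P {x | MvPolynomial.eval x.rep F = 0}, isClosed_closure, fun x hx =>
      BlowUp.exists_isAdaptedChart_strictTransform hF hsm hPF hx⟩
  have h3 : ¬ ∃ X : LineField C', X.IsTransverse := by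
    rintro ⟨X, hX⟩
    exact BlowUp.not_isTransverse hF hd hsm hPF hle rfl X hX
  exact ⟨C', by rw [hCF], h3, fun h => h3 h.exists_isTransverse⟩
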